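/- **Conventions.** Let $\mathbf K$ be a strict $2$-category; $F\circ G$ means "first $G$"; $\mathbf K^{\mathsf{co}}$ is $\mathbf K$ with reversed $2$-cells. *Opposite objects* on $\mathbf K$ consist of a (strict) $2$-equivalence $(-)^{\mathsf{op}}\colon\mathbf K^{\mathsf{co}}\to\mathbf K$ together with a $2$-natural isomorphism $\xi\colon \mathrm{id}_{\mathbf K^{\mathsf{co}}}\Rightarrow((-)^{\mathsf{op}})^{\mathsf{co}}\circ(-)^{\mathsf{op}}$. A *tangentad* $(X,\mathbb T)$ in $\mathbf K$ is an object $X$ with a $1$-cell $T\colon X\to X$; a $2$-cell $p\colon T\Rightarrow\mathrm{id}_X$ with chosen $n$-fold pullbacks $T_n$ of $p$ along itself ($T_1=T$), with projections $\pi_i\colon T_n\Rightarrow T$, which are pointwise (preserved by precomposition with every $1$-cell into $X$) and preserved by postcomposition with the iterates of $T$; and $2$-cells $z\colon\mathrm{id}_X\Rightarrow T$, $s\colon T_2\Rightarrow T$, $l\colon T\Rightarrow T^2$, $c\colon T^2\Rightarrow T^2$. These satisfy the equations of a tangent structure: $(p,z,s)$ is a commutative monoid over $\mathrm{id}_X$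 (an additive bundle); $(z,l)\colon \mathbf p\to T\mathbf p$ and $(\mathrm{id},c)\colon T\mathbf p\to\mathbf p_T$ are additive bundle morphisms; $Tl\cdot l=l_T\cdot l$, $c\cdot l=l$, $c_T\cdot Tc\cdot l_T=Tl\cdot c$, $c\cdot c=\mathrm{id}$, $Tc\cdot c_T\cdot Tc=c_T\cdot Tc\cdot c_T$; and the square with top $Ts\cdot(z_T\times l)\colon T_2\Rightarrow T^2$, left side $p\pi_1$, right side $Tp$ and bottom $z$ is a pointwise pullback. A *lax tangent morphism* $(F,\alpha)\colon(X,\mathbb T)\to(X',\mathbb T')$ is a $1$-cell $F\colon X\to X'$ with a $2$-cell $\alpha\colon F\circ T\Rightarrow T'\circ F$ such that $(\mathrm{id}_F,\alpha)\colon F\mathbf p\to\mathbf p'_F$ is an additive bundle morphism and $\alpha$ is compatible with $l,l'$ and $c,c'$. A *tangent $2$-morphism* $(F,\alpha)\Rightarrow(G,\beta)$ is a $2$-cell $\varphi\colon F\Rightarrow G$ with $T'\varphi\cdot\alpha=\beta\cdot\varphi T$. They form the $2$-category $\mathsf{Tng}(\mathbf K)$. A tangentad is *adjunctable* if $T$ and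 every $T_n$ have left adjoints $T^\flat\dashv T$, $T_n^\flat\dashv T_n$ in $\mathbf K$; $\mathsf{AdjTng}(\mathbf K)$ is the full sub-$2$-category of $\mathsf{Tng}(\mathbf K)$ on the adjunctable tangentads. **Theorem.** Let $\mathbf K$ be a strict $2$-category with opposite objects, and choose left adjoints $T^\flat\dashv T$, $T^\flat_n\dashv T_n$ for every adjunctable tangentad $(X,\mathbb T)$. Let $\mathbb T^\flat$ consist of $T^\flat$, the $1$-cells $T^\flat_n$, and the mates $p^\flat\colon\mathrm{id}_X\Rightarrow T^\flat$, $\pi_i^\flat\colon T^\flat\Rightarrow T_n^\flat$, $z^\flat\colon T^\flat\Rightarrow\mathrm{id}_X$, $s^\flat\colon T^\flat\Rightarrow T^\flat_2$, $l^\flat\colon T^\flat T^\flat\Rightarrow T^\flat$, $c^\flat\colon T^\flat T^\flat\Rightarrow T^\flat T^\flat$ of $p,\pi_i,z,s,l,c$. Then $\mathbb T^\flat$ is an op-tangent structure on $X$, i.e. a tangent structure on $X$ in $\mathbf K^{\mathsf{co}}$; $(X^{\mathsf{op}},(\mathbb T^\flat)^{\mathsf{op}})$ is an adjunctable tangentad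 in $\mathbf K$; and $\mathsf{AdjTng}(\mathbf K)$ admits opposite objects, with opposite $2$-functor $\mathsf{AdjTng}(\mathbf K)^{\mathsf{co}}\to\mathsf{AdjTng}(\mathbf K)$ given by $$(X,\mathbb T)\mapsto(X^{\mathsf{op}},(\mathbb T^\flat)^{\mathsf{op}}),\qquad (F,\alpha)\mapsto(F^{\mathsf{op}},(\alpha^\flat)^{\mathsf{op}}),\qquad \varphi\mapsto\varphi^{\mathsf{op}},$$ where $\alpha^\flat\colon T'^\flat\circ F\Rightarrow F\circ T^\flat$ is the mate of $\alpha$. -/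

import Mathlib

open CategoryTheory Bicategory Opposite

universe w v u w' v' u'

/-! ## The 2-cell dual of a bicategory, 2-natural isomorphisms, opposite objects -/

namespace TwoCat

/-- Objects of the 2-cell dual `K^co` of `K`. -/
@[ext]
structure Co (B : Type u) where
  /-- The object of `K^co` given by an object of `K`. -/
  of ::
  /-- The underlying object. -/
  as : B

/-- The 2-cell dual: same objects and 1-cells, `K^co(a, b) = K(a, b)ᵒᵖ`. -/
instance Co.bicategory (B : Type u) [Bicategory.{w, v} B] : Bicategory.{w, v} (Co B) where
  Hom a b := (a.as ⟶ b.as)ᵒᵖ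
  id a := op (𝟙 a.as)
  comp f g := op (f.unop ≫ g.unop)
  homCategory a b := inferInstanceAs (Category (a.as ⟶ b.as)ᵒᵖ)
  whiskerLeft f _ _ η := (f.unop ◁ η.unop).op
  whiskerRight η h := (η.unop ▷ h.unop).op
  associator f g h := (α_ f.unop g.unop h.unop).symm.op
  leftUnitor f := (λ_ f.unop).symm.op
  rightUnitor f := (ρ_ f.unop).symm.op
  whiskerLeft_id f g := Quiver.Hom.unop_inj (whiskerLeft_id f.unop g.unop)
  whiskerLeft_comp f _ _ _ η θ := Quiver.Hom.unop_inj (whiskerLeft_comp f.unop θ.unop η.unop)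
  id_whiskerLeft η := Quiver.Hom.unop_inj (by simp)
  comp_whiskerLeft f g _ _ η := Quiver.Hom.unop_inj (by simp)
  id_whiskerRight f g := Quiver.Hom.unop_inj (id_whiskerRight f.unop g.unop)
  comp_whiskerRight η θ i := Quiver.Hom.unop_inj (comp_whiskerRight θ.unop η.unop i.unop)
  whiskerRight_id η := Quiver.Hom.unop_inj (by simp)
  whiskerRight_comp η g h := Quiver.Hom.unop_inj (by simp)
  whisker_assoc f _ _ η h := Quiver.Hom.unop_inj (by simp)
  whisker_exchange η θ := Quiver.Hom.unop_inj (whisker_exchange η.unop θ.unop).symm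
  pentagon f g h i := Quiver.Hom.unop_inj
    ((Category.assoc _ _ _).trans (pentagon_inv f.unop g.unop h.unop i.unop))
  triangle f g := Quiver.Hom.unop_inj (triangle_assoc_comp_left_inv f.unop g.unop)

section

variable {B : Type u} [Bicategory.{w, v} B] {C : Type u'} [Bicategory.{w', v'} C]

/-- A 1-cell of `K`, as a 1-cell of `K^co`. -/
abbrev Co.hom {a b : B} (f : a ⟶ b) : Co.of a ⟶ Co.of b := op f

/-- A 2-cell `f ⟶ g` of `K`, as a 2-cell `g ⟶ f` of `K^co`. -/
abbrev Co.hom₂ {a b : B} {f g : a ⟶ b} (η : f ⟶ g) : Co.hom g ⟶ Co.hom f := η.op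

/-- The 1-cell of `K` underlying a 1-cell of `K^co`. -/
abbrev Co.un {a b : Co B} (f : a ⟶ b) : a.as ⟶ b.as := Opposite.unop f

/-- The 2-cell of `K` underlying a 2-cell of `K^co`, in the opposite direction. -/
abbrev Co.un₂ {a b : Co B} {f g : a ⟶ b} (η : f ⟶ g) : Co.un g ⟶ Co.un f := Quiver.Hom.unop η

theorem Co.un₂_injective {a b : Co B} {f g : a ⟶ b} {η θ : f ⟶ g} (h : Co.un₂ η = Co.un₂ θ) :
    η = θ :=
  Quiver.Hom.unop_inj h

theorem Co.un₂_comp {a b : Co B} {f g h : a ⟶ b} (η : f ⟶ g) (θ : g ⟶ h) :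
    Co.un₂ (η ≫ θ) = Co.un₂ θ ≫ Co.un₂ η := rfl

theorem Co.un₂_eqToHom {a b : Co B} {f g : a ⟶ b} (h : f = g) :
    Co.un₂ (eqToHom h) = eqToHom (congrArg Co.un h).symm := by
  subst h; rfl

theorem Co.eqToIso_op {a b : B} {f g : a ⟶ b} (h : f = g) (h' : Co.hom f = Co.hom g) :
    (eqToIso h).symm.op = (eqToIso h' : Co.hom f ≅ Co.hom g) := by
  subst h; rfl

instance Co.strict [Bicategory.Strict B] : Bicategory.Strict (Co B) where
  id_comp f := congrArg Co.hom (Bicategory.Strict.id_comp (Co.un f))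
  comp_id f := congrArg Co.hom (Bicategory.Strict.comp_id (Co.un f))
  assoc f g h := congrArg Co.hom (Bicategory.Strict.assoc (Co.un f) (Co.un g) (Co.un h))
  leftUnitor_eqToIso f := by
    change (λ_ (Co.un f)).symm.op = _
    rw [Bicategory.Strict.leftUnitor_eqToIso]
    exact Co.eqToIso_op _ _
  rightUnitor_eqToIso f := by
    change (ρ_ (Co.un f)).symm.op = _
    rw [Bicategory.Strict.rightUnitor_eqToIso]
    exact Co.eqToIso_op _ _
  associator_eqToIso f g h := by
    change (α_ (Co.un f) (Co.un g) (Co.un h)).symm.op = _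
    rw [Bicategory.Strict.associator_eqToIso]
    exact Co.eqToIso_op _ _

/-- A 2-functor `F : B^co ⟶ C`, regarded as a 2-functor `F^co : B ⟶ C^co`. -/
def coFunctor [Bicategory.Strict B] [Bicategory.Strict C] (F : StrictPseudofunctor (Co B) C) :
    StrictPseudofunctor B (Co C) :=
  StrictPseudofunctor.mk''
    { obj := fun a => Co.of (F.obj (Co.of a))
      map := fun f => Co.hom (F.map (Co.hom f))
      map₂ := fun η => Co.hom₂ (F.map₂ (Co.hom₂ η))
      map₂_id := fun f => congrArg Quiver.Hom.op (F.map₂_id (Co.hom f))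
      map₂_comp := fun η θ => congrArg Quiver.Hom.op (F.map₂_comp (Co.hom₂ θ) (Co.hom₂ η))
      map_id := fun a => congrArg op (F.map_id (Co.of a))
      map_comp := fun f g => congrArg op (F.map_comp (Co.hom f) (Co.hom g))
      map₂_whisker_left := fun f g g' η => by
        apply Co.un₂_injective
        have h := F.map₂_whisker_left (Co.hom f) (Co.hom₂ η)
        simp only [F.mapComp_eq_eqToIso] at h
        refine h.trans ?_
        rw [Co.un₂_comp, Co.un₂_comp, Co.un₂_eqToHom, Co.un₂_eqToHom, Category.assoc]
        rfl
      map₂_whisker_right := fun {_ _ _ f f'} η g => by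
        apply Co.un₂_injective
        have h := F.map₂_whisker_right (Co.hom₂ η) (Co.hom g)
        simp only [F.mapComp_eq_eqToIso] at h
        refine h.trans ?_
        rw [Co.un₂_comp, Co.un₂_comp, Co.un₂_eqToHom, Co.un₂_eqToHom, Category.assoc]
        rfl }

/-- A 2-natural isomorphism between (strict) 2-functors: a family of invertible 1-cells,
strictly natural with respect to 1-cells and to 2-cells. -/
structure TwoNatIso (F G : StrictPseudofunctor B C) where
  /-- The component at an object. -/
  app (a : B) : F.obj a ⟶ G.obj a
  /-- The inverse of the component. -/
  inv (a : B) : G.obj a ⟶ F.obj a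
  app_inv (a : B) : app a ≫ inv a = 𝟙 (F.obj a)
  inv_app (a : B) : inv a ≫ app a = 𝟙 (G.obj a)
  naturality {a b : B} (f : a ⟶ b) : F.map f ≫ app b = app a ≫ G.map f
  naturality₂ {a b : B} {f g : a ⟶ b} (η : f ⟶ g) :
    F.map₂ η ▷ app b ≫ eqToHom (naturality g) = eqToHom (naturality f) ≫ app a ◁ G.map₂ η

/-- A 2-functor is a 2-equivalence if it has an inverse up to 2-natural isomorphism. -/
def IsTwoEquivalence (F : StrictPseudofunctor B C) : Prop :=
  ∃ G : StrictPseudofunctor C B,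
    Nonempty (TwoNatIso (StrictPseudofunctor.id B) (F.comp G)) ∧
    Nonempty (TwoNatIso (G.comp F) (StrictPseudofunctor.id C))

end

/-- Opposite objects on a (strict) 2-category `K`: a 2-equivalence `op : K^co ⟶ K` together with
a 2-natural isomorphism `ξ : id ⟶ op^co ∘ op` of 2-functors `K^co ⟶ K^co`. -/
structure OppositeObjects (K : Type u) [Bicategory.{w, v} K] [Bicategory.Strict K] where
  /-- The opposite 2-functor. -/
  opp : StrictPseudofunctor (Co K) K
  isTwoEquivalence : IsTwoEquivalence opp
  /-- The comparison of an object with its double opposite. -/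
  ξ : TwoNatIso (StrictPseudofunctor.id (Co K)) (opp.comp (coFunctor opp))

end TwoCat

/-! ## Additive bundles in a category -/

namespace Tangentad

open TwoCat

/-- The data of an additive bundle over an object `base` of a category: a projection, the
(chosen) `n`-fold pullbacks `pow n` of the projection along itself with their projections `π n i`
(for `n ≥ 2`; the `1`-fold pullback is `total` itself), a zero morphism and a sum morphism. -/
structure BundleData {C : Type u} [Category.{v} C] (base : C) where
  /-- The total object. -/
  total : C
  /-- The projection. -/
  proj : total ⟶ base
  /-- The `n`-fold pullback of the projection along itself. -/
  pow (n : ℕ) [n.AtLeastTwo] : C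
  /-- The projections of the `n`-fold pullback. -/
  π (n : ℕ) [n.AtLeastTwo] (i : Fin n) : pow n ⟶ total
  /-- The zero morphism. -/
  zero : base ⟶ total
  /-- The sum morphism. -/
  add : pow 2 ⟶ total

namespace BundleData

section

variable {C : Type u} [Category.{v} C] {B B' B'' : C}

/-- The cone `π n` exhibits `pow n` as the `n`-fold pullback of the projection along itself. -/
def IsFoldPullback (q : BundleData B) (n : ℕ) [n.AtLeastTwo] : Prop :=
  (∀ i j, q.π n i ≫ q.proj = q.π n j ≫ q.proj) ∧
  ∀ (H : C) (f : Fin n → (H ⟶ q.total)), (∀ i j, f i ≫ q.proj = f j ≫ q.proj) →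
    ∃! u : H ⟶ q.pow n, ∀ i, u ≫ q.π n i = f i

/-- `u` is the morphism `⟨a, b⟩` into the two-fold pullback. -/
def IsPair (q : BundleData B) {H : C} (a b : H ⟶ q.total) (u : H ⟶ q.pow 2) : Prop :=
  u ≫ q.π 2 0 = a ∧ u ≫ q.π 2 1 = b

/-- Additive bundles. In each clause the morphisms `⟨a, b⟩` asserted to exist are unique, by the
universal property of the two-fold pullback. -/
structure IsAdditiveBundle (q : BundleData B) : Prop where
  isFoldPullback (n : ℕ) [n.AtLeastTwo] : q.IsFoldPullback n
  zero_proj : q.zero ≫ q.proj = 𝟙 B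
  add_proj : q.add ≫ q.proj = q.π 2 0 ≫ q.proj
  add_assoc : ∃ π₁₂ π₂₃ x y : q.pow 3 ⟶ q.pow 2,
    q.IsPair (q.π 3 0) (q.π 3 1) π₁₂ ∧ q.IsPair (q.π 3 1) (q.π 3 2) π₂₃ ∧
    q.IsPair (π₁₂ ≫ q.add) (q.π 3 2) x ∧ q.IsPair (q.π 3 0) (π₂₃ ≫ q.add) y ∧
    x ≫ q.add = y ≫ q.add
  zero_add : ∃ x : q.total ⟶ q.pow 2, q.IsPair (q.proj ≫ q.zero) (𝟙 q.total) x ∧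
    x ≫ q.add = 𝟙 q.total
  add_comm : ∃ τ : q.pow 2 ⟶ q.pow 2, q.IsPair (q.π 2 1) (q.π 2 0) τ ∧ τ ≫ q.add = q.add

/-- `(f, g)` is an additive bundle morphism; `x` is the morphism `g ×_f g`. (When `q'` is an
additive bundle, or an image of one with the same pullbacks, `x` exists and is unique as soon
as the first condition holds.) -/
structure IsAdditiveBundleMorphism (q : BundleData B) (q' : BundleData B')
    (f : B ⟶ B') (g : q.total ⟶ q'.total) : Prop where
  proj : g ≫ q'.proj = q.proj ≫ f
  zero : q.zero ≫ g = f ≫ q'.zero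
  add : ∃ x : q.pow 2 ⟶ q'.pow 2, q'.IsPair (q.π 2 0 ≫ g) (q.π 2 1 ≫ g) x ∧
    q.add ≫ g = x ≫ q'.add

theorem IsAdditiveBundleMorphism.id (q : BundleData B) :
    IsAdditiveBundleMorphism q q (𝟙 B) (𝟙 q.total) where
  proj := by simp
  zero := by simp
  add := ⟨𝟙 _, ⟨by simp, by simp⟩, by simp⟩

theorem IsAdditiveBundleMorphism.comp {q : BundleData B} {q' : BundleData B'}
    {q'' : BundleData B''} {f : B ⟶ B'} {g : q.total ⟶ q'.total} {f' : B' ⟶ B''}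
    {g' : q'.total ⟶ q''.total} (h : IsAdditiveBundleMorphism q q' f g)
    (h' : IsAdditiveBundleMorphism q' q'' f' g') :
    IsAdditiveBundleMorphism q q'' (f ≫ f') (g ≫ g') where
  proj := by rw [Category.assoc, h'.proj, ← Category.assoc, h.proj, Category.assoc]
  zero := by rw [← Category.assoc, h.zero, Category.assoc, h'.zero, Category.assoc]
  add := by
    obtain ⟨x, ⟨h0, h1⟩, hx⟩ := h.add
    obtain ⟨x', ⟨h0', h1'⟩, hx'⟩ := h'.add
    refine ⟨x ≫ x', ⟨?_, ?_⟩, ?_⟩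
    · rw [Category.assoc, h0', ← Category.assoc, h0, Category.assoc]
    · rw [Category.assoc, h1', ← Category.assoc, h1, Category.assoc]
    · rw [← Category.assoc, hx, Category.assoc, hx', Category.assoc]

end

section

variable {K : Type u} [Bicategory.{w, v} K] {a b c d : K} {f : a ⟶ b} {f' : a ⟶ b}

/-- The bundle data `g q`: the image of `q` under `g ∘ -`. -/
abbrev post (q : BundleData f) (g : b ⟶ c) : BundleData (f ≫ g) where
  total := q.total ≫ g
  proj := q.proj ▷ g
  pow n _ := q.pow n ≫ g
  π n _ i := q.π n i ▷ g
  zero := q.zero ▷ g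
  add := q.add ▷ g

/-- The bundle data `q_h`: the image of `q` under `- ∘ h`. -/
abbrev pre (h : d ⟶ a) (q : BundleData f) : BundleData (h ≫ f) where
  total := h ≫ q.total
  proj := h ◁ q.proj
  pow n _ := h ≫ q.pow n
  π n _ i := h ◁ q.π n i
  zero := h ◁ q.zero
  add := h ◁ q.add

theorem IsAdditiveBundleMorphism.post {q : BundleData f} {q' : BundleData f'}
    {φ : f ⟶ f'} {ψ : q.total ⟶ q'.total} (h : IsAdditiveBundleMorphism q q' φ ψ) (g : b ⟶ c) :
    IsAdditiveBundleMorphism (q.post g) (q'.post g) (φ ▷ g) (ψ ▷ g) where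
  proj := by simp only [← comp_whiskerRight, h.proj]
  zero := by simp only [← comp_whiskerRight, h.zero]
  add := by
    obtain ⟨x, ⟨h0, h1⟩, hx⟩ := h.add
    exact ⟨x ▷ g, ⟨by simp only [← comp_whiskerRight, h0], by simp only [← comp_whiskerRight, h1]⟩,
      by simp only [← comp_whiskerRight, hx]⟩

theorem IsAdditiveBundleMorphism.pre {q : BundleData f} {q' : BundleData f'}
    {φ : f ⟶ f'} {ψ : q.total ⟶ q'.total} (h : IsAdditiveBundleMorphism q q' φ ψ) (g : d ⟶ a) :
    IsAdditiveBundleMorphism (q.pre g) (q'.pre g) (g ◁ φ) (g ◁ ψ) where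
  proj := by simp only [← whiskerLeft_comp, h.proj]
  zero := by simp only [← whiskerLeft_comp, h.zero]
  add := by
    obtain ⟨x, ⟨h0, h1⟩, hx⟩ := h.add
    exact ⟨g ◁ x, ⟨by simp only [← whiskerLeft_comp, h0], by simp only [← whiskerLeft_comp, h1]⟩,
      by simp only [← whiskerLeft_comp, hx]⟩

theorem isAdditiveBundleMorphism_rightUnitor (q : BundleData f) :
    IsAdditiveBundleMorphism (q.post (𝟙 b)) q (ρ_ f).hom (ρ_ q.total).hom where
  proj := by simp
  zero := by simp
  add := ⟨(ρ_ _).hom, ⟨by simp, by simp⟩, by simp⟩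

theorem isAdditiveBundleMorphism_leftUnitor_inv (q : BundleData f) :
    IsAdditiveBundleMorphism q (q.pre (𝟙 a)) (λ_ f).inv (λ_ q.total).inv where
  proj := by simp
  zero := by simp
  add := ⟨(λ_ _).inv, ⟨by simp, by simp⟩, by simp⟩

theorem isAdditiveBundleMorphism_post_comp (q : BundleData f) {e : K} (g : b ⟶ c) (h : c ⟶ e) :
    IsAdditiveBundleMorphism (q.post (g ≫ h)) ((q.post g).post h) (α_ f g h).inv
      (α_ q.total g h).inv where
  proj := by simp
  zero := by simp
  add := ⟨(α_ _ _ _).inv, ⟨by simp, by simp⟩, by simp⟩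

theorem isAdditiveBundleMorphism_pre_post (q : BundleData f) (g : b ⟶ c) (h : d ⟶ a) :
    IsAdditiveBundleMorphism ((q.pre h).post g) ((q.post g).pre h) (α_ h f g).hom
      (α_ h q.total g).hom where
  proj := by simp
  zero := by simp
  add := ⟨(α_ _ _ _).hom, ⟨by simp, by simp⟩, by simp⟩

theorem isAdditiveBundleMorphism_pre_comp (q : BundleData f) {e : K} (g : e ⟶ d) (h : d ⟶ a) :
    IsAdditiveBundleMorphism ((q.pre h).pre g) (q.pre (g ≫ h)) (α_ g h f).inv
      (α_ g h q.total).inv where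
  proj := by simp
  zero := by simp
  add := ⟨(α_ _ _ _).inv, ⟨by simp, by simp⟩, by simp⟩

end

end BundleData

/-! ## Tangentads, lax tangent morphisms, tangent 2-morphisms -/

open BundleData

/-- The data underlying a tangentad: an object `X`, a 1-cell `T : X ⟶ X` with 2-cells
`p : T ⟶ 𝟙`, `z : 𝟙 ⟶ T`, 1-cells `Tₙ` with `πᵢ : Tₙ ⟶ T` and `s : T₂ ⟶ T`, the vertical lift
`l : T ⟶ T²` and the canonical flip `c : T² ⟶ T²`. -/
structure TangentData (K : Type u) [Bicategory.{w, v} K] where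
  /-- The base object. -/
  X : K
  /-- The bundle `(p, z, s)` over the identity. -/
  p : BundleData (𝟙 X)
  /-- The vertical lift. -/
  l : p.total ⟶ p.total ≫ p.total
  /-- The canonical flip. -/
  c : p.total ≫ p.total ⟶ p.total ≫ p.total

section

variable {K : Type u} [Bicategory.{w, v} K]

/-- The iterates of an endomorphism. -/
def iter {X : K} (T : X ⟶ X) : ℕ → (X ⟶ X)
  | 0 => 𝟙 X
  | k + 1 => iter T k ≫ T

namespace TangentData

/-- The tangent bundle 1-cell. -/
abbrev T (A : TangentData K) : A.X ⟶ A.X := A.p.total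

/-- Tangentads. Composition is written diagrammatically: `T ◁ φ` is `φ_T` and `φ ▷ T` is `Tφ`. -/
structure IsTangentad (A : TangentData K) : Prop where
  /-- `(p, z, s)` is an additive bundle in `K(X, X)`. -/
  isAdditiveBundle : A.p.IsAdditiveBundle
  /-- The `n`-fold pullbacks are pointwise and preserved by all iterates of `T`. -/
  isFoldPullback (n : ℕ) [n.AtLeastTwo] (k : ℕ) (Y : K) (G : Y ⟶ A.X) :
    ((A.p.post (iter A.T k)).pre G).IsFoldPullback n
  /-- `(z, l) : p ⟶ Tp` is an additive bundle morphism. -/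
  lift_additive : IsAdditiveBundleMorphism A.p (A.p.post A.T)
    (A.p.zero ≫ (λ_ A.T).inv) A.l
  /-- `(id, c) : Tp ⟶ p_T` is an additive bundle morphism. -/
  flip_additive : IsAdditiveBundleMorphism (A.p.post A.T)
    (A.p.pre A.T) ((λ_ A.T).hom ≫ (ρ_ A.T).inv) A.c
  lift_coassoc : A.l ≫ A.l ▷ A.T ≫ (α_ A.T A.T A.T).hom = A.l ≫ A.T ◁ A.l
  lift_flip : A.l ≫ A.c = A.l
  lift_flip_flip : A.T ◁ A.l ≫ (α_ A.T A.T A.T).inv ≫ A.c ▷ A.T ≫ (α_ A.T A.T A.T).hom ≫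
    A.T ◁ A.c = A.c ≫ A.l ▷ A.T ≫ (α_ A.T A.T A.T).hom
  flip_flip : A.c ≫ A.c = 𝟙 (A.T ≫ A.T)
  flip_braid : A.c ▷ A.T ≫ (α_ A.T A.T A.T).hom ≫ A.T ◁ A.c ≫ (α_ A.T A.T A.T).inv ≫ A.c ▷ A.T =
    (α_ A.T A.T A.T).hom ≫ A.T ◁ A.c ≫ (α_ A.T A.T A.T).inv ≫ A.c ▷ A.T ≫
      (α_ A.T A.T A.T).hom ≫ A.T ◁ A.c ≫ (α_ A.T A.T A.T).inv
  /-- Local linearity, as a pointwise pullback; `x` is the 2-cell `z_T ×_z l : T₂ ⟶ T T₂`. -/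
  locally_linear : ∃ x : A.p.pow 2 ⟶ A.p.pow 2 ≫ A.T,
    (A.p.post A.T).IsPair
      (A.p.π 2 0 ≫ (ρ_ A.T).inv ≫ A.T ◁ A.p.zero) (A.p.π 2 1 ≫ A.l) x ∧
    ∀ (Y : K) (G : Y ⟶ A.X), IsPullback
      (G ◁ (x ≫ A.p.add ▷ A.T)) (G ◁ (A.p.π 2 0 ≫ A.p.proj))
      (G ◁ (A.p.proj ▷ A.T ≫ (λ_ A.T).hom)) (G ◁ A.p.zero)

/-- `T` and every `Tₙ` admit a left adjoint in `K`. -/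
def IsAdjunctable (A : TangentData K) : Prop :=
  IsRightAdjoint A.T ∧ ∀ (n : ℕ) [n.AtLeastTwo], IsRightAdjoint (A.p.pow n)

/-- A choice of left adjoints `T♭ ⊣ T` and `Tₙ♭ ⊣ Tₙ`. -/
structure LeftAdjoints (A : TangentData K) where
  /-- The left adjoint of `T`. -/
  tan : LeftAdjoint A.T
  /-- The left adjoint of `Tₙ`. -/
  pow (n : ℕ) [n.AtLeastTwo] : LeftAdjoint (A.p.pow n)

/-- The structure `T♭` on `X` in `K^co`, built from the left adjoints: the structural 2-cells are
the mates of those of `T`. -/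
def flat (A : TangentData K) (L : A.LeftAdjoints) : TangentData (Co K) where
  X := Co.of A.X
  p :=
    { total := Co.hom L.tan.left
      proj := Co.hom₂ ((conjugateEquiv L.tan.adj (Adjunction.id A.X)).symm A.p.proj)
      pow := fun n _ => Co.hom (L.pow n).left
      π := fun n _ i => Co.hom₂ ((conjugateEquiv (L.pow n).adj L.tan.adj).symm (A.p.π n i))
      zero := Co.hom₂ ((conjugateEquiv (Adjunction.id A.X) L.tan.adj).symm A.p.zero)
      add := Co.hom₂ ((conjugateEquiv (L.pow 2).adj L.tan.adj).symm A.p.add) }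
  l := Co.hom₂ ((conjugateEquiv L.tan.adj (L.tan.adj.comp L.tan.adj)).symm A.l)
  c := Co.hom₂ ((conjugateEquiv (L.tan.adj.comp L.tan.adj) (L.tan.adj.comp L.tan.adj)).symm A.c)

/-- The image of tangent data under a 2-functor. -/
def map {K' : Type u'} [Bicategory.{w', v'} K'] (F : StrictPseudofunctor K K')
    (A : TangentData K) : TangentData K' where
  X := F.obj A.X
  p :=
    { total := F.map A.T
      proj := F.map₂ A.p.proj ≫ (F.mapId A.X).hom
      pow := fun n _ => F.map (A.p.pow n)
      π := fun n _ i => F.map₂ (A.p.π n i)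
      zero := (F.mapId A.X).inv ≫ F.map₂ A.p.zero
      add := F.map₂ A.p.add }
  l := F.map₂ A.l ≫ (F.mapComp A.T A.T).hom
  c := (F.mapComp A.T A.T).inv ≫ F.map₂ A.c ≫ (F.mapComp A.T A.T).hom

end TangentData

open TangentData

/-- The data underlying a lax tangent morphism: a 1-cell `F` and a 2-cell `α : F ∘ T ⟶ T' ∘ F`. -/
structure LaxData (A B : TangentData K) where
  /-- The underlying 1-cell. -/
  F : A.X ⟶ B.X
  /-- The lax distributive law. -/
  α : A.T ≫ F ⟶ F ≫ B.T

namespace LaxData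

/-- The composite `T'α ∘ αT : F ∘ T² ⟶ T'² ∘ F`. -/
def sq {A B : TangentData K} (m : LaxData A B) : (A.T ≫ A.T) ≫ m.F ⟶ m.F ≫ B.T ≫ B.T :=
  (α_ A.T A.T m.F).hom ≫ A.T ◁ m.α ≫ (α_ A.T m.F B.T).inv ≫ m.α ▷ B.T ≫ (α_ m.F B.T B.T).hom

/-- Lax tangent morphisms. -/
structure IsLax {A B : TangentData K} (m : LaxData A B) : Prop where
  /-- `(id, α) : Fp ⟶ p'_F` is an additive bundle morphism. -/
  additive : IsAdditiveBundleMorphism (A.p.post m.F) (B.p.pre m.F)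
    ((λ_ m.F).hom ≫ (ρ_ m.F).inv) m.α
  lift : A.l ▷ m.F ≫ m.sq = m.α ≫ m.F ◁ B.l
  flip : A.c ▷ m.F ≫ m.sq = m.sq ≫ m.F ◁ B.c

/-- The mate `(F, α♭)` of a lax tangent morphism, with `α♭ : T'♭ ∘ F ⟶ F ∘ T♭` in `K`. -/
def flat {A B : TangentData K} (m : LaxData A B) (L : A.LeftAdjoints) (L' : B.LeftAdjoints) :
    LaxData (A.flat L) (B.flat L') where
  F := Co.hom m.F
  α := Co.hom₂ ((mateEquiv L.tan.adj L'.tan.adj).symm m.α)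

/-- The image of a lax tangent morphism under a 2-functor. -/
def map {K' : Type u'} [Bicategory.{w', v'} K'] (F : StrictPseudofunctor K K')
    {A B : TangentData K} (m : LaxData A B) : LaxData (A.map F) (B.map F) where
  F := F.map m.F
  α := (F.mapComp A.T m.F).inv ≫ F.map₂ m.α ≫ (F.mapComp m.F B.T).hom

/-- The identity morphism. -/
def id (A : TangentData K) : LaxData A A where
  F := 𝟙 A.X
  α := (ρ_ A.T).hom ≫ (λ_ A.T).inv

/-- Composition of lax tangent morphisms. -/
def comp {A B C : TangentData K} (m : LaxData A B) (n : LaxData B C) : LaxData A C where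
  F := m.F ≫ n.F
  α := (α_ A.T m.F n.F).inv ≫ m.α ▷ n.F ≫ (α_ m.F B.T n.F).hom ≫ m.F ◁ n.α ≫
    (α_ m.F n.F C.T).inv

/-- A 2-cell `φ : F ⟶ G` is compatible with the distributive laws. -/
def IsCompatible {A B : TangentData K} (m n : LaxData A B) (φ : m.F ⟶ n.F) : Prop :=
  m.α ≫ φ ▷ B.T = A.T ◁ φ ≫ n.α

theorem ext_of_isCompatible {A B : TangentData K} {m n : LaxData A B} (h : m.F = n.F)
    (h' : IsCompatible m n (eqToHom h)) : m = n := by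
  obtain ⟨F, α⟩ := m
  obtain ⟨G, β⟩ := n
  obtain rfl : F = G := h
  have : α = β := by simpa [IsCompatible] using h'
  rw [this]

theorem sq_comp {A B C : TangentData K} (m : LaxData A B) (n : LaxData B C) :
    (m.comp n).sq = (α_ (A.T ≫ A.T) m.F n.F).inv ≫ m.sq ▷ n.F ≫ (α_ m.F (B.T ≫ B.T) n.F).hom ≫
      m.F ◁ n.sq ≫ (α_ m.F n.F (C.T ≫ C.T)).inv := by
  dsimp only [sq, comp]
  calc _ = 𝟙 _ ⊗≫ A.T ◁ m.α ▷ n.F ⊗≫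
      ((A.T ≫ m.F) ◁ n.α ≫ m.α ▷ (n.F ≫ C.T)) ⊗≫ m.F ◁ n.α ▷ C.T ⊗≫ 𝟙 _ := by bicategory
    _ = _ := by rw [whisker_exchange]; bicategory

theorem IsLax.id (A : TangentData K) : (LaxData.id A).IsLax where
  additive := by
    have h := (isAdditiveBundleMorphism_rightUnitor A.p).comp
      (isAdditiveBundleMorphism_leftUnitor_inv A.p)
    have hb : (λ_ (𝟙 A.X)).hom ≫ (ρ_ (𝟙 A.X)).inv = (ρ_ (𝟙 A.X)).hom ≫ (λ_ (𝟙 A.X)).inv := by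
      rw [unitors_equal, unitors_inv_equal]
    dsimp only [LaxData.id]
    rw [hb]
    exact h
  lift := by
    dsimp only [sq, LaxData.id]
    bicategory
  flip := by
    dsimp only [sq, LaxData.id]
    bicategory

theorem IsLax.comp {A B C : TangentData K} {m : LaxData A B} {n : LaxData B C} (hm : m.IsLax)
    (hn : n.IsLax) : (m.comp n).IsLax where
  additive := by
    have h := (isAdditiveBundleMorphism_post_comp A.p m.F n.F).comp
      ((hm.additive.post n.F).comp ((isAdditiveBundleMorphism_pre_post B.p n.F m.F).comp
        ((hn.additive.pre m.F).comp (isAdditiveBundleMorphism_pre_comp C.p m.F n.F))))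
    have hb : (λ_ (m.F ≫ n.F)).hom ≫ (ρ_ (m.F ≫ n.F)).inv =
        (α_ (𝟙 A.X) m.F n.F).inv ≫ ((λ_ m.F).hom ≫ (ρ_ m.F).inv) ▷ n.F ≫
          (α_ m.F (𝟙 B.X) n.F).hom ≫ m.F ◁ ((λ_ n.F).hom ≫ (ρ_ n.F).inv) ≫
            (α_ m.F n.F (𝟙 C.X)).inv := by bicategory
    dsimp only [LaxData.comp]
    rw [hb]
    exact h
  lift := by
    rw [sq_comp]
    have e1 := hm.lift
    have e2 := hn.lift
    dsimp only [LaxData.comp]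
    calc _ = 𝟙 _ ⊗≫ (A.l ▷ m.F ≫ m.sq) ▷ n.F ⊗≫ m.F ◁ n.sq ⊗≫ 𝟙 _ := by
          bicategory
      _ = 𝟙 _ ⊗≫ m.α ▷ n.F ⊗≫ m.F ◁ (B.l ▷ n.F ≫ n.sq) ⊗≫ 𝟙 _ := by
          rw [e1]; bicategory
      _ = _ := by
          rw [e2]; bicategory
  flip := by
    rw [sq_comp]
    have e1 := hm.flip
    have e2 := hn.flip
    dsimp only [LaxData.comp]
    calc _ = 𝟙 _ ⊗≫ (A.c ▷ m.F ≫ m.sq) ▷ n.F ⊗≫ m.F ◁ n.sq ⊗≫ 𝟙 _ := by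
          bicategory
      _ = 𝟙 _ ⊗≫ m.sq ▷ n.F ⊗≫ m.F ◁ (B.c ▷ n.F ≫ n.sq) ⊗≫ 𝟙 _ := by
          rw [e1]; bicategory
      _ = _ := by
          rw [e2]; bicategory

end LaxData

/-- The tangentads of `K`. -/
structure Tng (K : Type u) [Bicategory.{w, v} K] extends TangentData K where
  isTangentad : toTangentData.IsTangentad

/-- Lax tangent morphisms between tangentads. -/
structure Tng.Hom (A B : Tng K) extends LaxData A.toTangentData B.toTangentData where
  isLax : toLaxData.IsLax

/-- Tangent 2-morphisms. -/
@[ext]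
structure Tng.Hom₂ {A B : Tng K} (m n : Tng.Hom A B) where
  /-- The underlying 2-cell. -/
  φ : m.F ⟶ n.F
  isCompatible : LaxData.IsCompatible m.toLaxData n.toLaxData φ

theorem Tng.Hom.ext' {A B : Tng K} {m n : Tng.Hom A B} (h : m.toLaxData = n.toLaxData) :
    m = n := by
  cases m; cases n; cases h; rfl

instance Tng.homCategory (A B : Tng K) : Category (Tng.Hom A B) where
  Hom m n := Tng.Hom₂ m n
  id m := ⟨𝟙 m.F, by simp [LaxData.IsCompatible]⟩
  comp η θ := ⟨η.φ ≫ θ.φ, by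
    have h₁ := η.isCompatible
    have h₂ := θ.isCompatible
    unfold LaxData.IsCompatible at *
    rw [comp_whiskerRight, reassoc_of% h₁, h₂, whiskerLeft_comp, Category.assoc]⟩
  id_comp η := Tng.Hom₂.ext (Category.id_comp η.φ)
  comp_id η := Tng.Hom₂.ext (Category.comp_id η.φ)
  assoc η θ κ := Tng.Hom₂.ext (Category.assoc η.φ θ.φ κ.φ)

/-- An invertible compatible 2-cell is an isomorphism of lax tangent morphisms. -/
def Tng.isoMk {A B : Tng K} {m n : Tng.Hom A B} (e : m.F ≅ n.F)
    (h : LaxData.IsCompatible m.toLaxData n.toLaxData e.hom) : m ≅ n where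
  hom := ⟨e.hom, h⟩
  inv := ⟨e.inv, by
    unfold LaxData.IsCompatible at *
    rw [← cancel_epi (A.T ◁ e.hom), ← Category.assoc, ← h]
    simp⟩
  hom_inv_id := Tng.Hom₂.ext e.hom_inv_id
  inv_hom_id := Tng.Hom₂.ext e.inv_hom_id

/-- The 2-category of tangentads, lax tangent morphisms and tangent 2-morphisms. -/
instance Tng.bicategory : Bicategory (Tng K) where
  Hom A B := Tng.Hom A B
  id A := ⟨LaxData.id A.toTangentData, LaxData.IsLax.id _⟩
  comp m n := ⟨m.toLaxData.comp n.toLaxData, m.isLax.comp n.isLax⟩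
  homCategory := Tng.homCategory
  whiskerLeft {A B C} m n n' η := ⟨m.F ◁ η.φ, by
    have h := η.isCompatible
    unfold LaxData.IsCompatible at *
    simp only [LaxData.comp]
    calc _ = 𝟙 _ ⊗≫ m.α ▷ n.F ⊗≫ m.F ◁ (n.α ≫ η.φ ▷ C.T) ⊗≫ 𝟙 _ := by bicategory
      _ = 𝟙 _ ⊗≫ (m.α ▷ n.F ≫ (m.F ≫ B.T) ◁ η.φ) ⊗≫ m.F ◁ n'.α ⊗≫ 𝟙 _ := by
          rw [h]; bicategory
      _ = _ := by rw [← whisker_exchange]; bicategory⟩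
  whiskerRight {A B C} m m' η n := ⟨η.φ ▷ n.F, by
    have h := η.isCompatible
    unfold LaxData.IsCompatible at *
    simp only [LaxData.comp]
    calc _ = 𝟙 _ ⊗≫ m.α ▷ n.F ⊗≫ (m.F ◁ n.α ≫ η.φ ▷ (n.F ≫ C.T)) ⊗≫ 𝟙 _ := by bicategory
      _ = 𝟙 _ ⊗≫ (m.α ≫ η.φ ▷ B.T) ▷ n.F ⊗≫ m'.F ◁ n.α ⊗≫ 𝟙 _ := by
          rw [whisker_exchange]; bicategory
      _ = _ := by rw [h]; bicategory⟩
  associator m n o := Tng.isoMk (α_ m.F n.F o.F) (by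
    simp only [LaxData.IsCompatible, LaxData.comp]
    bicategory)
  leftUnitor m := Tng.isoMk (λ_ m.F) (by
    simp only [LaxData.IsCompatible, LaxData.comp, LaxData.id]
    bicategory)
  rightUnitor m := Tng.isoMk (ρ_ m.F) (by
    simp only [LaxData.IsCompatible, LaxData.comp, LaxData.id]
    bicategory)
  whiskerLeft_id m n := Tng.Hom₂.ext (whiskerLeft_id m.F n.F)
  whiskerLeft_comp m _ _ _ η θ := Tng.Hom₂.ext (whiskerLeft_comp m.F η.φ θ.φ)
  id_whiskerLeft η := Tng.Hom₂.ext (id_whiskerLeft η.φ)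
  comp_whiskerLeft m n _ _ η := Tng.Hom₂.ext (comp_whiskerLeft m.F n.F η.φ)
  id_whiskerRight m n := Tng.Hom₂.ext (id_whiskerRight m.F n.F)
  comp_whiskerRight η θ n := Tng.Hom₂.ext (comp_whiskerRight η.φ θ.φ n.F)
  whiskerRight_id η := Tng.Hom₂.ext (whiskerRight_id η.φ)
  whiskerRight_comp η m n := Tng.Hom₂.ext (whiskerRight_comp η.φ m.F n.F)
  whisker_assoc m _ _ η n := Tng.Hom₂.ext (whisker_assoc m.F η.φ n.F)
  whisker_exchange η θ := Tng.Hom₂.ext (whisker_exchange η.φ θ.φ)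
  pentagon m n o q := Tng.Hom₂.ext (pentagon m.F n.F o.F q.F)
  triangle m n := Tng.Hom₂.ext (triangle m.F n.F)

theorem Tng.eq_of_iso {A B : Tng K} {m n : A ⟶ B} (h : m.F = n.F)
    (e : m ≅ n) (he : e.hom.φ = eqToHom h) : m = n :=
  Tng.Hom.ext' (LaxData.ext_of_isCompatible h (he ▸ e.hom.isCompatible))

theorem Tng.eqToHom_φ {A B : Tng K} {m n : A ⟶ B} (h : m = n) (h' : m.F = n.F) :
    (eqToHom h).φ = eqToHom h' := by
  subst h; rfl

theorem Tng.iso_eq_eqToIso {A B : Tng K} {m n : A ⟶ B} (h : m = n) (h' : m.F = n.F)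
    (e : m ≅ n) (he : e.hom.φ = eqToHom h') : e = eqToIso h := by
  ext
  exact Tng.Hom₂.ext (he.trans (Tng.eqToHom_φ h h').symm)

instance Tng.strict [Bicategory.Strict K] : Bicategory.Strict (Tng K) :=
  have id_comp {A B : Tng K} (m : A ⟶ B) : 𝟙 A ≫ m = m :=
    Tng.eq_of_iso (Bicategory.Strict.id_comp m.F) (λ_ m)
      (congrArg Iso.hom (Bicategory.Strict.leftUnitor_eqToIso m.F))
  have comp_id {A B : Tng K} (m : A ⟶ B) : m ≫ 𝟙 B = m :=
    Tng.eq_of_iso (Bicategory.Strict.comp_id m.F) (ρ_ m)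
      (congrArg Iso.hom (Bicategory.Strict.rightUnitor_eqToIso m.F))
  have assoc {A B C D : Tng K} (m : A ⟶ B) (n : B ⟶ C) (o : C ⟶ D) :
      (m ≫ n) ≫ o = m ≫ n ≫ o :=
    Tng.eq_of_iso (Bicategory.Strict.assoc m.F n.F o.F) (α_ m n o)
      (congrArg Iso.hom (Bicategory.Strict.associator_eqToIso m.F n.F o.F))
  { id_comp := id_comp
    comp_id := comp_id
    assoc := assoc
    leftUnitor_eqToIso := fun m =>
      Tng.iso_eq_eqToIso (id_comp m) (Bicategory.Strict.id_comp m.F) _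
        (congrArg Iso.hom (Bicategory.Strict.leftUnitor_eqToIso m.F))
    rightUnitor_eqToIso := fun m =>
      Tng.iso_eq_eqToIso (comp_id m) (Bicategory.Strict.comp_id m.F) _
        (congrArg Iso.hom (Bicategory.Strict.rightUnitor_eqToIso m.F))
    associator_eqToIso := fun m n o =>
      Tng.iso_eq_eqToIso (assoc m n o) (Bicategory.Strict.assoc m.F n.F o.F) _
        (congrArg Iso.hom (Bicategory.Strict.associator_eqToIso m.F n.F o.F)) }

variable (K) in
/-- The full sub-2-category of `Tng K` on the adjunctable tangentads. -/
abbrev AdjTng :=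
  InducedBicategory (Tng K) (Subtype.val : {A : Tng K // A.IsAdjunctable} → Tng K)

/-- The tangentad underlying an adjunctable one. -/
abbrev AdjTng.tng (A : AdjTng K) : Tng K := Subtype.val A

/-- The opposite `(X^op, (T♭)^op)` of tangent data with chosen left adjoints. -/
def TangentData.opposite [Bicategory.Strict K] (O : OppositeObjects K) (A : TangentData K)
    (L : A.LeftAdjoints) : TangentData K :=
  (A.flat L).map O.opp

/-- The opposite `(F^op, (α♭)^op)` of a lax tangent morphism. -/
def LaxData.opposite [Bicategory.Strict K] (O : OppositeObjects K) {A B : TangentData K}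
    (m : LaxData A B) (L : A.LeftAdjoints) (L' : B.LeftAdjoints) :
    LaxData (A.opposite O L) (B.opposite O L') :=
  (m.flat L L').map O.opp

/-- The assignments `(X, T) ↦ (X^op, (T♭)^op)`, `(F, α) ↦ (F^op, (α♭)^op)`, `φ ↦ φ^op`, for a
choice `L` of left adjoints, given that they take values in adjunctable tangentads, lax tangent
morphisms and tangent 2-morphisms. -/
def oppositeAssignment [Bicategory.Strict K] (O : OppositeObjects K)
    (L : ∀ A : AdjTng K, A.tng.LeftAdjoints)
    (h₀ : ∀ A : AdjTng K, (A.tng.opposite O (L A)).IsTangentad ∧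
      (A.tng.opposite O (L A)).IsAdjunctable)
    (h₁ : ∀ (A B : AdjTng K) (m : A ⟶ B), (m.hom.opposite O (L A) (L B)).IsLax)
    (h₂ : ∀ (A B : AdjTng K) (m n : A ⟶ B) (η : m ⟶ n),
      LaxData.IsCompatible (n.hom.opposite O (L A) (L B)) (m.hom.opposite O (L A) (L B))
        (O.opp.map₂ (Co.hom₂ η.hom.φ))) :
    PrelaxFunctorStruct (Co (AdjTng K)) (AdjTng K) where
  obj A := ⟨⟨A.as.tng.opposite O (L A.as), (h₀ A.as).1⟩, (h₀ A.as).2⟩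
  map {A B} m := InducedBicategory.mkHom
    ⟨(Co.un m).hom.opposite O (L A.as) (L B.as), h₁ A.as B.as (Co.un m)⟩
  map₂ {A B m n} η :=
    ⟨⟨O.opp.map₂ (Co.hom₂ (Co.un₂ η).hom.φ), h₂ A.as B.as (Co.un n) (Co.un m) (Co.un₂ η)⟩⟩

end

end Tangentad

/-! Mates are handled in the bicategory `Adj K`, whose 1-cells are adjunctions and whose 2-cells are
conjugate pairs. Each half of a conjugate pair determines the other, so an equation between pasted
2-cells holds for right adjoints exactly when it holds for left adjoints. The equational axioms of
$\mathbb T^\flat$ are therefore checked on right halves and read off on left halves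
(`TangentData.IsTangentad.flat`). Right adjoints compose in the reverse order, so the equations
needed are the axioms with $T\varphi$ and $\varphi_T$ exchanged; these follow from the given ones
because $c$ is an involution.

The universal properties rest on pointwiseness. For $L\dashv R$, 2-cells $L\circ G\Rightarrow H$
correspond to 2-cells $G\Rightarrow R\circ H$, so a cocone with vertex $H$ under left adjoints
precomposed with $G$ is a cone with vertex $G$ over right adjoints precomposed with $H$. Pointwise
pullbacks thus become pointwise pushouts, which are pullbacks in $\mathbf K^{\mathsf{co}}$
(`IsFoldCone.coWhisker`, `isPullback_coWhisker`). An iterate of $T^\flat$ is itself a left adjoint,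
and its right adjoint is absorbed into the test 1-cell, so preservation by iterates comes for free.

Naturality of $\xi$ makes $(-)^{\mathsf{op}}$ an equivalence on hom-categories, and $\xi_Y$ is an
invertible 1-cell from $Y$ to an object in its image. Every pointwise universal property is then
transported from $\mathbf K^{\mathsf{co}}$ to $\mathbf K$ (`opp_isLocalEquivalence`,
`TangentData.IsTangentad.map`). The pasting laws for mates make the assignment strictly functorial.

In $\mathbf K^{\mathsf{co}}$ the adjunction $T^\flat\dashv T$ reads $T\dashv T^\flat$, so
$T^{\mathsf{op}}\dashv(T^\flat)^{\mathsf{op}}$. With this left adjoint a second passage to mates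
undoes the first, and $\xi_X$ with an identity distributive law is an invertible tangent morphism to
the double opposite (`zeta_isLax`). Any other choice of left adjoints is reached by the opposite of
an identity morphism taken between the two choices. The resulting comparison already forces the
2-functor to be a 2-equivalence, with its own co-dual as inverse. -/

namespace Tangentad

open TwoCat

/-! ## Fold pullbacks and equivalences of categories -/

section FoldCone

variable {C : Type u} [Category.{v} C] {D : Type u'} [Category.{v'} D]

/-- The cone `π` exhibits `P` as the fold pullback of `p` along itself. -/
def IsFoldCone {n : ℕ} {B T P : C} (p : T ⟶ B) (π : Fin n → (P ⟶ T)) : Prop :=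
  (∀ i j, π i ≫ p = π j ≫ p) ∧
  ∀ (H : C) (f : Fin n → (H ⟶ T)), (∀ i j, f i ≫ p = f j ≫ p) → ∃! u : H ⟶ P, ∀ i, u ≫ π i = f i

variable {n : ℕ} {B T P : C} {p : T ⟶ B} {π : Fin n → (P ⟶ T)}

theorem IsFoldCone.hom_ext (h : IsFoldCone p π) {H : C} {u v : H ⟶ P}
    (huv : ∀ i, u ≫ π i = v ≫ π i) : u = v := by
  obtain ⟨w, -, hw⟩ := h.2 H (fun i => v ≫ π i) fun i j => by
    rw [Category.assoc, Category.assoc, h.1 i j]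
  rw [hw u huv, hw v fun _ => rfl]

theorem IsFoldCone.comp_iso (h : IsFoldCone p π) {B' : C} (e : B ≅ B') :
    IsFoldCone (p ≫ e.hom) π := by
  refine ⟨fun i j => by rw [← Category.assoc, h.1 i j, Category.assoc], fun H f hf => ?_⟩
  exact h.2 H f fun i j => by simpa only [← Category.assoc, cancel_mono] using hf i j

theorem IsFoldCone.of_iso (h : IsFoldCone p π) {B' T' P' : C} {p' : T' ⟶ B'}
    {π' : Fin n → (P' ⟶ T')} (eB : B ≅ B') (eT : T ≅ T') (eP : P ≅ P')
    (hp : p ≫ eB.hom = eT.hom ≫ p') (hπ : ∀ i, π i ≫ eT.hom = eP.hom ≫ π' i) :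
    IsFoldCone p' π' := by
  have hπ' : ∀ i, π' i = eP.inv ≫ π i ≫ eT.hom := fun i => by rw [hπ, Iso.inv_hom_id_assoc]
  have hp' : p' = eT.inv ≫ p ≫ eB.hom := by rw [hp, Iso.inv_hom_id_assoc]
  refine ⟨fun i j => by simp [hπ', hp', reassoc_of% h.1 i j], fun H f hf => ?_⟩
  obtain ⟨u, hu, hu'⟩ := h.2 H (fun i => f i ≫ eT.inv) fun i j => by
    simpa [hp', ← Category.assoc] using hf i j
  refine ⟨u ≫ eP.hom, fun i => by simp [hπ', reassoc_of% hu i], fun v hv => ?_⟩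
  rw [← hu' (v ≫ eP.inv) fun i => by simp [← hv, hπ']]
  simp

/-- A test object of the target is isomorphic to an image, and fullness and faithfulness pull its
cone back to the source. -/
theorem IsFoldCone.map (h : IsFoldCone p π) (Φ : C ⥤ D) [Φ.IsEquivalence] :
    IsFoldCone (Φ.map p) fun i => Φ.map (π i) := by
  refine ⟨fun i j => by rw [← Φ.map_comp, h.1 i j, Φ.map_comp], fun H f hf => ?_⟩
  let e : Φ.obj (Φ.objPreimage H) ≅ H := Φ.objObjPreimageIso H
  obtain ⟨u, hu, hu'⟩ := h.2 (Φ.objPreimage H) (fun i => Φ.preimage (e.hom ≫ f i)) fun i j =>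
    Φ.map_injective (by simp [hf i j])
  refine ⟨e.inv ≫ Φ.map u, fun i => ?_, fun v hv => ?_⟩
  · rw [Category.assoc, ← Φ.map_comp, hu, Φ.map_preimage, Iso.inv_hom_id_assoc]
  · rw [← hu' (Φ.preimage (e.hom ≫ v)) fun i => Φ.map_injective (by simp [hv])]
    simp

theorem IsFoldCone.of_natIso {Φ Ψ : C ⥤ D} (h : IsFoldCone (Φ.map p) fun i => Φ.map (π i))
    (e : Φ ≅ Ψ) : IsFoldCone (Ψ.map p) fun i => Ψ.map (π i) :=
  h.of_iso (e.app _) (e.app _) (e.app _) (e.hom.naturality p) fun i => e.hom.naturality (π i)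

theorem isPullback_of_natIso {Φ Ψ : C ⥤ D} {W X Y Z : C} {f : W ⟶ X} {g : W ⟶ Y} {h : X ⟶ Z}
    {k : Y ⟶ Z} (hΦ : IsPullback (Φ.map f) (Φ.map g) (Φ.map h) (Φ.map k)) (e : Φ ≅ Ψ) :
    IsPullback (Ψ.map f) (Ψ.map g) (Ψ.map h) (Ψ.map k) :=
  hΦ.of_iso (e.app _) (e.app _) (e.app _) (e.app _) (e.hom.naturality f) (e.hom.naturality g)
    (e.hom.naturality h) (e.hom.naturality k)

end FoldCone

/-! ## Local equivalences -/

theorem isEquivalence_of_iso_comp {C : Type*} [Category* C] {D : Type*} [Category* D]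
    {E : Type*} [Category* E] {F : C ⥤ D} {G : D ⥤ E} {H : C ⥤ E} (hG : G.IsEquivalence)
    (hH : H.IsEquivalence) (e : H ≅ F ⋙ G) : F.IsEquivalence :=
  have := Functor.isEquivalence_of_iso e
  Functor.isEquivalence_of_comp_right F G

section LocalEquivalence

variable {K : Type u} [Bicategory.{w, v} K]

/-- Precomposition with an invertible 1-cell. -/
def precompEquivalence {a b : K} (e : a ⟶ b) (e' : b ⟶ a) (h : e ≫ e' = 𝟙 a)
    (h' : e' ≫ e = 𝟙 b) (c : K) : (b ⟶ c) ≌ (a ⟶ c) :=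
  .mk (precomp c e) (precomp c e')
    (NatIso.ofComponents
      (F := 𝟭 (b ⟶ c)) (G := precomp c e ⋙ precomp c e')
      (fun f => (λ_ f).symm ≪≫ whiskerRightIso (eqToIso h'.symm) f ≪≫ α_ e' e f)
      fun {f g} φ => by
        change φ ≫ (λ_ g).inv ≫ eqToHom h'.symm ▷ g ≫ (α_ e' e g).hom =
          ((λ_ f).inv ≫ eqToHom h'.symm ▷ f ≫ (α_ e' e f).hom) ≫ e' ◁ e ◁ φ
        rw [leftUnitor_inv_naturality_assoc, whisker_exchange_assoc]
        simp)
    (NatIso.ofComponents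
      (F := precomp c e' ⋙ precomp c e) (G := 𝟭 (a ⟶ c))
      (fun f => (α_ e e' f).symm ≪≫ whiskerRightIso (eqToIso h) f ≪≫ λ_ f)
      fun {f g} φ => by
        change e ◁ e' ◁ φ ≫ (α_ e e' g).inv ≫ eqToHom h ▷ g ≫ (λ_ g).hom =
          ((α_ e e' f).inv ≫ eqToHom h ▷ f ≫ (λ_ f).hom) ≫ φ
        rw [associator_inv_naturality_right_assoc, whisker_exchange_assoc]
        simp)

theorem precomp_isEquivalence {a b : K} (e : a ⟶ b) (e' : b ⟶ a) (h : e ≫ e' = 𝟙 a)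
    (h' : e' ≫ e = 𝟙 b) (c : K) : (precomp c e).IsEquivalence :=
  (precompEquivalence e e' h h' c).isEquivalence_functor

/-- Postcomposition with an invertible 1-cell. -/
def postcompEquivalence {a b : K} (e : a ⟶ b) (e' : b ⟶ a) (h : e ≫ e' = 𝟙 a)
    (h' : e' ≫ e = 𝟙 b) (c : K) : (c ⟶ a) ≌ (c ⟶ b) :=
  .mk (postcomp c e) (postcomp c e')
    (NatIso.ofComponents
      (F := 𝟭 (c ⟶ a)) (G := postcomp c e ⋙ postcomp c e')
      (fun f => (ρ_ f).symm ≪≫ whiskerLeftIso f (eqToIso h.symm) ≪≫ (α_ f e e').symm)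
      fun {f g} φ => by
        change φ ≫ (ρ_ g).inv ≫ g ◁ eqToHom h.symm ≫ (α_ g e e').inv =
          ((ρ_ f).inv ≫ f ◁ eqToHom h.symm ≫ (α_ f e e').inv) ≫ φ ▷ e ▷ e'
        rw [rightUnitor_inv_naturality_assoc, ← whisker_exchange_assoc]
        simp)
    (NatIso.ofComponents
      (F := postcomp c e' ⋙ postcomp c e) (G := 𝟭 (c ⟶ b))
      (fun f => α_ f e' e ≪≫ whiskerLeftIso f (eqToIso h') ≪≫ ρ_ f)
      fun {f g} φ => by
        change φ ▷ e' ▷ e ≫ (α_ g e' e).hom ≫ g ◁ eqToHom h' ≫ (ρ_ g).hom =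
          ((α_ f e' e).hom ≫ f ◁ eqToHom h' ≫ (ρ_ f).hom) ≫ φ
        rw [associator_naturality_left_assoc, ← whisker_exchange_assoc]
        simp)

theorem postcomp_isEquivalence {a b : K} (e : a ⟶ b) (e' : b ⟶ a) (h : e ≫ e' = 𝟙 a)
    (h' : e' ≫ e = 𝟙 b) (c : K) : (postcomp c e).IsEquivalence :=
  (postcompEquivalence e e' h h' c).isEquivalence_functor

/-- A 2-functor is an equivalence on hom-categories and essentially surjective on objects. -/
structure IsLocalEquivalence {K' : Type u'} [Bicategory.{w', v'} K']
    (F : StrictPseudofunctor K K') : Prop where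
  mapFunctor_isEquivalence (a b : K) : (F.mapFunctor a b).IsEquivalence
  exists_precomp (Y : K') : ∃ (Y₀ : K) (e : Y ⟶ F.obj Y₀), ∀ c, (precomp c e).IsEquivalence

variable [Bicategory.Strict K]

/-- The naturality of a 2-natural isomorphism, as an isomorphism of functors. -/
def mapFunctorIso {K' : Type u'} [Bicategory.{w', v'} K'] {F G : StrictPseudofunctor K K'}
    (t : TwoNatIso F G) (a b : K) :
    F.mapFunctor a b ⋙ postcomp _ (t.app b) ≅ G.mapFunctor a b ⋙ precomp _ (t.app a) :=
  NatIso.ofComponents (fun f => eqToIso (t.naturality f)) fun η => t.naturality₂ η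

variable (O : OppositeObjects K)

/-- Naturality of $\xi$ identifies postcomposition with $\xi_b$ with the double opposite followed by
precomposition with $\xi_a$. Both whiskerings are by invertible 1-cells, so two-out-of-three
applies. -/
theorem oppComp_isEquivalence (a b : Co K) :
    (O.opp.mapFunctor a b ⋙ (coFunctor O.opp).mapFunctor _ _).IsEquivalence :=
  isEquivalence_of_iso_comp
    (precomp_isEquivalence _ (O.ξ.inv a) (O.ξ.app_inv a) (O.ξ.inv_app a) _)
    (postcomp_isEquivalence _ (O.ξ.inv b) (O.ξ.app_inv b) (O.ξ.inv_app b) a)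
    (mapFunctorIso O.ξ a b)

theorem opp_mapFunctor_faithful (a b : Co K) : (O.opp.mapFunctor a b).Faithful :=
  have := oppComp_isEquivalence O a b
  Functor.Faithful.of_comp _ ((coFunctor O.opp).mapFunctor _ _)

/-- On hom-categories the co-dual is the opposite of the original functor, so faithfulness passes
between them, and likewise fullness below. Faithfulness of this second factor is what lets fullness
of the composite descend to the first. -/
theorem coFunctor_mapFunctor_faithful (a b : K) :
    ((coFunctor O.opp).mapFunctor a b).Faithful :=
  have := opp_mapFunctor_faithful O (Co.of a) (Co.of b)
  Functor.rightOp_faithful (F := O.opp.mapFunctor (Co.of a) (Co.of b))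

theorem opp_mapFunctor_full (a b : Co K) : (O.opp.mapFunctor a b).Full :=
  have := coFunctor_mapFunctor_faithful O (O.opp.obj a) (O.opp.obj b)
  have := oppComp_isEquivalence O a b
  Functor.Full.of_comp_faithful _ ((coFunctor O.opp).mapFunctor (O.opp.obj a) (O.opp.obj b))

theorem coFunctor_mapFunctor_full (a b : K) :
    ((coFunctor O.opp).mapFunctor a b).Full :=
  have := opp_mapFunctor_full O (Co.of a) (Co.of b)
  Functor.rightOp_full (F := O.opp.mapFunctor (Co.of a) (Co.of b))

theorem opp_isLocalEquivalence : IsLocalEquivalence O.opp where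
  mapFunctor_isEquivalence a b :=
    have h := oppComp_isEquivalence O a b
    have hG : ((coFunctor O.opp).mapFunctor (O.opp.obj a) (O.opp.obj b)).IsEquivalence :=
      { faithful := coFunctor_mapFunctor_faithful O _ _
        full := coFunctor_mapFunctor_full O _ _
        -- A preimage under the composite yields one under its second factor.
        essSurj := ⟨fun y => ⟨_, ⟨(O.opp.mapFunctor a b ⋙
          (coFunctor O.opp).mapFunctor _ _).objObjPreimageIso y⟩⟩⟩ }
    isEquivalence_of_iso_comp hG h (Iso.refl _)
  exists_precomp Y := ⟨Co.of (O.opp.obj (Co.of Y)), Co.un (O.ξ.app (Co.of Y)), fun c =>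
    precomp_isEquivalence _ (Co.un (O.ξ.inv (Co.of Y)))
      (congrArg Co.un (O.ξ.app_inv (Co.of Y))) (congrArg Co.un (O.ξ.inv_app (Co.of Y))) c⟩

end LocalEquivalence

end Tangentad

namespace Tangentad

open TwoCat BundleData

/-! ## Images of tangentads under 2-functors -/

namespace BundleData

section

variable {C : Type u} [Category.{v} C] {D : Type u'} [Category.{v'} D] {B B' : C}

/-- The image of bundle data under a functor. -/
abbrev image (q : BundleData B) (Φ : C ⥤ D) : BundleData (Φ.obj B) where
  total := Φ.obj q.total
  proj := Φ.map q.proj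
  pow n _ := Φ.obj (q.pow n)
  π n _ i := Φ.map (q.π n i)
  zero := Φ.map q.zero
  add := Φ.map q.add

/-- Bundle data transported along an isomorphism of the base. -/
abbrev rebase (q : BundleData B) (e : B ≅ B') : BundleData B' where
  total := q.total
  proj := q.proj ≫ e.hom
  pow n _ := q.pow n
  π n _ i := q.π n i
  zero := e.inv ≫ q.zero
  add := q.add

theorem IsAdditiveBundleMorphism.congr {q : BundleData B} {q' : BundleData B'} {f f' : B ⟶ B'}
    {g g' : q.total ⟶ q'.total} (h : IsAdditiveBundleMorphism q q' f g) (hf : f = f')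
    (hg : g = g') : IsAdditiveBundleMorphism q q' f' g' :=
  hf ▸ hg ▸ h

theorem IsAdditiveBundleMorphism.image {q : BundleData B} {q' : BundleData B'} {f : B ⟶ B'}
    {g : q.total ⟶ q'.total} (h : IsAdditiveBundleMorphism q q' f g) (Φ : C ⥤ D) :
    IsAdditiveBundleMorphism (q.image Φ) (q'.image Φ) (Φ.map f) (Φ.map g) where
  proj := by simp only [← Φ.map_comp, h.proj]
  zero := by simp only [← Φ.map_comp, h.zero]
  add := by
    obtain ⟨x, ⟨h0, h1⟩, hx⟩ := h.add
    exact ⟨Φ.map x, ⟨by simp only [← Φ.map_comp, h0], by simp only [← Φ.map_comp, h1]⟩,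
      by simp only [← Φ.map_comp, hx]⟩

theorem isAdditiveBundleMorphism_rebase (q : BundleData B) (e : B ≅ B') :
    IsAdditiveBundleMorphism q (q.rebase e) e.hom (𝟙 q.total) where
  proj := by simp
  zero := by simp
  add := ⟨𝟙 _, ⟨by simp, by simp⟩, by simp⟩

theorem isAdditiveBundleMorphism_rebase_inv (q : BundleData B) (e : B ≅ B') :
    IsAdditiveBundleMorphism (q.rebase e) q e.inv (𝟙 q.total) where
  proj := by simp
  zero := by simp
  add := ⟨𝟙 _, ⟨by simp, by simp⟩, by simp⟩

/-- Apart from the universal property, every clause asserts morphisms satisfying equations, which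
any functor preserves. The pullbacks are a separate hypothesis because `Φ` need not preserve limits.
-/
theorem IsAdditiveBundle.image {q : BundleData B} (h : q.IsAdditiveBundle) (Φ : C ⥤ D)
    (hΦ : ∀ (n : ℕ) [n.AtLeastTwo], (q.image Φ).IsFoldPullback n) :
    (q.image Φ).IsAdditiveBundle where
  isFoldPullback n _ := hΦ n
  zero_proj := by simp only [← Φ.map_comp, h.zero_proj, Φ.map_id]
  add_proj := by simp only [← Φ.map_comp, h.add_proj]
  add_assoc := by
    obtain ⟨a, b, x, y, ⟨ha, ha'⟩, ⟨hb, hb'⟩, ⟨hx, hx'⟩, ⟨hy, hy'⟩, hxy⟩ := h.add_assoc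
    refine ⟨Φ.map a, Φ.map b, Φ.map x, Φ.map y, ⟨?_, ?_⟩, ⟨?_, ?_⟩, ⟨?_, ?_⟩, ⟨?_, ?_⟩, ?_⟩ <;>
      simp only [← Φ.map_comp, *]
  zero_add := by
    obtain ⟨x, ⟨hx, hx'⟩, hxy⟩ := h.zero_add
    refine ⟨Φ.map x, ⟨?_, ?_⟩, ?_⟩ <;> simp only [← Φ.map_comp, ← Φ.map_id, *]
  add_comm := by
    obtain ⟨x, ⟨hx, hx'⟩, hxy⟩ := h.add_comm
    refine ⟨Φ.map x, ⟨?_, ?_⟩, ?_⟩ <;> simp only [← Φ.map_comp, *]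

theorem IsAdditiveBundle.rebase {q : BundleData B} (h : q.IsAdditiveBundle) (e : B ≅ B') :
    (q.rebase e).IsAdditiveBundle where
  isFoldPullback n _ := IsFoldCone.comp_iso (h.isFoldPullback n) e
  zero_proj := by simp [reassoc_of% h.zero_proj]
  add_proj := by simp [reassoc_of% h.add_proj]
  add_assoc := h.add_assoc
  zero_add := by
    obtain ⟨x, ⟨hx, hx'⟩, hxy⟩ := h.zero_add
    exact ⟨x, ⟨by simpa using hx, hx'⟩, hxy⟩
  add_comm := h.add_comm

end

section

variable {K : Type u} [Bicategory.{w, v} K] {K' : Type u'} [Bicategory.{w', v'} K']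
  (F : StrictPseudofunctor K K') {a b c d : K} {f : a ⟶ b}

/-- The image of bundle data under a 2-functor. -/
abbrev map (q : BundleData f) : BundleData (F.map f) := q.image (F.mapFunctor a b)

theorem map₂_whiskerRight_mapComp_hom {f f' : a ⟶ b} (η : f ⟶ f') (g : b ⟶ c) :
    F.map₂ (η ▷ g) ≫ (F.mapComp f' g).hom = (F.mapComp f g).hom ≫ F.map₂ η ▷ F.map g := by
  simp

theorem mapComp_inv_map₂_whiskerRight {f f' : a ⟶ b} (η : f ⟶ f') (g : b ⟶ c) :
    (F.mapComp f g).inv ≫ F.map₂ (η ▷ g) = F.map₂ η ▷ F.map g ≫ (F.mapComp f' g).inv := by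
  simp

theorem map₂_whiskerLeft_mapComp_hom {f f' : a ⟶ b} (g : d ⟶ a) (η : f ⟶ f') :
    F.map₂ (g ◁ η) ≫ (F.mapComp g f').hom = (F.mapComp g f).hom ≫ F.map g ◁ F.map₂ η := by
  simp

/-- The coherence cells of `F` are themselves additive bundle morphisms. The additivity axioms of an
image are then composites of such morphisms, and only the resulting base and total 2-cells remain to
be compared. -/
theorem isAdditiveBundleMorphism_map_post (q : BundleData f) (g : b ⟶ c) :
    IsAdditiveBundleMorphism ((q.post g).map F) ((q.map F).post (F.map g)) (F.mapComp f g).hom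
      (F.mapComp q.total g).hom where
  proj := (map₂_whiskerRight_mapComp_hom F q.proj g).symm
  zero := map₂_whiskerRight_mapComp_hom F q.zero g
  add := ⟨(F.mapComp _ g).hom, ⟨(map₂_whiskerRight_mapComp_hom F (q.π 2 0) g).symm,
    (map₂_whiskerRight_mapComp_hom F (q.π 2 1) g).symm⟩, map₂_whiskerRight_mapComp_hom F q.add g⟩

theorem isAdditiveBundleMorphism_map_post_inv (q : BundleData f) (g : b ⟶ c) :
    IsAdditiveBundleMorphism ((q.map F).post (F.map g)) ((q.post g).map F) (F.mapComp f g).inv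
      (F.mapComp q.total g).inv where
  proj := mapComp_inv_map₂_whiskerRight F q.proj g
  zero := (mapComp_inv_map₂_whiskerRight F q.zero g).symm
  add := ⟨(F.mapComp _ g).inv, ⟨mapComp_inv_map₂_whiskerRight F (q.π 2 0) g,
    mapComp_inv_map₂_whiskerRight F (q.π 2 1) g⟩, (mapComp_inv_map₂_whiskerRight F q.add g).symm⟩

theorem isAdditiveBundleMorphism_map_pre (q : BundleData f) (g : d ⟶ a) :
    IsAdditiveBundleMorphism ((q.pre g).map F) ((q.map F).pre (F.map g)) (F.mapComp g f).hom
      (F.mapComp g q.total).hom where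
  proj := (map₂_whiskerLeft_mapComp_hom F g q.proj).symm
  zero := map₂_whiskerLeft_mapComp_hom F g q.zero
  add := ⟨(F.mapComp g _).hom, ⟨(map₂_whiskerLeft_mapComp_hom F g (q.π 2 0)).symm,
    (map₂_whiskerLeft_mapComp_hom F g (q.π 2 1)).symm⟩, map₂_whiskerLeft_mapComp_hom F g q.add⟩

end

end BundleData

section

variable {K : Type u} [Bicategory.{w, v} K] {K' : Type u'} [Bicategory.{w', v'} K']
  (F : StrictPseudofunctor K K')

/-- A 2-functor preserves the iterates of an endomorphism. -/
def mapIter {X : K} (T : X ⟶ X) : ∀ k, F.map (iter T k) ≅ iter (F.map T) k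
  | 0 => F.mapId X
  | k + 1 => F.mapComp _ _ ≪≫ whiskerRightIso (mapIter T k) (F.map T)

/-- Whiskering with images of 1-cells under a 2-functor. -/
def postcompMapIso {a b c : K} {t : b ⟶ c} {t' : F.obj b ⟶ F.obj c} (e : F.map t ≅ t') :
    postcomp a t ⋙ F.mapFunctor a c ≅ F.mapFunctor a b ⋙ postcomp _ t' :=
  NatIso.ofComponents (fun f => F.mapComp f t ≪≫ whiskerLeftIso (F.map f) e) fun {f g} φ => by
    change F.map₂ (φ ▷ t) ≫ (F.mapComp g t).hom ≫ F.map g ◁ e.hom =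
      ((F.mapComp f t).hom ≫ F.map f ◁ e.hom) ≫ F.map₂ φ ▷ t'
    simp [whisker_exchange]

/-- Up to isomorphism, `F ⋙ precomp G` is the composite of a functor `precomp G₀` and an
equivalence. -/
theorem IsLocalEquivalence.exists_iso {F : StrictPseudofunctor K K'} (hF : IsLocalEquivalence F)
    {a : K} (c : K) {Y : K'} (G : Y ⟶ F.obj a) :
    ∃ (Y₀ : K) (G₀ : Y₀ ⟶ a) (Ψ : (Y₀ ⟶ c) ⥤ (Y ⟶ F.obj c)), Ψ.IsEquivalence ∧
      Nonempty (Bicategory.precomp c G₀ ⋙ Ψ ≅ F.mapFunctor a c ⋙ Bicategory.precomp _ G) := by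
  obtain ⟨Y₀, i, hi⟩ := hF.exists_precomp Y
  have := hi
  have := hF.mapFunctor_isEquivalence
  -- `G` is factored up to isomorphism as `i` followed by `F.map G₀`: first essential surjectivity
  -- of precomposition with `i`, then that of `F` on hom-categories.
  let G₁ : F.obj Y₀ ⟶ F.obj a := (Bicategory.precomp _ i).objPreimage G
  let e₁ : i ≫ G₁ ≅ G := (Bicategory.precomp _ i).objObjPreimageIso G
  let G₀ : Y₀ ⟶ a := (F.mapFunctor Y₀ a).objPreimage G₁
  let e₀ : F.map G₀ ≅ G₁ := (F.mapFunctor Y₀ a).objObjPreimageIso G₁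
  let e₂ : i ≫ F.map G₀ ≅ G := whiskerLeftIso i e₀ ≪≫ e₁
  refine ⟨Y₀, G₀, F.mapFunctor Y₀ c ⋙ Bicategory.precomp _ i, inferInstance,
    ⟨NatIso.ofComponents (fun f => whiskerLeftIso i (F.mapComp G₀ f) ≪≫
      (α_ i (F.map G₀) (F.map f)).symm ≪≫ whiskerRightIso e₂ _) fun {f g} φ => ?_⟩⟩
  change i ◁ F.map₂ (G₀ ◁ φ) ≫ i ◁ (F.mapComp G₀ g).hom ≫
      (α_ i (F.map G₀) (F.map g)).inv ≫ e₂.hom ▷ _ =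
    (i ◁ (F.mapComp G₀ f).hom ≫ (α_ i (F.map G₀) (F.map f)).inv ≫ e₂.hom ▷ _) ≫ G ◁ F.map₂ φ
  rw [Category.assoc, Category.assoc, ← whisker_exchange, ← associator_inv_naturality_right_assoc,
    ← whiskerLeft_comp_assoc, ← whiskerLeft_comp_assoc]
  simp

end

end Tangentad

/-! ### Preservation of the tangentad axioms by local equivalences -/

namespace Tangentad

open TwoCat BundleData

variable {K : Type u} [Bicategory.{w, v} K] {K' : Type u'} [Bicategory.{w', v'} K']
  {F : StrictPseudofunctor K K'}

section

variable {a b c d : K}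

theorem map₂_associator_inv (f : a ⟶ b) (g : b ⟶ c) (h : c ⟶ d) :
    F.map₂ (α_ f g h).inv = (F.mapComp f (g ≫ h)).hom ≫ F.map f ◁ (F.mapComp g h).hom ≫
      (α_ (F.map f) (F.map g) (F.map h)).inv ≫ (F.mapComp f g).inv ▷ F.map h ≫
        (F.mapComp (f ≫ g) h).inv := by
  rw [← cancel_epi (F.map₂ (α_ f g h).hom), ← F.map₂_comp, Iso.hom_inv_id, F.map₂_id,
    F.map₂_associator]
  simp

theorem map₂_leftUnitor_inv (f : a ⟶ b) :
    F.map₂ (λ_ f).inv = (λ_ (F.map f)).inv ≫ (F.mapId a).inv ▷ F.map f ≫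
      (F.mapComp (𝟙 a) f).inv := by
  rw [← cancel_epi (F.map₂ (λ_ f).hom), ← F.map₂_comp, Iso.hom_inv_id, F.map₂_id,
    F.map₂_left_unitor]
  simp

theorem map₂_rightUnitor_inv (f : a ⟶ b) :
    F.map₂ (ρ_ f).inv = (ρ_ (F.map f)).inv ≫ F.map f ◁ (F.mapId b).inv ≫
      (F.mapComp f (𝟙 b)).inv := by
  rw [← cancel_epi (F.map₂ (ρ_ f).hom), ← F.map₂_comp, Iso.hom_inv_id, F.map₂_id,
    F.map₂_right_unitor]
  simp

variable {X : K} {T : X ⟶ X} (l : T ⟶ T ≫ T) (c : T ≫ T ⟶ T ≫ T)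

variable (F) in
/-- The image of a 2-cell `T ⟶ T²`. -/
abbrev mapLift : F.map T ⟶ F.map T ≫ F.map T := F.map₂ l ≫ (F.mapComp T T).hom

variable (F) in
/-- The image of a 2-cell `T² ⟶ T²`. -/
abbrev mapFlip : F.map T ≫ F.map T ⟶ F.map T ≫ F.map T :=
  (F.mapComp T T).inv ≫ F.map₂ c ≫ (F.mapComp T T).hom

variable {l c}

/-- `F` is applied to the equation, and coherence cells are composed at the ends until the boundary
consists of composites of `F.map T`. The other equational axioms are treated in the same way. -/
theorem mapLift_coassoc (h : l ≫ l ▷ T ≫ (α_ T T T).hom = l ≫ T ◁ l) :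
    mapLift F l ≫ mapLift F l ▷ F.map T ≫ (α_ (F.map T) (F.map T) (F.map T)).hom =
      mapLift F l ≫ F.map T ◁ mapLift F l := by
  have h := congrArg (fun η => F.map₂ η ≫ (F.mapComp _ _).hom ≫ F.map T ◁ (F.mapComp _ _).hom) h
  simpa using h

theorem mapLift_flip (h : l ≫ c = l) : mapLift F l ≫ mapFlip F c = mapLift F l := by
  simp [← F.map₂_comp_assoc, h]

theorem mapFlip_flip (h : c ≫ c = 𝟙 _) : mapFlip F c ≫ mapFlip F c = 𝟙 _ := by
  have h := congrArg (fun η => F.map₂ η) h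
  simp only [F.map₂_comp, F.map₂_id] at h
  simp [reassoc_of% h]

theorem mapLift_flip_flip (h : T ◁ l ≫ (α_ T T T).inv ≫ c ▷ T ≫ (α_ T T T).hom ≫ T ◁ c =
      c ≫ l ▷ T ≫ (α_ T T T).hom) :
    F.map T ◁ mapLift F l ≫ (α_ _ _ _).inv ≫ mapFlip F c ▷ F.map T ≫ (α_ _ _ _).hom ≫
      F.map T ◁ mapFlip F c = mapFlip F c ≫ mapLift F l ▷ F.map T ≫ (α_ _ _ _).hom := by
  have h := congrArg (fun η => (F.mapComp _ _).inv ≫ F.map₂ η ≫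
    (F.mapComp _ _).hom ≫ F.map T ◁ (F.mapComp _ _).hom) h
  simpa [map₂_associator_inv] using h

theorem mapFlip_braid (h : c ▷ T ≫ (α_ T T T).hom ≫ T ◁ c ≫ (α_ T T T).inv ≫ c ▷ T =
      (α_ T T T).hom ≫ T ◁ c ≫ (α_ T T T).inv ≫ c ▷ T ≫
        (α_ T T T).hom ≫ T ◁ c ≫ (α_ T T T).inv) :
    mapFlip F c ▷ F.map T ≫ (α_ _ _ _).hom ≫ F.map T ◁ mapFlip F c ≫ (α_ _ _ _).inv ≫
        mapFlip F c ▷ F.map T =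
      (α_ _ _ _).hom ≫ F.map T ◁ mapFlip F c ≫ (α_ _ _ _).inv ≫ mapFlip F c ▷ F.map T ≫
        (α_ _ _ _).hom ≫ F.map T ◁ mapFlip F c ≫ (α_ _ _ _).inv := by
  have h := congrArg (fun η => (F.mapComp _ _).inv ▷ F.map T ≫ (F.mapComp _ _).inv ≫
    F.map₂ η ≫ (F.mapComp _ _).hom ≫ (F.mapComp _ _).hom ▷ F.map T) h
  simpa [map₂_associator_inv] using h

theorem map_zeroPair {P : X ⟶ X} {x : P ⟶ P ≫ T} {π : P ⟶ T} {z : 𝟙 X ⟶ T}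
    (h : x ≫ π ▷ T = π ≫ (ρ_ T).inv ≫ T ◁ z) :
    (F.map₂ x ≫ (F.mapComp P T).hom) ≫ F.map₂ π ▷ F.map T =
      F.map₂ π ≫ (ρ_ (F.map T)).inv ≫ F.map T ◁ ((F.mapId X).inv ≫ F.map₂ z) := by
  have h := congrArg (fun η => F.map₂ η ≫ (F.mapComp _ _).hom) h
  simpa [map₂_rightUnitor_inv] using h

theorem map_liftPair {P : X ⟶ X} {x : P ⟶ P ≫ T} {π : P ⟶ T} (h : x ≫ π ▷ T = π ≫ l) :
    (F.map₂ x ≫ (F.mapComp P T).hom) ≫ F.map₂ π ▷ F.map T = F.map₂ π ≫ mapLift F l := by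
  have h := congrArg (fun η => F.map₂ η ≫ (F.mapComp _ _).hom) h
  simpa using h

/-- The two squares differ only by coherence isomorphisms at the corners $T^2$ and $\mathrm{id}$. -/
theorem isPullback_mapSquare {P : X ⟶ X} {x : P ⟶ P ≫ T} {s π : P ⟶ T} {p : T ⟶ 𝟙 X}
    {z : 𝟙 X ⟶ T} {Y : K'} {G : Y ⟶ F.obj X}
    (h : IsPullback (G ◁ F.map₂ (x ≫ s ▷ T)) (G ◁ F.map₂ (π ≫ p))
      (G ◁ F.map₂ (p ▷ T ≫ (λ_ T).hom)) (G ◁ F.map₂ z)) :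
    IsPullback (G ◁ ((F.map₂ x ≫ (F.mapComp P T).hom) ≫ F.map₂ s ▷ F.map T))
      (G ◁ (F.map₂ π ≫ F.map₂ p ≫ (F.mapId X).hom))
      (G ◁ ((F.map₂ p ≫ (F.mapId X).hom) ▷ F.map T ≫ (λ_ (F.map T)).hom))
      (G ◁ ((F.mapId X).inv ≫ F.map₂ z)) :=
  h.of_iso (Iso.refl _) (whiskerLeftIso G (F.mapComp T T)) (whiskerLeftIso G (F.mapId X))
    (Iso.refl _) (by simp) (by simp) (by simp) (by simp)

end

/-- A test 1-cell `G` into the image is traded for a 1-cell `G₀` of the source followed by an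
equivalence of hom-categories, so the pointwise pullback at `G₀` gives the one at `G`. -/
theorem IsLocalEquivalence.isFoldPullback (hF : IsLocalEquivalence F) {A : TangentData K}
    (hA : A.IsTangentad) (n : ℕ) [n.AtLeastTwo] (k : ℕ) {Y : K'} (G : Y ⟶ F.obj A.X) :
    (((A.map F).p.post (iter (A.map F).T k)).pre G).IsFoldPullback n := by
  obtain ⟨Y₀, G₀, Ψ, hΨ, ⟨e⟩⟩ := hF.exists_iso A.X G
  have h := IsFoldCone.of_natIso
    (Φ := (postcomp A.X (iter A.T k) ⋙ Bicategory.precomp A.X G₀) ⋙ Ψ)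
    (IsFoldCone.map (hA.isFoldPullback n k Y₀ G₀) Ψ)
    (Functor.isoWhiskerLeft (postcomp A.X (iter A.T k)) e ≪≫
      Functor.isoWhiskerRight (postcompMapIso F (mapIter F A.T k)) (Bicategory.precomp _ G))
  -- The projection of the image bundle ends in `mapId`; an isomorphism on the base does not affect
  -- the pullback.
  have h' := IsFoldCone.comp_iso h (whiskerLeftIso G (whiskerRightIso (F.mapId A.X) (iter (F.map A.T) k)))
  have e' : G ◁ (F.map₂ A.p.proj ▷ iter (F.map A.T) k) ≫
      G ◁ (F.mapId A.X).hom ▷ iter (F.map A.T) k =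
      G ◁ ((F.map₂ A.p.proj ≫ (F.mapId A.X).hom) ▷ iter (F.map A.T) k) := by simp
  exact e'.subst (motive := fun p => IsFoldCone p _) h'

theorem unitors_naturality {X : K} {f g : X ⟶ X} (η : f ⟶ g) :
    𝟙 X ◁ (η ▷ 𝟙 X) ≫ (λ_ (g ≫ 𝟙 X) ≪≫ ρ_ g).hom = (λ_ (f ≫ 𝟙 X) ≪≫ ρ_ f).hom ≫ η := by
  rw [Iso.trans_hom, Iso.trans_hom, leftUnitor_naturality_assoc, Category.assoc,
    rightUnitor_naturality]

/-- Pointwiseness for the zeroth iterate and the identity test 1-cell is the plain universal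
property, up to unitors. -/
theorem IsFoldCone.of_post_id_pre_id {X : K} {f : X ⟶ X} (q : BundleData f) (n : ℕ)
    [n.AtLeastTwo] (h : ((q.post (𝟙 X)).pre (𝟙 X)).IsFoldPullback n) : q.IsFoldPullback n :=
  IsFoldCone.of_iso h (λ_ (f ≫ 𝟙 X) ≪≫ ρ_ f) (λ_ (q.total ≫ 𝟙 X) ≪≫ ρ_ q.total)
    (λ_ (q.pow n ≫ 𝟙 X) ≪≫ ρ_ (q.pow n)) (unitors_naturality q.proj)
    fun i => unitors_naturality (q.π n i)

theorem TangentData.IsTangentad.map (hF : IsLocalEquivalence F) {A : TangentData K}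
    (hA : A.IsTangentad) : (A.map F).IsTangentad where
  isAdditiveBundle := by
    refine (hA.isAdditiveBundle.image (F.mapFunctor _ _) fun n _ => ?_).rebase (F.mapId A.X)
    have h := IsFoldCone.of_post_id_pre_id _ n (hF.isFoldPullback hA n 0 (𝟙 _))
    have h' := IsFoldCone.comp_iso h (F.mapId A.X).symm
    have e : (F.map₂ A.p.proj ≫ (F.mapId A.X).hom) ≫ (F.mapId A.X).inv = F.map₂ A.p.proj := by
      simp
    exact e.subst (motive := fun p => IsFoldCone p _) h'
  isFoldPullback n _ k Y G := hF.isFoldPullback hA n k G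
  lift_additive := by
    refine IsAdditiveBundleMorphism.congr
      ((isAdditiveBundleMorphism_rebase_inv (A.p.map F) (F.mapId A.X)).comp
      ((hA.lift_additive.image (F.mapFunctor _ _)).comp
      ((isAdditiveBundleMorphism_map_post F A.p A.T).comp
      ((isAdditiveBundleMorphism_rebase (A.p.map F) (F.mapId A.X)).post (F.map A.T))))) ?_ ?_
    · change (F.mapId A.X).inv ≫ F.map₂ (A.p.zero ≫ (λ_ A.T).inv) ≫ (F.mapComp _ A.T).hom ≫
        (F.mapId A.X).hom ▷ F.map A.T =
        ((F.mapId A.X).inv ≫ F.map₂ A.p.zero) ≫ (λ_ (F.map A.T)).inv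
      simp [map₂_leftUnitor_inv]
    · change 𝟙 _ ≫ F.map₂ A.l ≫ (F.mapComp _ A.T).hom ≫ 𝟙 _ ▷ F.map A.T = F.map₂ A.l ≫ _
      simp
  flip_additive := by
    refine IsAdditiveBundleMorphism.congr
      (((isAdditiveBundleMorphism_rebase_inv (A.p.map F) (F.mapId A.X)).post (F.map A.T)).comp
      ((isAdditiveBundleMorphism_map_post_inv F A.p A.T).comp
      ((hA.flip_additive.image (F.mapFunctor _ _)).comp
      ((isAdditiveBundleMorphism_map_pre F A.p A.T).comp
      ((isAdditiveBundleMorphism_rebase (A.p.map F) (F.mapId A.X)).pre (F.map A.T)))))) ?_ ?_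
    · change (F.mapId A.X).inv ▷ F.map A.T ≫ (F.mapComp _ A.T).inv ≫
        F.map₂ ((λ_ A.T).hom ≫ (ρ_ A.T).inv) ≫ (F.mapComp _ _).hom ≫
        F.map A.T ◁ (F.mapId A.X).hom = (λ_ (F.map A.T)).hom ≫ (ρ_ (F.map A.T)).inv
      simp [map₂_rightUnitor_inv]
    · change 𝟙 _ ▷ F.map A.T ≫ (F.mapComp _ A.T).inv ≫ F.map₂ A.c ≫ (F.mapComp _ A.T).hom ≫
        F.map A.T ◁ 𝟙 _ = _ ≫ F.map₂ A.c ≫ _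
      simp
  lift_coassoc := mapLift_coassoc hA.lift_coassoc
  lift_flip := mapLift_flip hA.lift_flip
  lift_flip_flip := mapLift_flip_flip hA.lift_flip_flip
  flip_flip := mapFlip_flip hA.flip_flip
  flip_braid := mapFlip_braid hA.flip_braid
  locally_linear := by
    obtain ⟨x, ⟨hx, hx'⟩, hp⟩ := hA.locally_linear
    refine ⟨F.map₂ x ≫ (F.mapComp _ _).hom, ⟨map_zeroPair hx, map_liftPair hx'⟩, fun Y G => ?_⟩
    obtain ⟨Y₀, G₀, Ψ, hΨ, ⟨e⟩⟩ := hF.exists_iso A.X G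
    have h := isPullback_of_natIso (Φ := Bicategory.precomp A.X G₀ ⋙ Ψ) ((hp Y₀ G₀).map Ψ) e
    exact isPullback_mapSquare h

end Tangentad

namespace Tangentad

open TwoCat BundleData

variable {K : Type u} [Bicategory.{w, v} K] {K' : Type u'} [Bicategory.{w', v'} K']
  {F : StrictPseudofunctor K K'}

/-! ## Images of lax tangent morphisms under 2-functors -/

section

variable {X Y : K} {T : X ⟶ X} {S : Y ⟶ Y} {f : X ⟶ Y}

variable (F) in
/-- The image of a distributive law. -/
abbrev mapLaw (α : T ≫ f ⟶ f ≫ S) : F.map T ≫ F.map f ⟶ F.map f ≫ F.map S :=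
  (F.mapComp T f).inv ≫ F.map₂ α ≫ (F.mapComp f S).hom

/-- The composite of a distributive law with itself. -/
abbrev sqLaw (α : T ≫ f ⟶ f ≫ S) : (T ≫ T) ≫ f ⟶ f ≫ S ≫ S :=
  (α_ T T f).hom ≫ T ◁ α ≫ (α_ T f S).inv ≫ α ▷ S ≫ (α_ f S S).hom

/-- Squaring a distributive law commutes with `F` up to coherence, which reduces compatibility with
$l$ and $c$ to one application of `F`. -/
theorem sqLaw_mapLaw (α : T ≫ f ⟶ f ≫ S) :
    sqLaw (mapLaw F α) = (F.mapComp T T).inv ▷ F.map f ≫ (F.mapComp (T ≫ T) f).inv ≫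
      F.map₂ (sqLaw α) ≫ (F.mapComp f (S ≫ S)).hom ≫ F.map f ◁ (F.mapComp S S).hom := by
  simp [map₂_associator_inv]

theorem mapLaw_lift {α : T ≫ f ⟶ f ≫ S} {l : T ⟶ T ≫ T} {l' : S ⟶ S ≫ S}
    (h : l ▷ f ≫ sqLaw α = α ≫ f ◁ l') :
    mapLift F l ▷ F.map f ≫ sqLaw (mapLaw F α) = mapLaw F α ≫ F.map f ◁ mapLift F l' := by
  rw [sqLaw_mapLaw, ← cancel_epi (F.mapComp T f).hom]
  have h := congrArg (fun η => F.map₂ η ≫ (F.mapComp _ _).hom ≫ F.map f ◁ (F.mapComp _ _).hom) h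
  simp only [F.map₂_comp, F.map₂_whisker_right, F.map₂_whisker_left, Category.assoc] at h
  simp [h, -Pseudofunctor.map₂_associator]

theorem mapLaw_flip {α : T ≫ f ⟶ f ≫ S} {c : T ≫ T ⟶ T ≫ T} {c' : S ≫ S ⟶ S ≫ S}
    (h : c ▷ f ≫ sqLaw α = sqLaw α ≫ f ◁ c') :
    mapFlip F c ▷ F.map f ≫ sqLaw (mapLaw F α) =
      sqLaw (mapLaw F α) ≫ F.map f ◁ mapFlip F c' := by
  rw [sqLaw_mapLaw]
  -- Only the boundary of the squared law matters here; making it opaque prevents its expansion into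
  -- whiskerings.
  generalize sqLaw α = σ at *
  have h := congrArg (fun η => F.map₂ η ≫ (F.mapComp _ _).hom ≫ F.map f ◁ (F.mapComp _ _).hom) h
  simp only [F.map₂_comp, F.map₂_whisker_right, F.map₂_whisker_left, Category.assoc] at h
  rw [← cancel_epi ((F.mapComp T T).hom ▷ F.map f), ← cancel_epi (F.mapComp (T ≫ T) f).hom]
  simp at h
  simp [h]

theorem mapLaw_id : (F.mapComp T (𝟙 X)).inv ≫ F.map₂ ((ρ_ T).hom ≫ (λ_ T).inv) ≫
    (F.mapComp (𝟙 X) T).hom ≫ (F.mapId X).hom ▷ F.map T =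
      F.map T ◁ (F.mapId X).hom ≫ (ρ_ (F.map T)).hom ≫ (λ_ (F.map T)).inv := by
  simp [map₂_leftUnitor_inv]

theorem mapLaw_compatible {α : T ≫ f ⟶ f ≫ S} {g : X ⟶ Y} {β : T ≫ g ⟶ g ≫ S} {φ : f ⟶ g}
    (h : α ≫ φ ▷ S = T ◁ φ ≫ β) :
    mapLaw F α ≫ F.map₂ φ ▷ F.map S = F.map T ◁ F.map₂ φ ≫ mapLaw F β := by
  have h := congrArg (fun η => F.map₂ η ≫ (F.mapComp _ _).hom) h
  rw [← cancel_epi (F.mapComp T f).hom]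
  simp at h
  simp [h]

theorem mapLaw_comp {Z : K} {R : Z ⟶ Z} {g : Y ⟶ Z} (α : T ≫ f ⟶ f ≫ S) (β : S ≫ g ⟶ g ≫ R) :
    mapLaw F ((α_ T f g).inv ≫ α ▷ g ≫ (α_ f S g).hom ≫ f ◁ β ≫ (α_ f g R).inv) ≫
        (F.mapComp f g).hom ▷ F.map R =
      F.map T ◁ (F.mapComp f g).hom ≫ (α_ _ _ _).inv ≫ mapLaw F α ▷ F.map g ≫ (α_ _ _ _).hom ≫
        F.map f ◁ mapLaw F β ≫ (α_ _ _ _).inv := by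
  simp [map₂_associator_inv]

end

namespace LaxData

variable {A B C : TangentData K}

theorem IsLax.map {m : LaxData A B} (hm : m.IsLax) : (m.map F).IsLax where
  additive := by
    refine IsAdditiveBundleMorphism.congr
      (((isAdditiveBundleMorphism_rebase_inv (A.p.map F) (F.mapId A.X)).post (F.map m.F)).comp
      ((isAdditiveBundleMorphism_map_post_inv F A.p m.F).comp
      ((hm.additive.image (F.mapFunctor _ _)).comp
      ((isAdditiveBundleMorphism_map_pre F B.p m.F).comp
      ((isAdditiveBundleMorphism_rebase (B.p.map F) (F.mapId B.X)).pre (F.map m.F)))))) ?_ ?_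
    · change (F.mapId A.X).inv ▷ F.map m.F ≫ (F.mapComp _ m.F).inv ≫
        F.map₂ ((λ_ m.F).hom ≫ (ρ_ m.F).inv) ≫ (F.mapComp _ _).hom ≫
        F.map m.F ◁ (F.mapId B.X).hom = (λ_ (F.map m.F)).hom ≫ (ρ_ (F.map m.F)).inv
      simp [map₂_rightUnitor_inv]
    · change 𝟙 _ ▷ F.map m.F ≫ (F.mapComp _ m.F).inv ≫ F.map₂ m.α ≫ (F.mapComp _ B.T).hom ≫
        F.map m.F ◁ 𝟙 _ = _ ≫ F.map₂ m.α ≫ _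
      simp
  lift := mapLaw_lift hm.lift
  flip := mapLaw_flip hm.flip

theorem IsCompatible.map {m n : LaxData A B} {φ : m.F ⟶ n.F} (h : IsCompatible m n φ) :
    IsCompatible (m.map F) (n.map F) (F.map₂ φ) :=
  mapLaw_compatible h

theorem isCompatible_map_id (A : TangentData K) :
    IsCompatible ((LaxData.id A).map F) (LaxData.id (A.map F)) (F.mapId A.X).hom := by
  have h := mapLaw_id (F := F) (T := A.T)
  refine Eq.trans ?_ h
  exact (Category.assoc _ _ _).trans (congrArg (_ ≫ ·) (Category.assoc _ _ _))

theorem isCompatible_map_comp (m : LaxData A B) (n : LaxData B C) :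
    IsCompatible ((m.comp n).map F) ((m.map F).comp (n.map F)) (F.mapComp m.F n.F).hom :=
  mapLaw_comp m.α n.α

end LaxData

end Tangentad

namespace Tangentad

open TwoCat BundleData

/-! ## Bundle data and fully faithful functors -/

namespace BundleData

section

variable {C : Type*} [Category* C] {D : Type*} [Category* D] {E : Type*} [Category* E]
  {B B' : C} (R : C ⥤ D) [R.Full] [R.Faithful] (S : C ⥤ E)

/-- Fullness supplies the morphism between the two-fold pullbacks, and faithfulness supplies the
equations. -/
theorem IsAdditiveBundleMorphism.of_image {q : BundleData B} {q' : BundleData B'} {f : B ⟶ B'}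
    {g : q.total ⟶ q'.total}
    (h : IsAdditiveBundleMorphism (q.image R) (q'.image R) (R.map f) (R.map g)) :
    IsAdditiveBundleMorphism q q' f g where
  proj := R.map_injective (by simpa using h.proj)
  zero := R.map_injective (by simpa using h.zero)
  add := by
    obtain ⟨x, ⟨h0, h1⟩, hx⟩ := h.add
    exact ⟨R.preimage x, ⟨R.map_injective (by simpa using h0), R.map_injective (by simpa using h1)⟩,
      R.map_injective (by simpa using hx)⟩

/-- This moves algebra from one image to another: equations and pairings lift along the fully
faithful `R` and are pushed forward by `S`. It is used with `R` forgetting left adjoints and `S`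
forgetting right adjoints, where only the pullbacks need a separate argument. -/
theorem IsAdditiveBundle.image_of_image {q : BundleData B} (h : (q.image R).IsAdditiveBundle)
    (hS : ∀ (n : ℕ) [n.AtLeastTwo], (q.image S).IsFoldPullback n) :
    (q.image S).IsAdditiveBundle where
  isFoldPullback n _ := hS n
  zero_proj := by
    have : q.zero ≫ q.proj = 𝟙 _ := R.map_injective (by simpa using h.zero_proj)
    simp only [← S.map_comp, this, S.map_id]
  add_proj := by
    have : q.add ≫ q.proj = q.π 2 0 ≫ q.proj := R.map_injective (by simpa using h.add_proj)
    simp only [← S.map_comp, this]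
  add_assoc := by
    obtain ⟨a, b, x, y, ⟨ha, ha'⟩, ⟨hb, hb'⟩, ⟨hx, hx'⟩, ⟨hy, hy'⟩, hxy⟩ := h.add_assoc
    obtain ⟨a, rfl⟩ := R.map_surjective a
    obtain ⟨b, rfl⟩ := R.map_surjective b
    obtain ⟨x, rfl⟩ := R.map_surjective x
    obtain ⟨y, rfl⟩ := R.map_surjective y
    simp only [← R.map_comp, R.map_injective.eq_iff] at *
    refine ⟨S.map a, S.map b, S.map x, S.map y, ⟨?_, ?_⟩, ⟨?_, ?_⟩, ⟨?_, ?_⟩, ⟨?_, ?_⟩, ?_⟩ <;>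
      simp only [← S.map_comp, *]
  zero_add := by
    obtain ⟨x, ⟨hx, hx'⟩, hxy⟩ := h.zero_add
    obtain ⟨x, rfl⟩ := R.map_surjective x
    simp only [← R.map_comp, ← R.map_id, R.map_injective.eq_iff] at *
    refine ⟨S.map x, ⟨?_, ?_⟩, ?_⟩ <;> simp only [← S.map_comp, ← S.map_id, *]
  add_comm := by
    obtain ⟨x, ⟨hx, hx'⟩, hxy⟩ := h.add_comm
    obtain ⟨x, rfl⟩ := R.map_surjective x
    simp only [← R.map_comp, R.map_injective.eq_iff] at *
    refine ⟨S.map x, ⟨?_, ?_⟩, ?_⟩ <;> simp only [← S.map_comp, *]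

end

end BundleData

section

variable {K : Type u} [Bicategory.{w, v} K]

/-! ## Forgetting one of two adjoints -/

/-- The left half of a conjugate pair is the mate of the right half. Hence equations in `Adj K` may
be checked on right adjoints alone. -/
theorem adjHom₂_ext {a b : Adj K} {x y : a ⟶ b} {f g : x ⟶ y} (h : f.τr = g.τr) : f = g :=
  Adj.hom₂_ext (by rw [← f.conjugateEquiv_symm_τr, ← g.conjugateEquiv_symm_τr, h])

/-- The 2-cell of adjunctions given by a 2-cell of right adjoints. -/
abbrev adjHom₂ {a b : Adj K} {x y : a ⟶ b} (f : y.r ⟶ x.r) : x ⟶ y :=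
  Adj.Hom₂.mk ((conjugateEquiv y.adj x.adj).symm f) f (Equiv.apply_symm_apply _ _)

/-- The functor that forgets left adjoints. -/
abbrev forgetLeft (a b : Adj K) : (a ⟶ b)ᵒᵖ ⥤ (b.obj ⟶ a.obj) where
  obj x := x.unop.r
  map f := f.unop.τr

/-- The functor that forgets right adjoints. -/
abbrev forgetRight (a b : Adj K) : (a ⟶ b)ᵒᵖ ⥤ (Co.of a.obj ⟶ Co.of b.obj) where
  obj x := Co.hom x.unop.l
  map f := Co.hom₂ f.unop.τl

instance forgetLeft_full (a b : Adj K) : (forgetLeft a b).Full where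
  map_surjective f := ⟨(adjHom₂ f).op, rfl⟩

instance forgetLeft_faithful (a b : Adj K) : (forgetLeft a b).Faithful where
  map_injective h := Quiver.Hom.unop_inj (adjHom₂_ext h)

/-- This is the unit form of conjugacy, obtained from the general criterion for mates by inserting
and then cancelling unitors. -/
theorem unit_conjugateEquiv {c d : K} {l₁ l₂ : c ⟶ d} {r₁ r₂ : d ⟶ c} (adj₁ : l₁ ⊣ r₁)
    (adj₂ : l₂ ⊣ r₂) (β : l₂ ⟶ l₁) :
    adj₂.unit ≫ β ▷ r₂ = adj₁.unit ≫ l₁ ◁ conjugateEquiv adj₁ adj₂ β := by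
  have h := (mateEquiv_eq_iff adj₁ adj₂ ((λ_ l₂).hom ≫ β ≫ (ρ_ l₁).inv)
    ((ρ_ r₁).hom ≫ conjugateEquiv adj₁ adj₂ β ≫ (λ_ r₂).inv)).1 (by simp [conjugateEquiv_apply])
  rw [Adjunction.homEquiv₁_symm_apply, Adjunction.homEquiv₂_apply] at h
  have h' := congrArg (fun η => η ≫ l₁ ◁ (λ_ r₂).hom) h
  calc _ = (((ρ_ (𝟙 c)).inv ≫ 𝟙 c ◁ adj₂.unit ≫ (α_ (𝟙 c) l₂ r₂).inv ≫
        ((λ_ l₂).hom ≫ β ≫ (ρ_ l₁).inv) ▷ r₂) ≫ (α_ l₁ (𝟙 d) r₂).hom) ≫ l₁ ◁ (λ_ r₂).hom := by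
        simp
    _ = _ := by
        rw [← h']; simp

/-! ## Dual universal properties -/

section

variable {a b : Adj K} {Y : K} {G : Y ⟶ a.obj} {H : Y ⟶ b.obj}

/-- Transposition is natural in the adjunction: precomposing with a left half becomes postcomposing
with the right half. This turns colimits of left adjoints into limits of right adjoints. -/
theorem homEquiv₂_whiskerLeft_comp {x y : a ⟶ b} (θ : x ⟶ y) (φ : G ≫ y.l ⟶ H) :
    x.adj.homEquiv₂ (G ◁ θ.τl ≫ φ) = y.adj.homEquiv₂ φ ≫ H ◁ θ.τr := by
  have h := unit_conjugateEquiv y.adj x.adj θ.τl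
  rw [θ.conjugateEquiv_τl] at h
  rw [Adjunction.homEquiv₂_apply, Adjunction.homEquiv₂_apply]
  simp only [Category.assoc]
  rw [← whisker_exchange, comp_whiskerRight, ← associator_inv_naturality_right_assoc,
    ← associator_inv_naturality_middle_assoc, ← whiskerLeft_comp_assoc, ← whiskerLeft_comp_assoc, h]

/-- Transposing a cocone with vertex `H` gives a cone with vertex `G` over the right adjoints
precomposed with `H`. Since `H` ranges over all 1-cells, the pullback upstairs must be pointwise. -/
theorem IsFoldCone.coWhisker {n : ℕ} {B T P : a ⟶ b} (p : B ⟶ T) (π : Fin n → (T ⟶ P))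
    (hp : ∀ i j, p ≫ π i = p ≫ π j)
    (h : ∀ H : Y ⟶ b.obj, IsFoldCone (H ◁ p.τr) fun i => H ◁ (π i).τr) (G : Y ⟶ a.obj) :
    IsFoldCone (Co.hom₂ (G ◁ p.τl)) fun i => Co.hom₂ (G ◁ (π i).τl) := by
  refine ⟨fun i j => ?_, fun H f hf => ?_⟩
  · have := congrArg (fun θ : B ⟶ P => Co.hom₂ (G ◁ θ.τl)) (hp i j)
    simp only [Adj.comp_τl, whiskerLeft_comp] at this
    exact this
  · have key : ∀ (u : G ≫ P.l ⟶ H.unop), (∀ i, Co.hom₂ u ≫ Co.hom₂ (G ◁ (π i).τl) = f i) ↔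
        ∀ i, P.adj.homEquiv₂ u ≫ H.unop ◁ (π i).τr = T.adj.homEquiv₂ (f i).unop := fun u => by
      refine forall_congr' fun i => ?_
      rw [← homEquiv₂_whiskerLeft_comp, EmbeddingLike.apply_eq_iff_eq]
      exact ⟨fun h => congrArg Quiver.Hom.unop h, fun h => Quiver.Hom.unop_inj h⟩
    obtain ⟨u, hu, hu'⟩ := (h H.unop).2 G (fun i => T.adj.homEquiv₂ (f i).unop) fun i j => by
      rw [← homEquiv₂_whiskerLeft_comp, ← homEquiv₂_whiskerLeft_comp]
      exact congrArg (fun θ => B.adj.homEquiv₂ (Quiver.Hom.unop θ)) (hf i j)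
    refine ⟨Co.hom₂ (P.adj.homEquiv₂.symm u), (key _).2 (by simpa using hu), fun v hv => ?_⟩
    apply Quiver.Hom.unop_inj
    exact P.adj.homEquiv₂.eq_symm_apply.2 (hu' _ ((key v.unop).1 hv))

theorem isPullback_coWhisker {P X' Y' Z : a ⟶ b} {f : X' ⟶ P} {g : Y' ⟶ P} {h : Z ⟶ X'}
    {k : Z ⟶ Y'} (hp : h ≫ f = k ≫ g)
    (H : ∀ H : Y ⟶ b.obj, IsPullback (H ◁ f.τr) (H ◁ g.τr) (H ◁ h.τr) (H ◁ k.τr))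
    (G : Y ⟶ a.obj) :
    IsPullback (Co.hom₂ (G ◁ f.τl)) (Co.hom₂ (G ◁ g.τl)) (Co.hom₂ (G ◁ h.τl))
      (Co.hom₂ (G ◁ k.τl)) := by
  have key {X : a ⟶ b} {t : Y ⟶ b.obj} (θ : X ⟶ P) (u : G ≫ P.l ⟶ t) (v : G ≫ X.l ⟶ t) :
      G ◁ θ.τl ≫ u = v ↔ P.adj.homEquiv₂ u ≫ t ◁ θ.τr = X.adj.homEquiv₂ v := by
    rw [← homEquiv₂_whiskerLeft_comp, EmbeddingLike.apply_eq_iff_eq]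
  -- `IsPushout.op` exchanges the legs of the span and of the cospan, hence the order of the four
  -- arguments.
  refine (IsPushout.op (f := G ◁ k.τl) (g := G ◁ h.τl) (inl := G ◁ g.τl) (inr := G ◁ f.τl)
    ⟨⟨by simp only [← whiskerLeft_comp, ← Adj.comp_τl, hp]⟩,
      ⟨Limits.PushoutCocone.IsColimit.mk _ (fun s => P.adj.homEquiv₂.symm
        ((H s.pt).lift (X'.adj.homEquiv₂ s.inr) (Y'.adj.homEquiv₂ s.inl) ?_)) ?_ ?_ ?_⟩⟩)
  · rw [← homEquiv₂_whiskerLeft_comp, ← homEquiv₂_whiskerLeft_comp, s.condition]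
  · exact fun s => (key g _ _).2 (by simp)
  · exact fun s => (key f _ _).2 (by simp)
  · exact fun s m hm hm' => P.adj.homEquiv₂.eq_symm_apply.2 ((H s.pt).hom_ext
      (by rw [(key f _ _).1 hm', IsPullback.lift_fst])
      (by rw [(key g _ _).1 hm, IsPullback.lift_snd]))

end

end

end Tangentad

namespace Tangentad

open TwoCat BundleData

variable {K : Type u} [Bicategory.{w, v} K]

/-! ## The reversed axioms of a tangentad -/

theorem leftUnitors_naturality {X Y : K} {T : X ⟶ Y} {f g : X ⟶ X} (η : f ⟶ g) :
    𝟙 X ◁ (η ▷ (𝟙 X ≫ T)) ≫ (λ_ (g ≫ 𝟙 X ≫ T) ≪≫ whiskerLeftIso g (λ_ T)).hom =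
      (λ_ (f ≫ 𝟙 X ≫ T) ≪≫ whiskerLeftIso f (λ_ T)).hom ≫ η ▷ T := by
  rw [Iso.trans_hom, Iso.trans_hom, leftUnitor_naturality_assoc, Category.assoc,
    whiskerLeftIso_hom, whiskerLeftIso_hom, ← whisker_exchange]

theorem whiskerLeft_rightUnitor_naturality {X Y Z : K} (G : Z ⟶ X) {f g : X ⟶ Y} (η : f ⟶ g) :
    G ◁ (η ▷ 𝟙 Y) ≫ (whiskerLeftIso G (ρ_ g)).hom = (whiskerLeftIso G (ρ_ f)).hom ≫ G ◁ η := by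
  simp only [whiskerLeftIso_hom, ← whiskerLeft_comp, rightUnitor_naturality]

namespace TangentData.IsTangentad

variable {A : TangentData K}

theorem flip_proj (hA : A.IsTangentad) :
    A.c ≫ A.T ◁ A.p.proj = A.p.proj ▷ A.T ≫ (λ_ A.T).hom ≫ (ρ_ A.T).inv :=
  hA.flip_additive.proj

/-- Adjoints compose in reverse, which exchanges whiskering with $T$ on the two sides. The primed
statements are the axioms in the form needed on right adjoints; they come from the originals by
$c\cdot c=\mathrm{id}$, by $c\cdot l=l$, or merely by moving associators. -/
theorem flip_proj' (hA : A.IsTangentad) :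
    A.c ≫ A.p.proj ▷ A.T = A.T ◁ A.p.proj ≫ (ρ_ A.T).hom ≫ (λ_ A.T).inv := by
  rw [← cancel_mono ((λ_ A.T).hom ≫ (ρ_ A.T).inv), Category.assoc, ← hA.flip_proj,
    reassoc_of% hA.flip_flip]
  simp

theorem flip_zero' (hA : A.IsTangentad) :
    A.T ◁ A.p.zero ≫ A.c = (ρ_ A.T).hom ≫ (λ_ A.T).inv ≫ A.p.zero ▷ A.T := by
  have h : A.p.zero ▷ A.T ≫ A.c = ((λ_ A.T).hom ≫ (ρ_ A.T).inv) ≫ A.T ◁ A.p.zero :=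
    hA.flip_additive.zero
  rw [← cancel_epi ((λ_ A.T).hom ≫ (ρ_ A.T).inv), ← Category.assoc, ← h, Category.assoc,
    hA.flip_flip]
  simp

theorem post_isFoldPullback (hA : A.IsTangentad) (n : ℕ) [n.AtLeastTwo] :
    (A.p.post A.T).IsFoldPullback n :=
  IsFoldCone.of_iso (hA.isFoldPullback n 1 A.X (𝟙 _))
    (λ_ _ ≪≫ whiskerLeftIso _ (λ_ A.T)) (λ_ _ ≪≫ whiskerLeftIso _ (λ_ A.T))
    (λ_ _ ≪≫ whiskerLeftIso _ (λ_ A.T)) (leftUnitors_naturality _)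
    fun _ => leftUnitors_naturality _

theorem pre_isFoldPullback (hA : A.IsTangentad) (n : ℕ) [n.AtLeastTwo] {Y : K} (G : Y ⟶ A.X) :
    (A.p.pre G).IsFoldPullback n :=
  IsFoldCone.of_iso (hA.isFoldPullback n 0 Y G)
    (whiskerLeftIso G (ρ_ _)) (whiskerLeftIso G (ρ_ _)) (whiskerLeftIso G (ρ_ _))
    (whiskerLeft_rightUnitor_naturality _ _) fun _ => whiskerLeft_rightUnitor_naturality _ _

/-- The inverse of an additive isomorphism is additive, and $c$ is its own inverse. -/
theorem flip_additive' (hA : A.IsTangentad) : IsAdditiveBundleMorphism (A.p.pre A.T)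
    (A.p.post A.T) ((ρ_ A.T).hom ≫ (λ_ A.T).inv) A.c where
  proj := hA.flip_proj'
  zero := by simpa using hA.flip_zero'
  add := by
    obtain ⟨x, ⟨h0, h1⟩, hx⟩ := hA.flip_additive.add
    obtain ⟨y, hy, -⟩ := (hA.post_isFoldPullback 2).2 _ (fun i => A.T ◁ A.p.π 2 i ≫ A.c)
      fun i j => by
        have h := hA.isAdditiveBundle.isFoldPullback 2
        simp only [Category.assoc, hA.flip_proj', ← whiskerLeft_comp_assoc, h.1 i j]
    -- The maps induced by $c$ on the two-fold pullbacks compose to the identity, because their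
    -- components apply $c$ twice.
    have hyx : y ≫ x = 𝟙 _ := by
      refine IsFoldCone.hom_ext (hA.pre_isFoldPullback 2 A.T) fun i => ?_
      have hi : x ≫ A.T ◁ A.p.π 2 i = A.p.π 2 i ▷ A.T ≫ A.c := by fin_cases i <;> assumption
      have hi' := hy i
      simp only [Category.assoc, hi, reassoc_of% hi', hA.flip_flip, Category.id_comp,
        Category.comp_id]
    refine ⟨y, ⟨hy 0, hy 1⟩, ?_⟩
    have hx' : A.p.add ▷ A.T = x ≫ A.T ◁ A.p.add ≫ A.c := by
      rw [← Category.assoc, ← hx, Category.assoc, hA.flip_flip, Category.comp_id]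
    change A.T ◁ A.p.add ≫ A.c = y ≫ A.p.add ▷ A.T
    rw [hx', ← Category.assoc y, hyx, Category.id_comp]

theorem lift_additive' (hA : A.IsTangentad) : IsAdditiveBundleMorphism A.p (A.p.pre A.T)
    (A.p.zero ≫ (ρ_ A.T).inv) A.l :=
  (hA.lift_additive.comp hA.flip_additive).congr (by simp) hA.lift_flip

theorem lift_coassoc' (hA : A.IsTangentad) :
    A.l ≫ A.T ◁ A.l ≫ (α_ A.T A.T A.T).inv = A.l ≫ A.l ▷ A.T := by
  rw [← Category.assoc, ← hA.lift_coassoc]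
  simp

theorem lift_flip_flip' (hA : A.IsTangentad) :
    A.l ▷ A.T ≫ (α_ A.T A.T A.T).hom ≫ A.T ◁ A.c ≫ (α_ A.T A.T A.T).inv ≫ A.c ▷ A.T =
      A.c ≫ A.T ◁ A.l ≫ (α_ A.T A.T A.T).inv := by
  have h : A.l ▷ A.T ≫ (α_ A.T A.T A.T).hom = A.c ≫ A.T ◁ A.l ≫ (α_ A.T A.T A.T).inv ≫
      A.c ▷ A.T ≫ (α_ A.T A.T A.T).hom ≫ A.T ◁ A.c := by
    rw [hA.lift_flip_flip, reassoc_of% hA.flip_flip]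
  rw [← Category.assoc, h]
  simp only [Category.assoc]
  rw [← whiskerLeft_comp_assoc A.T A.c A.c, hA.flip_flip]
  simp only [whiskerLeft_id, Category.id_comp, Iso.hom_inv_id_assoc, ← comp_whiskerRight,
    hA.flip_flip, id_whiskerRight, Category.comp_id]

theorem flip_braid' (hA : A.IsTangentad) :
    A.T ◁ A.c ≫ (α_ A.T A.T A.T).inv ≫ A.c ▷ A.T ≫ (α_ A.T A.T A.T).hom ≫ A.T ◁ A.c =
      (α_ A.T A.T A.T).inv ≫ A.c ▷ A.T ≫ (α_ A.T A.T A.T).hom ≫ A.T ◁ A.c ≫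
        (α_ A.T A.T A.T).inv ≫ A.c ▷ A.T ≫ (α_ A.T A.T A.T).hom := by
  have h := congrArg (fun η => (α_ A.T A.T A.T).inv ≫ η ≫ (α_ A.T A.T A.T).hom) hA.flip_braid
  simpa using h.symm

/-- The square is transported along the isomorphism $c$ at the corner $T^2$. The pairing into $TT_2$
is followed by the map that $c$ induces on two-fold pullbacks. -/
theorem locally_linear' (hA : A.IsTangentad) : ∃ x : A.p.pow 2 ⟶ A.T ≫ A.p.pow 2,
    (A.p.pre A.T).IsPair
      (A.p.π 2 0 ≫ (λ_ A.T).inv ≫ A.p.zero ▷ A.T) (A.p.π 2 1 ≫ A.l) x ∧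
    ∀ (Y : K) (G : Y ⟶ A.X), IsPullback
      (G ◁ (x ≫ A.T ◁ A.p.add)) (G ◁ (A.p.π 2 0 ≫ A.p.proj))
      (G ◁ (A.T ◁ A.p.proj ≫ (ρ_ A.T).hom)) (G ◁ A.p.zero) := by
  obtain ⟨x, ⟨h0, h1⟩, hp⟩ := hA.locally_linear
  obtain ⟨y, ⟨hy0, hy1⟩, hy⟩ := hA.flip_additive.add
  refine ⟨x ≫ y, ⟨?_, ?_⟩, fun Y G => ?_⟩
  · change (x ≫ y) ≫ A.T ◁ A.p.π 2 0 = _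
    have hy0 : y ≫ A.T ◁ A.p.π 2 0 = A.p.π 2 0 ▷ A.T ≫ A.c := hy0
    have h0 : x ≫ A.p.π 2 0 ▷ A.T = A.p.π 2 0 ≫ (ρ_ A.T).inv ≫ A.T ◁ A.p.zero := h0
    rw [Category.assoc, hy0, reassoc_of% h0, hA.flip_zero']
    simp
  · change (x ≫ y) ≫ A.T ◁ A.p.π 2 1 = _
    have hy1 : y ≫ A.T ◁ A.p.π 2 1 = A.p.π 2 1 ▷ A.T ≫ A.c := hy1
    have h1 : x ≫ A.p.π 2 1 ▷ A.T = A.p.π 2 1 ≫ A.l := h1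
    rw [Category.assoc, hy1, reassoc_of% h1, hA.lift_flip]
  · have hy : A.p.add ▷ A.T ≫ A.c = y ≫ A.T ◁ A.p.add := hy
    refine (hp Y G).of_iso (Iso.refl _)
      (whiskerLeftIso G ⟨A.c, A.c, hA.flip_flip, hA.flip_flip⟩) (Iso.refl _) (Iso.refl _)
      ?_ ?_ ?_ ?_
    · simp only [whiskerLeftIso_hom, Iso.refl_hom, Category.id_comp, ← whiskerLeft_comp,
        Category.assoc, hy]
    · simp
    · simp only [whiskerLeftIso_hom, Iso.refl_hom, Category.comp_id, ← whiskerLeft_comp,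
        reassoc_of% hA.flip_proj, Iso.inv_hom_id]
    · simp

end TangentData.IsTangentad

end Tangentad

namespace Tangentad

open TwoCat BundleData

variable {K : Type u} [Bicategory.{w, v} K]

/-! ## The left adjoint structure is an op-tangent structure -/

theorem BundleData.IsAdditiveBundle.forgetRight_of_forgetLeft {a b : Adj K} {x : (a ⟶ b)ᵒᵖ}
    {q : BundleData x} (h : (q.image (forgetLeft a b)).IsAdditiveBundle)
    (hq : ∀ (n : ℕ) [n.AtLeastTwo], (q.image (forgetRight a b)).IsFoldPullback n) :
    (q.image (forgetRight a b)).IsAdditiveBundle :=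
  h.image_of_image _ _ hq

namespace TangentData

variable (A : TangentData K) (L : A.LeftAdjoints)

/-- The adjunction `T♭ ⊣ T`, as a 1-cell of the bicategory of adjunctions. -/
abbrev adjTan : Adj.mk A.X ⟶ Adj.mk A.X := Adj.Hom.mk L.tan.adj

/-- The bundle data of a tangentad in the bicategory of adjunctions. -/
abbrev adjBundle : BundleData (op (𝟙 (Adj.mk A.X))) where
  total := op (A.adjTan L)
  proj := (adjHom₂ (x := 𝟙 (Adj.mk A.X)) (y := A.adjTan L) A.p.proj).op
  pow n _ := op (Adj.Hom.mk (L.pow n).adj)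
  π n _ i := (adjHom₂ (a := Adj.mk A.X) (b := Adj.mk A.X) (x := A.adjTan L)
    (y := Adj.Hom.mk (L.pow n).adj) (A.p.π n i)).op
  zero := (adjHom₂ (x := A.adjTan L) (y := 𝟙 (Adj.mk A.X)) A.p.zero).op
  add := (adjHom₂ (a := Adj.mk A.X) (b := Adj.mk A.X) (x := A.adjTan L)
    (y := Adj.Hom.mk (L.pow 2).adj) A.p.add).op

/-- The vertical lift in the bicategory of adjunctions. -/
abbrev adjLift : A.adjTan L ≫ A.adjTan L ⟶ A.adjTan L :=
  adjHom₂ (x := A.adjTan L ≫ A.adjTan L) (y := A.adjTan L) A.l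

/-- The canonical flip in the bicategory of adjunctions. -/
abbrev adjFlip : A.adjTan L ≫ A.adjTan L ⟶ A.adjTan L ≫ A.adjTan L :=
  adjHom₂ (x := A.adjTan L ≫ A.adjTan L) (y := A.adjTan L ≫ A.adjTan L) A.c

/-- Each iterate of $T^\flat$ thereby has a right adjoint, so whiskering with it stays inside `Adj
K`. -/
theorem exists_adj_iter (k : ℕ) : ∃ t : Adj.mk A.X ⟶ Adj.mk A.X,
    t.l = Co.un (iter (A.flat L).T k) := by
  induction k with
  | zero => exact ⟨𝟙 _, rfl⟩
  | succ k ih =>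
    obtain ⟨t, ht⟩ := ih
    exact ⟨t ≫ A.adjTan L, congrArg (· ≫ L.tan.left) ht⟩

namespace IsTangentad

variable {A}

/-- Whiskering an adjunction 2-cell on the right by `t` whiskers its right half on the left by
`t.r`. The condition for an iterate of $T^\flat$ at `H` thus becomes pointwiseness of $T_n$ at the
test 1-cell `H ≫ t.r`. -/
theorem flat_isFoldPullback (hA : A.IsTangentad) (n : ℕ) [n.AtLeastTwo] (k : ℕ) (Y : Co K)
    (G : Y ⟶ (A.flat L).X) :
    (((A.flat L).p.post (iter (A.flat L).T k)).pre G).IsFoldPullback n := by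
  obtain ⟨t, ht⟩ := A.exists_adj_iter L k
  have key : IsFoldCone (Co.hom₂ (Co.un G ◁ (Co.un₂ (A.flat L).p.proj ▷ t.l)))
      fun i => Co.hom₂ (Co.un G ◁ (Co.un₂ ((A.flat L).p.π n i) ▷ t.l)) := by
    refine IsFoldCone.coWhisker (a := Adj.mk A.X) (b := Adj.mk A.X)
      ((A.adjBundle L).proj.unop ▷ t) (fun i => ((A.adjBundle L).π n i).unop ▷ t)
      (fun i j => ?_) (fun H => ?_) (Co.un G)
    · rw [← comp_whiskerRight, ← comp_whiskerRight]
      congr 1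
      exact adjHom₂_ext ((hA.isAdditiveBundle.isFoldPullback n).1 i j)
    · exact IsFoldCone.of_iso (hA.pre_isFoldPullback n (H ≫ t.r)) (α_ H t.r (𝟙 _))
        (α_ H t.r A.T) (α_ H t.r (A.p.pow n)) (associator_naturality_right _ _ _)
        fun i => associator_naturality_right _ _ _
  have hk : iter (A.flat L).T k = Co.hom t.l := congrArg Co.hom ht.symm
  rw [hk]
  exact key

/-- Each equational axiom is stated in `Adj K`, proved there on right halves from the reversed
axioms, and projected to left halves. -/
theorem flat (hA : A.IsTangentad) : (A.flat L).IsTangentad where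
  isAdditiveBundle := by
    have h : ((A.adjBundle L).image (forgetLeft _ _)).IsAdditiveBundle := hA.isAdditiveBundle
    exact h.forgetRight_of_forgetLeft fun n _ =>
      IsFoldCone.of_post_id_pre_id (A.flat L).p n (hA.flat_isFoldPullback L n 0 _ (𝟙 _))
  isFoldPullback n _ k Y G := hA.flat_isFoldPullback L n k Y G
  lift_additive := by
    have h : IsAdditiveBundleMorphism (A.adjBundle L)
        ((A.adjBundle L).image (postcomp _ (A.adjTan L)).op)
        ((A.adjBundle L).zero ≫ (λ_ (A.adjTan L)).hom.op) (A.adjLift L).op :=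
      .of_image (forgetLeft _ _) hA.lift_additive'
    exact h.image (forgetRight _ _)
  flip_additive := by
    have h : IsAdditiveBundleMorphism ((A.adjBundle L).image (postcomp _ (A.adjTan L)).op)
        ((A.adjBundle L).image (precomp _ (A.adjTan L)).op)
        ((λ_ (A.adjTan L)).inv.op ≫ (ρ_ (A.adjTan L)).hom.op) (A.adjFlip L).op :=
      .of_image (forgetLeft _ _) hA.flip_additive'
    exact h.image (forgetRight _ _)
  lift_coassoc := by
    let t := A.adjTan L
    have h : ((α_ t t t).inv ≫ A.adjLift L ▷ t) ≫ A.adjLift L = t ◁ A.adjLift L ≫ A.adjLift L :=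
      adjHom₂_ext hA.lift_coassoc'
    exact congrArg (fun θ => Co.hom₂ θ.τl) h
  lift_flip :=
    congrArg (fun θ => Co.hom₂ θ.τl) (adjHom₂_ext hA.lift_flip :
      A.adjFlip L ≫ A.adjLift L = A.adjLift L)
  lift_flip_flip := by
    let t := A.adjTan L
    have h : (((t ◁ A.adjFlip L ≫ (α_ t t t).inv) ≫ A.adjFlip L ▷ t) ≫ (α_ t t t).hom) ≫
        t ◁ A.adjLift L = ((α_ t t t).inv ≫ A.adjLift L ▷ t) ≫ A.adjFlip L :=
      adjHom₂_ext hA.lift_flip_flip'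
    exact congrArg (fun θ => Co.hom₂ θ.τl) h
  flip_flip :=
    congrArg (fun θ => Co.hom₂ θ.τl) (adjHom₂_ext hA.flip_flip :
      A.adjFlip L ≫ A.adjFlip L = 𝟙 _)
  flip_braid := by
    let t := A.adjTan L
    have h : (((A.adjFlip L ▷ t ≫ (α_ t t t).hom) ≫ t ◁ A.adjFlip L) ≫ (α_ t t t).inv) ≫
        A.adjFlip L ▷ t = (((((((α_ t t t).hom ≫ t ◁ A.adjFlip L) ≫ (α_ t t t).inv) ≫
          A.adjFlip L ▷ t) ≫ (α_ t t t).hom) ≫ t ◁ A.adjFlip L) ≫ (α_ t t t).inv) :=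
      adjHom₂_ext hA.flip_braid'
    exact congrArg (fun θ => Co.hom₂ θ.τl) h
  locally_linear := by
    obtain ⟨x, ⟨h0, h1⟩, hx⟩ := hA.locally_linear'
    let t := A.adjTan L
    let q := A.adjBundle L
    let y : (q.pow 2).unop ≫ t ⟶ (q.pow 2).unop :=
      adjHom₂ (x := (q.pow 2).unop ≫ t) (y := (q.pow 2).unop) x
    have h0' : (q.π 2 0).unop ▷ t ≫ y = (t ◁ q.zero.unop ≫ (ρ_ t).hom) ≫ (q.π 2 0).unop :=
      adjHom₂_ext h0
    have h1' : (q.π 2 1).unop ▷ t ≫ y = A.adjLift L ≫ (q.π 2 1).unop := adjHom₂_ext h1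
    refine ⟨Co.hom₂ y.τl, ⟨congrArg (fun θ => Co.hom₂ θ.τl) h0',
      congrArg (fun θ => Co.hom₂ θ.τl) h1'⟩, fun Y G => ?_⟩
    have hp : ((λ_ t).inv ≫ q.proj.unop ▷ t) ≫ q.add.unop ▷ t ≫ y =
        q.zero.unop ≫ q.proj.unop ≫ (q.π 2 0).unop := by
      refine adjHom₂_ext ?_
      -- Commutativity without whiskering is recovered from the identity test 1-cell, since
      -- whiskering with an identity is faithful.
      have := (hx A.X (𝟙 _)).w
      rw [← whiskerLeft_comp, ← whiskerLeft_comp, whiskerLeft_iff] at this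
      exact this
    exact isPullback_coWhisker (a := Adj.mk A.X) (b := Adj.mk A.X) hp (fun H => hx _ H) (Co.un G)

end IsTangentad

end TangentData

end Tangentad

namespace Tangentad

open TwoCat BundleData

variable {K : Type u} [Bicategory.{w, v} K]

/-! ## Mates of lax tangent morphisms -/

section

variable {a b c d : K} {g g' : a ⟶ c} {h h' : b ⟶ d} {l₁ l₁' : a ⟶ b} {r₁ r₁' : b ⟶ a}
  {l₂ l₂' : c ⟶ d} {r₂ r₂' : d ⟶ c} (adj₁ : l₁ ⊣ r₁) (adj₁' : l₁' ⊣ r₁') (adj₂ : l₂ ⊣ r₂)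
  (adj₂' : l₂' ⊣ r₂')

/-- Mates respect pasting with conjugate 2-cells. The axioms of a lax tangent morphism all have this
shape, with `θ` and `κ` the corresponding structural 2-cells of the two tangentads. -/
theorem mateEquiv_symm_comm {α : r₁ ≫ g ⟶ h ≫ r₂} {β : r₁' ≫ g ⟶ h ≫ r₂'} {θ : r₁ ⟶ r₁'}
    {κ : r₂ ⟶ r₂'} (e : θ ▷ g ≫ β = α ≫ h ◁ κ) :
    (mateEquiv adj₁' adj₂').symm β ≫ (conjugateEquiv adj₁ adj₁').symm θ ▷ h =
      g ◁ (conjugateEquiv adj₂ adj₂').symm κ ≫ (mateEquiv adj₁ adj₂).symm α := by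
  apply (mateEquiv adj₁ adj₂').injective
  have h₁ := conjugateEquiv_mateEquiv_vcomp adj₁ adj₁' adj₂'
    ((conjugateEquiv adj₁ adj₁').symm θ) ((mateEquiv adj₁' adj₂').symm β)
  have h₂ := mateEquiv_conjugateEquiv_vcomp adj₁ adj₂ adj₂'
    ((mateEquiv adj₁ adj₂).symm α) ((conjugateEquiv adj₂ adj₂').symm κ)
  simp only [Equiv.apply_symm_apply] at h₁ h₂
  exact h₁.trans (e.trans h₂.symm)

/-- Mates are natural in the 1-cells they sit over; this carries tangent 2-morphisms to their
opposites. -/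
theorem mateEquiv_symm_whisker {α : r₁ ≫ g ⟶ h ≫ r₂} {α' : r₁ ≫ g' ⟶ h' ≫ r₂} {φ : g ⟶ g'}
    {ψ : h ⟶ h'} (e : α ≫ ψ ▷ r₂ = r₁ ◁ φ ≫ α') :
    φ ▷ l₂ ≫ (mateEquiv adj₁ adj₂).symm α' = (mateEquiv adj₁ adj₂).symm α ≫ l₁ ◁ ψ := by
  rw [mateEquiv_symm_apply', mateEquiv_symm_apply']
  calc _ = 𝟙 _ ⊗≫ (𝟙 a ◁ φ ≫ adj₁.unit ▷ g') ▷ l₂ ⊗≫ l₁ ◁ α' ▷ l₂ ⊗≫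
        l₁ ◁ h' ◁ adj₂.counit ⊗≫ 𝟙 _ := by bicategory
    _ = 𝟙 _ ⊗≫ adj₁.unit ▷ g ▷ l₂ ⊗≫ l₁ ◁ (r₁ ◁ φ ≫ α') ▷ l₂ ⊗≫
        l₁ ◁ h' ◁ adj₂.counit ⊗≫ 𝟙 _ := by rw [whisker_exchange]; bicategory
    _ = 𝟙 _ ⊗≫ adj₁.unit ▷ g ▷ l₂ ⊗≫ l₁ ◁ α ▷ l₂ ⊗≫
        l₁ ◁ (ψ ▷ (r₂ ≫ l₂) ≫ h' ◁ adj₂.counit) ⊗≫ 𝟙 _ := by rw [← e]; bicategory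
    _ = _ := by rw [← whisker_exchange]; bicategory

end

theorem mateEquiv_id_id_symm {a b : K} (f : a ⟶ b) :
    (mateEquiv (Adjunction.id a) (Adjunction.id b)).symm ((λ_ f).hom ≫ (ρ_ f).inv) =
      (ρ_ f).hom ≫ (λ_ f).inv := by
  rw [mateEquiv_symm_apply']
  dsimp [Bicategory.Adjunction.id]
  bicategory

theorem mateEquiv_symm_sqLaw {X Y : K} {T T' : X ⟶ X} {S S' : Y ⟶ Y} {f : X ⟶ Y}
    (adj₁ : T' ⊣ T) (adj₂ : S' ⊣ S) (α : T ≫ f ⟶ f ≫ S) :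
    (mateEquiv (adj₁.comp adj₁) (adj₂.comp adj₂)).symm (sqLaw α) =
      leftAdjointSquare.hcomp ((mateEquiv adj₁ adj₂).symm α) ((mateEquiv adj₁ adj₂).symm α) := by
  rw [Equiv.symm_apply_eq, Bicategory.mateEquiv_hcomp, Equiv.apply_symm_apply]
  rfl

theorem mateEquiv_symm_vcomp {X Y Z : K} {T T' : X ⟶ X} {S S' : Y ⟶ Y} {R R' : Z ⟶ Z}
    {f : X ⟶ Y} {g : Y ⟶ Z} (adj₁ : T' ⊣ T) (adj₂ : S' ⊣ S) (adj₃ : R' ⊣ R)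
    (α : T ≫ f ⟶ f ≫ S) (β : S ≫ g ⟶ g ≫ R) :
    (mateEquiv adj₁ adj₃).symm
        ((α_ T f g).inv ≫ α ▷ g ≫ (α_ f S g).hom ≫ f ◁ β ≫ (α_ f g R).inv) =
      ((((α_ f g R').hom ≫ f ◁ (mateEquiv adj₂ adj₃).symm β) ≫ (α_ f S' g).inv) ≫
        (mateEquiv adj₁ adj₂).symm α ▷ g) ≫ (α_ T' f g).hom := by
  have h := Bicategory.mateEquiv_vcomp adj₁ adj₂ adj₃ ((mateEquiv adj₁ adj₂).symm α)
    ((mateEquiv adj₂ adj₃).symm β)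
  rw [← Equiv.eq_symm_apply, Equiv.apply_symm_apply, Equiv.apply_symm_apply] at h
  refine h.symm.trans ?_
  simp only [leftAdjointSquare.vcomp, Category.assoc]

namespace LaxData

variable {A B C : TangentData K} (L : A.LeftAdjoints) (L' : B.LeftAdjoints) (L'' : C.LeftAdjoints)

theorem flat_sq (m : LaxData A B) : (m.flat L L').sq =
    Co.hom₂ ((mateEquiv (L.tan.adj.comp L.tan.adj) (L'.tan.adj.comp L'.tan.adj)).symm m.sq) := by
  refine Quiver.Hom.unop_inj (Eq.trans ?_ (mateEquiv_symm_sqLaw L.tan.adj L'.tan.adj m.α).symm)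
  change (((_ ≫ _) ≫ _) ≫ _) ≫ _ = _ ≫ _ ≫ _ ≫ _ ≫ _
  simp only [Category.assoc]
  rfl

theorem IsLax.flat {m : LaxData A B} (hm : m.IsLax) : (m.flat L L').IsLax where
  additive :=
    { proj := by
        have h := mateEquiv_symm_comm L.tan.adj (Adjunction.id _) L'.tan.adj (Adjunction.id _)
          hm.additive.proj.symm
        rw [mateEquiv_id_id_symm] at h
        exact congrArg Quiver.Hom.op h.symm
      zero := by
        have h := mateEquiv_symm_comm (Adjunction.id _) L.tan.adj (Adjunction.id _) L'.tan.adj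
          hm.additive.zero
        rw [mateEquiv_id_id_symm] at h
        exact congrArg Quiver.Hom.op h
      add := by
        obtain ⟨x, ⟨h0, h1⟩, hx⟩ := hm.additive.add
        -- The map between two-fold pullbacks is a square over $T_2\to T'_2$, so its mate along
        -- $T_2^\flat\dashv T_2$ and $T_2'^\flat\dashv T'_2$ is the required witness.
        exact ⟨Co.hom₂ ((mateEquiv (L.pow 2).adj (L'.pow 2).adj).symm x),
          ⟨congrArg Quiver.Hom.op (mateEquiv_symm_comm _ _ _ _ h0.symm).symm,
            congrArg Quiver.Hom.op (mateEquiv_symm_comm _ _ _ _ h1.symm).symm⟩,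
          congrArg Quiver.Hom.op (mateEquiv_symm_comm _ _ _ _ hx)⟩ }
  lift := by
    rw [flat_sq]
    exact congrArg Quiver.Hom.op (mateEquiv_symm_comm _ _ _ _ hm.lift)
  flip := by
    rw [flat_sq]
    exact congrArg Quiver.Hom.op (mateEquiv_symm_comm _ _ _ _ hm.flip)

theorem IsCompatible.flat {m n : LaxData A B} {φ : m.F ⟶ n.F} (h : IsCompatible m n φ) :
    IsCompatible (n.flat L L') (m.flat L L') (Co.hom₂ φ) :=
  congrArg Quiver.Hom.op (mateEquiv_symm_whisker L.tan.adj L'.tan.adj h)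

theorem flat_id : (LaxData.id A).flat L L = LaxData.id (A.flat L) := by
  have h : (mateEquiv L.tan.adj L.tan.adj).symm ((ρ_ A.T).hom ≫ (λ_ A.T).inv) =
      (λ_ L.tan.left).hom ≫ (ρ_ L.tan.left).inv := by
    rw [Equiv.symm_apply_eq, mateEquiv_leftUnitor_hom_rightUnitor_inv]
  exact congrArg (fun α => LaxData.mk (A := A.flat L) (B := A.flat L) (Co.hom (𝟙 A.X))
    (Co.hom₂ α)) h

theorem flat_comp (m : LaxData A B) (n : LaxData B C) :
    (m.comp n).flat L L'' = (m.flat L L').comp (n.flat L' L'') :=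
  congrArg (fun α => LaxData.mk (A := A.flat L) (B := C.flat L'')
    (Co.hom (m.F ≫ n.F)) (Co.hom₂ α)) (mateEquiv_symm_vcomp L.tan.adj L'.tan.adj L''.tan.adj m.α n.α)

end LaxData

end Tangentad

namespace Tangentad

open TwoCat BundleData

variable {K : Type u} [Bicategory.{w, v} K]

/-! ## Opposite tangentads -/

theorem leftZigzag_eq {a b : K} {f : a ⟶ b} {g : b ⟶ a} (η : 𝟙 a ⟶ f ≫ g) (κ : g ≫ f ⟶ 𝟙 b) :
    leftZigzag η κ = (η ▷ f ≫ (α_ f g f).hom) ≫ f ◁ κ := by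
  simp [leftZigzag, bicategoricalComp]

theorem rightZigzag_eq {a b : K} {f : a ⟶ b} {g : b ⟶ a} (η : 𝟙 a ⟶ f ≫ g) (κ : g ≫ f ⟶ 𝟙 b) :
    rightZigzag η κ = g ◁ η ≫ (α_ g f g).inv ≫ κ ▷ g := by
  simp [rightZigzag, bicategoricalComp]

/-- An adjunction in `K`, as an adjunction in `K^co`. -/
def coAdjunction {a b : K} {l : a ⟶ b} {r : b ⟶ a} (adj : l ⊣ r) : Co.hom r ⊣ Co.hom l where
  unit := Co.hom₂ adj.counit
  counit := Co.hom₂ adj.unit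
  left_triangle := (leftZigzag_eq _ _).trans (congrArg Quiver.Hom.op
    ((rightZigzag_eq adj.unit adj.counit).symm.trans adj.right_triangle))
  right_triangle := (rightZigzag_eq _ _).trans (congrArg Quiver.Hom.op
    ((leftZigzag_eq adj.unit adj.counit).symm.trans adj.left_triangle))

section map

variable {K' : Type u'} [Bicategory.{w', v'} K'] (F : StrictPseudofunctor K K')
  {A B C : TangentData K}

/-- The coherence cell of a strict 2-functor is an `eqToHom`, and compatibility along an `eqToHom`
is equality of lax data. -/
theorem LaxData.map_id : (LaxData.id A).map F = LaxData.id (A.map F) :=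
  LaxData.ext_of_isCompatible (F.map_id A.X) (by
    have h := LaxData.isCompatible_map_id (F := F) A
    rw [F.mapId_eq_eqToIso] at h
    exact h)

theorem LaxData.map_comp (m : LaxData A B) (n : LaxData B C) :
    (m.comp n).map F = (m.map F).comp (n.map F) :=
  LaxData.ext_of_isCompatible (F.map_comp m.F n.F) (by
    have h := LaxData.isCompatible_map_comp (F := F) m n
    rw [F.mapComp_eq_eqToIso] at h
    exact h)

end map

variable [Bicategory.Strict K] (O : OppositeObjects K)

section

variable {A B C : TangentData K} (L : A.LeftAdjoints) (L' : B.LeftAdjoints) (L'' : C.LeftAdjoints)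

/-- The left adjoints of an opposite tangentad. -/
def TangentData.oppositeLeftAdjoints : (A.opposite O L).LeftAdjoints where
  -- Reversing 2-cells turns $T^\flat\dashv T$ into $T\dashv T^\flat$, so the opposite of $T$ itself
  -- is a left adjoint.
  tan := ⟨O.opp.map (Co.hom A.T), O.opp.mapAdjunction (coAdjunction L.tan.adj)⟩
  pow n _ := ⟨O.opp.map (Co.hom (A.p.pow n)), O.opp.mapAdjunction (coAdjunction (L.pow n).adj)⟩

theorem TangentData.IsTangentad.opposite (hA : A.IsTangentad) : (A.opposite O L).IsTangentad :=
  (hA.flat L).map (opp_isLocalEquivalence O)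

theorem TangentData.opposite_isAdjunctable : (A.opposite O L).IsAdjunctable :=
  ⟨⟨⟨(oppositeLeftAdjoints O L).tan⟩⟩, fun n _ => ⟨⟨(oppositeLeftAdjoints O L).pow n⟩⟩⟩

theorem LaxData.opposite_id : (LaxData.id A).opposite O L L = LaxData.id (A.opposite O L) :=
  (congrArg (LaxData.map O.opp) (LaxData.flat_id L)).trans (LaxData.map_id O.opp)

theorem LaxData.opposite_comp (m : LaxData A B) (n : LaxData B C) :
    (m.comp n).opposite O L L'' = (m.opposite O L L').comp (n.opposite O L' L'') :=
  (congrArg (LaxData.map O.opp) (LaxData.flat_comp L L' L'' m n)).trans (LaxData.map_comp O.opp _ _)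

theorem LaxData.IsLax.opposite {m : LaxData A B} (hm : m.IsLax) : (m.opposite O L L').IsLax :=
  (hm.flat L L').map

theorem LaxData.IsCompatible.opposite {m n : LaxData A B} {φ : m.F ⟶ n.F}
    (h : IsCompatible m n φ) :
    IsCompatible (n.opposite O L L') (m.opposite O L L') (O.opp.map₂ (Co.hom₂ φ)) :=
  (h.flat L L').map

end

/-! ### The opposite 2-functor on adjunctable tangentads -/

theorem AdjTng.hom_ext' {A B : AdjTng K} {m n : A ⟶ B} (h : m.hom.toLaxData = n.hom.toLaxData) :
    m = n :=
  InducedBicategory.hom_ext (Tng.Hom.ext' h)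

theorem AdjTng.hom₂_ext' {A B : AdjTng K} {m n : A ⟶ B} {η θ : m ⟶ n} (h : η.hom.φ = θ.hom.φ) :
    η = θ :=
  InducedBicategory.hom₂_ext (Tng.Hom₂.ext h)

theorem AdjTng.eqToHom_hom_φ {A B : AdjTng K} {m n : A ⟶ B} (h : m = n)
    (h' : m.hom.F = n.hom.F) : (eqToHom h).hom.φ = eqToHom h' := by
  subst h; rfl

variable (L : ∀ A : AdjTng K, A.tng.LeftAdjoints)

/-- The opposite 2-functor on adjunctable tangentads, as a prelax functor. -/
abbrev oppositePrelaxFunctor : PrelaxFunctor (Co (AdjTng K)) (AdjTng K) where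
  toPrelaxFunctorStruct := oppositeAssignment O L
    (fun A => ⟨A.tng.isTangentad.opposite O (L A), TangentData.opposite_isAdjunctable O (L A)⟩)
    (fun A B m => m.hom.isLax.opposite O (L A) (L B))
    (fun A B _ _ η => η.hom.isCompatible.opposite O (L A) (L B))
  map₂_id := fun _ => AdjTng.hom₂_ext' (O.opp.map₂_id _)
  map₂_comp := fun η θ => AdjTng.hom₂_ext' (O.opp.map₂_comp
    (Co.hom₂ (Co.un₂ η).hom.φ) (Co.hom₂ (Co.un₂ θ).hom.φ))

theorem oppositePrelaxFunctor_map_comp {A B C : Co (AdjTng K)} (m : A ⟶ B) (n : B ⟶ C) :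
    (oppositePrelaxFunctor O L).map (m ≫ n) =
      (oppositePrelaxFunctor O L).map m ≫ (oppositePrelaxFunctor O L).map n :=
  AdjTng.hom_ext' (LaxData.opposite_comp O (L A.as) (L B.as) (L C.as)
    (Co.un m).hom.toLaxData (Co.un n).hom.toLaxData)

/-- The opposite 2-functor on adjunctable tangentads. -/
def oppositeFunctor : StrictPseudofunctor (Co (AdjTng K)) (AdjTng K) :=
  StrictPseudofunctor.mk''
    { toPrelaxFunctor := oppositePrelaxFunctor O L
      map_id := fun A => AdjTng.hom_ext' (LaxData.opposite_id O (L A.as))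
      map_comp := oppositePrelaxFunctor_map_comp O L
      map₂_whisker_left := fun {A B C} m n n' η => AdjTng.hom₂_ext' (by
        have h := O.opp.map₂_whisker_left (Co.hom (Co.un m).hom.F) (Co.hom₂ (Co.un₂ η).hom.φ)
        rw [O.opp.mapComp_eq_eqToIso, O.opp.mapComp_eq_eqToIso, eqToIso.hom, eqToIso.inv] at h
        refine h.trans (congrArg₂ (fun x y => x ≫ _ ≫ y)
          (AdjTng.eqToHom_hom_φ (oppositePrelaxFunctor_map_comp O L m n) _).symm
          (AdjTng.eqToHom_hom_φ (oppositePrelaxFunctor_map_comp O L m n').symm _).symm))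
      map₂_whisker_right := fun {A B C} m m' η n => AdjTng.hom₂_ext' (by
        have h := O.opp.map₂_whisker_right (Co.hom₂ (Co.un₂ η).hom.φ) (Co.hom (Co.un n).hom.F)
        rw [O.opp.mapComp_eq_eqToIso, O.opp.mapComp_eq_eqToIso, eqToIso.hom, eqToIso.inv] at h
        refine h.trans (congrArg₂ (fun x y => x ≫ _ ≫ y)
          (AdjTng.eqToHom_hom_φ (oppositePrelaxFunctor_map_comp O L m n) _).symm
          (AdjTng.eqToHom_hom_φ (oppositePrelaxFunctor_map_comp O L m' n).symm _).symm)) }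

end Tangentad

namespace Tangentad

open TwoCat BundleData

variable {K : Type u} [Bicategory.{w, v} K]

/-! ## Heterogeneous equality of 2-cells in strict 2-categories -/

section

variable {a b c d : K}

theorem whiskerLeft_heq {f f' : a ⟶ b} {g g' h h' : b ⟶ c} {η : g ⟶ h} {η' : g' ⟶ h'}
    (hf : f = f') (hg : g = g') (hh : h = h') (hη : η ≍ η') : f ◁ η ≍ f' ◁ η' := by
  subst hf hg hh hη; rfl

theorem whiskerRight_heq {f f' : b ⟶ c} {g g' h h' : a ⟶ b} {η : g ⟶ h} {η' : g' ⟶ h'}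
    (hf : f = f') (hg : g = g') (hh : h = h') (hη : η ≍ η') : η ▷ f ≍ η' ▷ f' := by
  subst hf hg hh hη; rfl

/-- Strict naturality is stated with `eqToHom` corrections. Trading them for heterogeneous equality
lets identifications such as the double opposite of a composite be chained without tracking
coherence. -/
theorem comp_eqToHom_eq_iff_heq {C : Type*} [Category* C] {x x' y y' : C} {f : x ⟶ y}
    {g : x' ⟶ y'} (hx : x = x') (hy : y = y') :
    f ≫ eqToHom hy = eqToHom hx ≫ g ↔ f ≍ g := by
  subst hx hy; simp

variable [Bicategory.Strict K]

theorem id_whiskerLeft_heq {f g : a ⟶ b} (η : f ⟶ g) : 𝟙 a ◁ η ≍ η := by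
  rw [id_whiskerLeft, Bicategory.Strict.leftUnitor_eqToIso, Bicategory.Strict.leftUnitor_eqToIso]
  simp

theorem whiskerRight_id_heq {f g : a ⟶ b} (η : f ⟶ g) : η ▷ 𝟙 b ≍ η := by
  rw [whiskerRight_id, Bicategory.Strict.rightUnitor_eqToIso,
    Bicategory.Strict.rightUnitor_eqToIso]
  simp

theorem comp_whiskerLeft_heq (f : a ⟶ b) (g : b ⟶ c) {h k : c ⟶ d} (η : h ⟶ k) :
    (f ≫ g) ◁ η ≍ f ◁ g ◁ η := by
  rw [comp_whiskerLeft, Bicategory.Strict.associator_eqToIso,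
    Bicategory.Strict.associator_eqToIso]
  simp

theorem whiskerRight_comp_heq {h k : a ⟶ b} (η : h ⟶ k) (f : b ⟶ c) (g : c ⟶ d) :
    η ▷ (f ≫ g) ≍ (η ▷ f) ▷ g := by
  rw [whiskerRight_comp, Bicategory.Strict.associator_eqToIso,
    Bicategory.Strict.associator_eqToIso]
  simp

theorem whisker_assoc_heq (f : a ⟶ b) {g h : b ⟶ c} (η : g ⟶ h) (k : c ⟶ d) :
    (f ◁ η) ▷ k ≍ f ◁ η ▷ k := by
  rw [whisker_assoc, Bicategory.Strict.associator_eqToIso,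
    Bicategory.Strict.associator_eqToIso]
  simp

end

/-! ## Images of adjunctions -/

/-- The counit is the transpose of an identity, up to a unitor, and transposition is defined from
the unit alone. -/
theorem adjunction_ext {a b : K} {l : a ⟶ b} {r : b ⟶ a} {adj adj' : l ⊣ r}
    (h : adj.unit = adj'.unit) : adj = adj' := by
  have key (adj : l ⊣ r) : adj.counit = adj.homEquiv₂.symm (λ_ r).inv := by
    rw [Adjunction.homEquiv₂_symm_apply]
    simp
  have h₂ : adj.homEquiv₂ (g := r) (h := 𝟙 b) = adj'.homEquiv₂ := by
    ext α
    rw [Adjunction.homEquiv₂_apply, Adjunction.homEquiv₂_apply, h]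
  have h₃ : adj.counit = adj'.counit := by rw [key, key, h₂]
  cases adj; cases adj'; cases h; cases h₃; rfl

theorem adjunction_heq {a b : K} {l l' : a ⟶ b} {r r' : b ⟶ a} {adj : l ⊣ r} {adj' : l' ⊣ r'}
    (hl : l = l') (hr : r = r') (h : adj.unit ≍ adj'.unit) : adj ≍ adj' := by
  subst hl hr
  exact heq_of_eq (adjunction_ext (eq_of_heq h))

theorem conjugateEquiv_symm_eq_of_unit {a b : K} {l₁ l₂ : a ⟶ b} {r₁ r₂ : b ⟶ a} (adj₁ : l₁ ⊣ r₁)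
    (adj₂ : l₂ ⊣ r₂) {θ : l₂ ⟶ l₁} {τ : r₁ ⟶ r₂}
    (h : adj₂.unit ≫ θ ▷ r₂ = adj₁.unit ≫ l₁ ◁ τ) : (conjugateEquiv adj₁ adj₂).symm τ = θ := by
  have h' := unit_conjugateEquiv adj₁ adj₂ ((conjugateEquiv adj₁ adj₂).symm τ)
  rw [Equiv.apply_symm_apply, ← h] at h'
  have key (x : l₂ ⟶ l₁) : adj₂.homEquiv₂ ((λ_ l₂).hom ≫ x) = adj₂.unit ≫ x ▷ r₂ := by
    rw [Adjunction.homEquiv₂_apply]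
    simp
  rw [← key, ← key, EmbeddingLike.apply_eq_iff_eq, cancel_epi] at h'
  exact h'

section

variable {a b c d : K} {l₁ : a ⟶ b} {r₁ : b ⟶ a} {l₂ : c ⟶ d} {r₂ : d ⟶ c} (adj₁ : l₁ ⊣ r₁)
  (adj₂ : l₂ ⊣ r₂)

/-- Reversing 2-cells exchanges units with counits, so the formula for one direction of conjugation
becomes the formula for the other. -/
theorem conjugateEquiv_coAdjunction_symm {l l' : a ⟶ b} {r r' : b ⟶ a} (adj : l ⊣ r)
    (adj' : l' ⊣ r') (θ : l' ⟶ l) :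
    (conjugateEquiv (coAdjunction adj) (coAdjunction adj')).symm (Co.hom₂ θ) =
      Co.hom₂ (conjugateEquiv adj adj' θ) := by
  refine (conjugateEquiv_symm_apply' _ _ _).trans ?_
  rw [conjugateEquiv_apply']
  refine congrArg Quiver.Hom.op ?_
  change ((((_ ≫ _) ≫ _) ≫ _) ≫ _) ≫ _ = _
  simp only [Category.assoc]
  rfl

/-- Bracketed to be the term-by-term reverse of `mateEquiv_symm_eq_comp`, so that the two agree in
$\mathbf K^{\mathsf{co}}$ after reassociation. -/
theorem mateEquiv_eq_comp {g : a ⟶ c} {h : b ⟶ d} (α : g ≫ l₂ ⟶ l₁ ≫ h) :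
    mateEquiv adj₁ adj₂ α = r₁ ◁ (ρ_ g).inv ≫ r₁ ◁ g ◁ adj₂.unit ≫ r₁ ◁ (α_ g l₂ r₂).inv ≫
      r₁ ◁ α ▷ r₂ ≫ r₁ ◁ (α_ l₁ h r₂).hom ≫ (α_ r₁ l₁ (h ≫ r₂)).inv ≫
        adj₁.counit ▷ (h ≫ r₂) ≫ (λ_ (h ≫ r₂)).hom := by
  rw [mateEquiv_apply']
  bicategory

theorem mateEquiv_symm_eq_comp {g : a ⟶ c} {h : b ⟶ d} (β : r₁ ≫ g ⟶ h ≫ r₂) :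
    (mateEquiv adj₁ adj₂).symm β = (λ_ (g ≫ l₂)).inv ≫ adj₁.unit ▷ (g ≫ l₂) ≫
      (α_ l₁ r₁ (g ≫ l₂)).hom ≫ l₁ ◁ (α_ r₁ g l₂).inv ≫ l₁ ◁ β ▷ l₂ ≫ l₁ ◁ (α_ h r₂ l₂).hom ≫
        l₁ ◁ h ◁ adj₂.counit ≫ l₁ ◁ (ρ_ h).hom := by
  rw [mateEquiv_symm_apply']
  bicategory

theorem mateEquiv_coAdjunction_symm {g : a ⟶ c} {h : b ⟶ d} (α : g ≫ l₂ ⟶ l₁ ≫ h) :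
    (mateEquiv (coAdjunction adj₁) (coAdjunction adj₂)).symm (Co.hom₂ α) =
      Co.hom₂ (mateEquiv adj₁ adj₂ α) := by
  refine (mateEquiv_symm_eq_comp _ _ _).trans ?_
  rw [mateEquiv_eq_comp]
  refine congrArg Quiver.Hom.op ?_
  change ((((((_ ≫ _) ≫ _) ≫ _) ≫ _) ≫ _) ≫ _) ≫ _ = _
  simp only [Category.assoc]
  rfl

variable {K' : Type u'} [Bicategory.{w', v'} K'] (F : StrictPseudofunctor K K')

theorem conjugateEquiv_mapAdjunction_symm {l l' : a ⟶ b} {r r' : b ⟶ a} (adj : l ⊣ r)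
    (adj' : l' ⊣ r') (τ : r ⟶ r') :
    (conjugateEquiv (F.mapAdjunction adj) (F.mapAdjunction adj')).symm (F.map₂ τ) =
      F.map₂ ((conjugateEquiv adj adj').symm τ) := by
  apply conjugateEquiv_symm_eq_of_unit
  have h := unit_conjugateEquiv adj adj' ((conjugateEquiv adj adj').symm τ)
  rw [Equiv.apply_symm_apply] at h
  have h' := congrArg (fun η => (F.mapId a).inv ≫ F.map₂ η ≫ (F.mapComp l r').hom) h
  simpa using h'

theorem mateEquiv_mapAdjunction_symm {g : a ⟶ c} {h : b ⟶ d} (β : r₁ ≫ g ⟶ h ≫ r₂) :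
    (mateEquiv (F.mapAdjunction adj₁) (F.mapAdjunction adj₂)).symm
      ((F.mapComp r₁ g).inv ≫ F.map₂ β ≫ (F.mapComp h r₂).hom) =
    (F.mapComp g l₂).inv ≫ F.map₂ ((mateEquiv adj₁ adj₂).symm β) ≫ (F.mapComp l₁ h).hom := by
  rw [mateEquiv_symm_eq_comp, mateEquiv_symm_eq_comp]
  -- The image adjunctions carry `mapId` in their units and counits; interchange moves these cells
  -- past `mapComp`.
  have e₁ : (F.mapComp g l₂).inv ≫ (λ_ (F.map (g ≫ l₂))).inv ≫
      (F.mapId a).inv ▷ F.map (g ≫ l₂) ≫ F.map (𝟙 a) ◁ (F.mapComp g l₂).hom =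
        (λ_ (F.map g ≫ F.map l₂)).inv ≫ (F.mapId a).inv ▷ (F.map g ≫ F.map l₂) := by
    rw [← whisker_exchange, leftUnitor_inv_naturality_assoc]
    simp
  have e₂ : (F.mapComp l₁ h).inv ▷ F.map (𝟙 d) ≫ F.map (l₁ ≫ h) ◁ (F.mapId d).hom ≫
      (ρ_ (F.map (l₁ ≫ h))).hom ≫ (F.mapComp l₁ h).hom =
        (F.map l₁ ≫ F.map h) ◁ (F.mapId d).hom ≫ (ρ_ (F.map l₁ ≫ F.map h)).hom := by
    rw [← whisker_exchange_assoc, rightUnitor_naturality_assoc]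
    simp
  simp [map₂_associator_inv, map₂_leftUnitor_inv, e₂, reassoc_of% e₁]

end

end Tangentad

namespace Tangentad

open TwoCat BundleData

variable {K : Type u} [Bicategory.{w, v} K]

/-! ## Double opposites of adjunctions and of tangentads -/

theorem eqToHom_heq_eqToHom {C : Type*} [Category* C] {x y x' y' : C} (h : x = y) (h' : x' = y')
    (hx : x = x') : eqToHom h ≍ eqToHom h' := by
  subst hx h h'; rfl

theorem map₂_heq {K' : Type u'} [Bicategory.{w', v'} K'] (F : StrictPseudofunctor K K') {a b : K}
    {f f' g g' : a ⟶ b} {η : f ⟶ g} {η' : f' ⟶ g'} (hf : f = f') (hg : g = g') (h : η ≍ η') :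
    F.map₂ η ≍ F.map₂ η' := by
  subst hf hg h; rfl

theorem coHom₂_heq {a b : K} {f f' g g' : a ⟶ b} {η : f ⟶ g} {η' : f' ⟶ g'} (hf : f = f')
    (hg : g = g') (h : η ≍ η') : Co.hom₂ η ≍ Co.hom₂ η' := by
  subst hf hg h; rfl

section

variable {a b c : K} {l : a ⟶ b} {r : b ⟶ a} {l' : b ⟶ c} {r' : c ⟶ b} (adj : l ⊣ r)
  (adj' : l' ⊣ r')

theorem comp_unit_eq : (adj.comp adj').unit = adj.unit ≫ l ◁ (λ_ r).inv ≫ l ◁ adj'.unit ▷ r ≫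
    l ◁ (α_ l' r' r).hom ≫ (α_ l l' (r' ≫ r)).inv := by
  dsimp [Bicategory.Adjunction.comp]
  bicategory

theorem comp_counit_eq : (adj.comp adj').counit = (((((α_ r' r (l ≫ l')).hom ≫
    r' ◁ (α_ r l l').inv) ≫ r' ◁ adj.counit ▷ l') ≫ r' ◁ (λ_ l').hom)) ≫ adj'.counit := by
  dsimp [Bicategory.Adjunction.comp]
  bicategory

/-- Only units need comparing, and the unit of the dual of a composite is the composite's counit. -/
theorem coAdjunction_comp :
    coAdjunction (adj.comp adj') = (coAdjunction adj').comp (coAdjunction adj) :=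
  adjunction_ext ((congrArg Quiver.Hom.op (comp_counit_eq adj adj')).trans
    (comp_unit_eq (coAdjunction adj') (coAdjunction adj)).symm)

theorem coAdjunction_id (a : K) :
    coAdjunction (Bicategory.Adjunction.id a) = Bicategory.Adjunction.id (Co.of a) :=
  adjunction_ext rfl

variable {K' : Type u'} [Bicategory.{w', v'} K'] (F : StrictPseudofunctor K K')

theorem mapAdjunction_comp_unit : (F.mapAdjunction (adj.comp adj')).unit ≫
    (F.mapComp l l').hom ▷ F.map (r' ≫ r) ≫ (F.map l ≫ F.map l') ◁ (F.mapComp r' r).hom =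
      ((F.mapAdjunction adj).comp (F.mapAdjunction adj')).unit := by
  rw [comp_unit_eq, StrictPseudofunctor.mapAdjunction_unit, comp_unit_eq]
  simp [map₂_associator_inv, map₂_leftUnitor_inv]

theorem mapAdjunction_comp_heq : F.mapAdjunction (adj.comp adj') ≍
    (F.mapAdjunction adj).comp (F.mapAdjunction adj') := by
  refine adjunction_heq (F.map_comp _ _) (F.map_comp _ _) ?_
  rw [← mapAdjunction_comp_unit, F.mapComp_eq_eqToIso l l', F.mapComp_eq_eqToIso r' r]
  simp only [eqToIso.hom, eqToHom_whiskerRight, whiskerLeft_eqToHom, eqToHom_trans]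
  exact (comp_eqToHom_heq _ _).symm

theorem mapAdjunction_id_heq [Bicategory.Strict K] [Bicategory.Strict K'] (a : K) :
    F.mapAdjunction (Bicategory.Adjunction.id a) ≍ Bicategory.Adjunction.id (F.obj a) := by
  refine adjunction_heq (F.map_id a) (F.map_id a) ?_
  rw [StrictPseudofunctor.mapAdjunction_unit]
  dsimp only [Bicategory.Adjunction.id]
  rw [Bicategory.Strict.rightUnitor_eqToIso, Bicategory.Strict.rightUnitor_eqToIso,
    F.mapId_eq_eqToIso, F.mapComp_eq_eqToIso]
  simp only [eqToIso.inv, eqToIso.hom, PrelaxFunctor.map₂_eqToHom, eqToHom_trans]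
  exact eqToHom_heq_eqToHom _ _ rfl

end

variable [Bicategory.Strict K] (O : OppositeObjects K)

/-- The opposite of an adjunction. -/
abbrev oppositeAdjunction {a b : K} {l : a ⟶ b} {r : b ⟶ a} (adj : l ⊣ r) :
    O.opp.map (Co.hom r) ⊣ O.opp.map (Co.hom l) :=
  O.opp.mapAdjunction (coAdjunction adj)

/-- The double opposite of a 2-cell. -/
abbrev doubleOpposite {a b : K} {f g : a ⟶ b} (η : f ⟶ g) :
    O.opp.map (Co.hom (O.opp.map (Co.hom f))) ⟶ O.opp.map (Co.hom (O.opp.map (Co.hom g))) :=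
  O.opp.map₂ (Co.hom₂ (O.opp.map₂ (Co.hom₂ η)))

theorem oppositeAdjunction_id_heq (a : K) :
    oppositeAdjunction O (Bicategory.Adjunction.id a) ≍
      Bicategory.Adjunction.id (O.opp.obj (Co.of a)) := by
  have h := mapAdjunction_id_heq O.opp (Co.of a)
  rw [← coAdjunction_id] at h
  exact h

theorem oppositeAdjunction_comp_heq {a b c : K} {l : a ⟶ b} {r : b ⟶ a} {l' : b ⟶ c}
    {r' : c ⟶ b} (adj : l ⊣ r) (adj' : l' ⊣ r') : oppositeAdjunction O (adj.comp adj') ≍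
      (oppositeAdjunction O adj').comp (oppositeAdjunction O adj) := by
  have h := mapAdjunction_comp_heq (coAdjunction adj') (coAdjunction adj) O.opp
  rw [← coAdjunction_comp] at h
  exact h

/-- Taking mates twice is the identity: the second passage runs along the reversed adjunctions and
inverts the first. -/
theorem conjugateEquiv_oppositeAdjunction_symm {a b : K} {l l' : a ⟶ b} {r r' : b ⟶ a}
    (adj : l ⊣ r) (adj' : l' ⊣ r') (τ : r ⟶ r') :
    (conjugateEquiv (oppositeAdjunction O adj) (oppositeAdjunction O adj')).symm
      (O.opp.map₂ (Co.hom₂ ((conjugateEquiv adj adj').symm τ))) = O.opp.map₂ (Co.hom₂ τ) := by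
  rw [conjugateEquiv_mapAdjunction_symm, conjugateEquiv_coAdjunction_symm,
    Equiv.apply_symm_apply]

theorem mateEquiv_oppositeAdjunction_symm {X Y : K} {T T' : X ⟶ X} {S S' : Y ⟶ Y} {f : X ⟶ Y}
    (adj : T' ⊣ T) (adj' : S' ⊣ S) (α : T ≫ f ⟶ f ≫ S) :
    (mateEquiv (oppositeAdjunction O adj) (oppositeAdjunction O adj')).symm
      (mapLaw O.opp (Co.hom₂ ((mateEquiv adj adj').symm α) :
        Co.hom T' ≫ Co.hom f ⟶ Co.hom f ≫ Co.hom S')) =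
      (O.opp.mapComp (Co.hom f) (Co.hom S)).inv ≫ O.opp.map₂ (Co.hom₂ α) ≫
        (O.opp.mapComp (Co.hom T) (Co.hom f)).hom := by
  refine (mateEquiv_mapAdjunction_symm (coAdjunction adj) (coAdjunction adj') O.opp _).trans ?_
  rw [mateEquiv_coAdjunction_symm, Equiv.apply_symm_apply]

/-- The adjunctions `bdj` and `bdj'` are kept general because the second dualisation uses identity
and composite adjunctions on $X^{\mathsf{op}}$, which match the opposites of those on $X$ only after
transport along equalities of 1-cells. -/
theorem doubleOpposite_heq {a b : K} {l l' : a ⟶ b} {r r' : b ⟶ a} (adj : l ⊣ r)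
    (adj' : l' ⊣ r') (τ : r ⟶ r') {m m' : O.opp.obj (Co.of b) ⟶ O.opp.obj (Co.of a)}
    {s s' : O.opp.obj (Co.of a) ⟶ O.opp.obj (Co.of b)} {bdj : m ⊣ s} {bdj' : m' ⊣ s'}
    (hm : m = O.opp.map (Co.hom r)) (hs : s = O.opp.map (Co.hom l))
    (hm' : m' = O.opp.map (Co.hom r')) (hs' : s' = O.opp.map (Co.hom l'))
    (h : bdj ≍ oppositeAdjunction O adj) (h' : bdj' ≍ oppositeAdjunction O adj') {σ : s ⟶ s'}
    (hσ : σ ≍ O.opp.map₂ (Co.hom₂ ((conjugateEquiv adj adj').symm τ))) :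
    O.opp.map₂ (Co.hom₂ ((conjugateEquiv bdj bdj').symm σ)) ≍ doubleOpposite O τ := by
  subst hm hs hm' hs' h h' hσ
  rw [conjugateEquiv_oppositeAdjunction_symm]

end Tangentad

namespace Tangentad

open TwoCat BundleData

/-! ### Coherence cells of 2-functors up to heterogeneous equality -/

section

variable {K : Type u} [Bicategory.{w, v} K] {K' : Type u'} [Bicategory.{w', v'} K']
  (F : StrictPseudofunctor K K') {a b c : K}

theorem comp_mapId_hom_heq {x : F.obj a ⟶ F.obj a} (η : x ⟶ F.map (𝟙 a)) :
    η ≫ (F.mapId a).hom ≍ η := by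
  rw [F.mapId_eq_eqToIso]
  exact comp_eqToHom_heq _ (F.map_id a)

theorem mapId_inv_comp_heq {x : F.obj a ⟶ F.obj a} (η : F.map (𝟙 a) ⟶ x) :
    (F.mapId a).inv ≫ η ≍ η := by
  rw [F.mapId_eq_eqToIso]
  exact eqToHom_comp_heq _ (F.map_id a).symm

theorem comp_mapComp_hom_heq {f : a ⟶ b} {g : b ⟶ c} {x : F.obj a ⟶ F.obj c}
    (η : x ⟶ F.map (f ≫ g)) : η ≫ (F.mapComp f g).hom ≍ η := by
  rw [F.mapComp_eq_eqToIso]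
  exact comp_eqToHom_heq _ (F.map_comp f g)

theorem mapComp_inv_comp_heq {f : a ⟶ b} {g : b ⟶ c} {x : F.obj a ⟶ F.obj c}
    (η : F.map (f ≫ g) ⟶ x) : (F.mapComp f g).inv ≫ η ≍ η := by
  rw [F.mapComp_eq_eqToIso]
  exact eqToHom_comp_heq _ (F.map_comp f g).symm

end

variable {K : Type u} [Bicategory.{w, v} K]

theorem LaxData.ext_heq {A B : TangentData K} {m n : LaxData A B} (h : m.F = n.F)
    (h' : m.α ≍ n.α) : m = n := by
  obtain ⟨F, α⟩ := m
  obtain ⟨G, β⟩ := n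
  obtain rfl : F = G := h
  obtain rfl : α = β := eq_of_heq h'
  rfl

variable [Bicategory.Strict K]

/-! ## Lax tangent morphisms whose distributive law is an identity -/

namespace LaxData

variable {A B C : TangentData K}

/-- The lax tangent morphism given by a 1-cell that commutes with the tangent bundle 1-cells. -/
abbrev strict (F : A.X ⟶ B.X) (h : A.T ≫ F = F ≫ B.T) : LaxData A B := ⟨F, eqToHom h⟩

theorem strict_sq (F : A.X ⟶ B.X) (h : A.T ≫ F = F ≫ B.T)
    (h' : (A.T ≫ A.T) ≫ F = F ≫ B.T ≫ B.T) :
    (strict F h : LaxData A B).sq = eqToHom h' := by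
  simp only [sq, Bicategory.Strict.associator_eqToIso, eqToIso.hom, eqToIso.inv,
    eqToHom_whiskerRight, whiskerLeft_eqToHom, eqToHom_trans]

/-- With an identity distributive law the axioms say only that `F` commutes with the structural
2-cells, up to identification of their boundaries. -/
theorem isLax_strict (F : A.X ⟶ B.X) (h : A.T ≫ F = F ≫ B.T)
    (h₂ : A.p.pow 2 ≫ F = F ≫ B.p.pow 2) (hproj : A.p.proj ▷ F ≍ F ◁ B.p.proj)
    (hπ : ∀ i, A.p.π 2 i ▷ F ≍ F ◁ B.p.π 2 i) (hzero : A.p.zero ▷ F ≍ F ◁ B.p.zero)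
    (hadd : A.p.add ▷ F ≍ F ◁ B.p.add) (hl : A.l ▷ F ≍ F ◁ B.l) (hc : A.c ▷ F ≍ F ◁ B.c) :
    (strict F h : LaxData A B).IsLax := by
  have hTT : (A.T ≫ A.T) ≫ F = F ≫ B.T ≫ B.T := by
    rw [Bicategory.Strict.assoc, h, ← Bicategory.Strict.assoc, h, Bicategory.Strict.assoc]
  have h1 : 𝟙 A.X ≫ F = F ≫ 𝟙 B.X := by
    rw [Bicategory.Strict.id_comp, Bicategory.Strict.comp_id]
  have e1 : (λ_ F).hom ≫ (ρ_ F).inv = eqToHom h1 := by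
    simp only [Bicategory.Strict.leftUnitor_eqToIso, Bicategory.Strict.rightUnitor_eqToIso,
      eqToIso.hom, eqToIso.inv, eqToHom_trans]
  refine ⟨⟨?_, ?_, ⟨eqToHom h₂, ⟨?_, ?_⟩, ?_⟩⟩, ?_, ?_⟩
  · rw [e1]
    exact ((comp_eqToHom_eq_iff_heq h _).2 hproj).symm
  · rw [e1]
    exact (comp_eqToHom_eq_iff_heq _ h).2 hzero
  · exact ((comp_eqToHom_eq_iff_heq h₂ h).2 (hπ 0)).symm
  · exact ((comp_eqToHom_eq_iff_heq h₂ h).2 (hπ 1)).symm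
  · exact (comp_eqToHom_eq_iff_heq h₂ h).2 hadd
  · rw [strict_sq F h hTT]
    exact (comp_eqToHom_eq_iff_heq h hTT).2 hl
  · rw [strict_sq F h hTT]
    exact (comp_eqToHom_eq_iff_heq hTT hTT).2 hc

theorem comp_strict_α_heq (m : LaxData A B) (F : B.X ⟶ C.X) (h : B.T ≫ F = F ≫ C.T) :
    (m.comp (strict F h)).α ≍ m.α ▷ F := by
  simp only [comp, Bicategory.Strict.associator_eqToIso, eqToIso.hom, eqToIso.inv,
    whiskerLeft_eqToHom, eqToHom_trans]
  exact (eqToHom_comp_heq _ _).trans (comp_eqToHom_heq _ _)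

theorem strict_comp_α_heq (F : A.X ⟶ B.X) (h : A.T ≫ F = F ≫ B.T) (m : LaxData B C) :
    ((strict F h).comp m).α ≍ F ◁ m.α := by
  simp only [comp, Bicategory.Strict.associator_eqToIso, eqToIso.hom, eqToIso.inv,
    eqToHom_whiskerRight, eqToHom_trans_assoc]
  exact (eqToHom_comp_heq _ _).trans (comp_eqToHom_heq _ _)

theorem strict_comp_strict (F : A.X ⟶ B.X) (h : A.T ≫ F = F ≫ B.T) (G : B.X ⟶ A.X)
    (h' : B.T ≫ G = G ≫ A.T) (e : F ≫ G = 𝟙 A.X) :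
    (strict F h).comp (strict G h') = LaxData.id A := by
  refine LaxData.ext_heq e ?_
  simp only [comp, LaxData.id, Bicategory.Strict.associator_eqToIso, eqToIso.hom, eqToIso.inv,
    eqToHom_whiskerRight, whiskerLeft_eqToHom, eqToHom_trans,
    Bicategory.Strict.leftUnitor_eqToIso, Bicategory.Strict.rightUnitor_eqToIso]
  exact eqToHom_heq_eqToHom _ _ (congrArg _ e)

end LaxData

variable (O : OppositeObjects K)

/-! ## Double opposites of tangentads -/

section

variable {A B : TangentData K} (L : A.LeftAdjoints) (L' : B.LeftAdjoints)

/-- The opposite of the opposite tangentad, for the induced left adjoints. -/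
abbrev TangentData.doubleOpposite : TangentData K :=
  (A.opposite O L).opposite O (oppositeLeftAdjoints O L)

theorem doubleOpposite_proj_heq :
    (TangentData.doubleOpposite O L).p.proj ≍ Tangentad.doubleOpposite O A.p.proj :=
  (comp_mapId_hom_heq O.opp _).trans (doubleOpposite_heq O L.tan.adj (Bicategory.Adjunction.id A.X)
    A.p.proj rfl rfl (O.opp.map_id _).symm (O.opp.map_id _).symm HEq.rfl
    (oppositeAdjunction_id_heq O A.X).symm (comp_mapId_hom_heq O.opp _))

theorem doubleOpposite_zero_heq :
    (TangentData.doubleOpposite O L).p.zero ≍ Tangentad.doubleOpposite O A.p.zero :=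
  (mapId_inv_comp_heq O.opp _).trans (doubleOpposite_heq O (Bicategory.Adjunction.id A.X) L.tan.adj
    A.p.zero (O.opp.map_id _).symm (O.opp.map_id _).symm rfl rfl
    (oppositeAdjunction_id_heq O A.X).symm HEq.rfl (mapId_inv_comp_heq O.opp _))

theorem doubleOpposite_π_heq (n : ℕ) [n.AtLeastTwo] (i : Fin n) :
    (TangentData.doubleOpposite O L).p.π n i ≍ Tangentad.doubleOpposite O (A.p.π n i) :=
  doubleOpposite_heq O (L.pow n).adj L.tan.adj (A.p.π n i) rfl rfl rfl rfl HEq.rfl HEq.rfl HEq.rfl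

theorem doubleOpposite_add_heq :
    (TangentData.doubleOpposite O L).p.add ≍ Tangentad.doubleOpposite O A.p.add :=
  doubleOpposite_heq O (L.pow 2).adj L.tan.adj A.p.add rfl rfl rfl rfl HEq.rfl HEq.rfl HEq.rfl

theorem doubleOpposite_l_heq :
    (TangentData.doubleOpposite O L).l ≍ Tangentad.doubleOpposite O A.l :=
  (comp_mapComp_hom_heq O.opp _).trans (doubleOpposite_heq O L.tan.adj (L.tan.adj.comp L.tan.adj)
    A.l rfl rfl (O.opp.map_comp _ _).symm (O.opp.map_comp _ _).symm HEq.rfl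
    (oppositeAdjunction_comp_heq O L.tan.adj L.tan.adj).symm (comp_mapComp_hom_heq O.opp _))

theorem doubleOpposite_c_heq :
    (TangentData.doubleOpposite O L).c ≍ Tangentad.doubleOpposite O A.c :=
  (mapComp_inv_comp_heq O.opp _).trans ((comp_mapComp_hom_heq O.opp _).trans
    (doubleOpposite_heq O (L.tan.adj.comp L.tan.adj) (L.tan.adj.comp L.tan.adj)
      A.c (O.opp.map_comp _ _).symm (O.opp.map_comp _ _).symm (O.opp.map_comp _ _).symm
      (O.opp.map_comp _ _).symm (oppositeAdjunction_comp_heq O L.tan.adj L.tan.adj).symm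
      (oppositeAdjunction_comp_heq O L.tan.adj L.tan.adj).symm
      ((mapComp_inv_comp_heq O.opp _).trans (comp_mapComp_hom_heq O.opp _))))

/-- The opposite of the opposite of a lax tangent morphism. -/
abbrev LaxData.doubleOpposite (m : LaxData A B) :
    LaxData (TangentData.doubleOpposite O L) (TangentData.doubleOpposite O L') :=
  (m.opposite O L L').opposite O (TangentData.oppositeLeftAdjoints O L)
    (TangentData.oppositeLeftAdjoints O L')

/-- As for the structural 2-cells, the mate of the opposite of a mate is the opposite of the
original law. -/
theorem doubleOpposite_α_heq (m : LaxData A B) :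
    (m.doubleOpposite O L L').α ≍ Tangentad.doubleOpposite O m.α := by
  refine HEq.trans (b := O.opp.map₂ (Co.hom₂ ((mateEquiv (oppositeAdjunction O L.tan.adj)
    (oppositeAdjunction O L'.tan.adj)).symm (m.opposite O L L').α)))
    ((mapComp_inv_comp_heq O.opp _).trans (comp_mapComp_hom_heq O.opp _)) ?_
  refine map₂_heq O.opp (congrArg op (O.opp.map_comp _ _).symm)
    (congrArg op (O.opp.map_comp _ _).symm) (coHom₂_heq (O.opp.map_comp _ _).symm
    (O.opp.map_comp _ _).symm ?_)
  refine (heq_of_eq (mateEquiv_oppositeAdjunction_symm O L.tan.adj L'.tan.adj m.α)).trans ?_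
  exact (mapComp_inv_comp_heq O.opp _).trans
    (comp_mapComp_hom_heq O.opp (f := Co.hom A.T) (g := Co.hom m.F) _)

end

end Tangentad

namespace Tangentad

open TwoCat BundleData

/-! ## 2-natural isomorphisms -/

section

variable {K : Type u} [Bicategory.{w, v} K] {K' : Type u'} [Bicategory.{w', v'} K']

theorem coUn₂_heq {a b : Co K} {f f' g g' : a ⟶ b} {η : f ⟶ g} {η' : f' ⟶ g'} (hf : f = f')
    (hg : g = g') (h : η ≍ η') : Co.un₂ η ≍ Co.un₂ η' := by
  subst hf hg h; rfl

theorem twoNatIso_heq {F G : StrictPseudofunctor K K'} (t : TwoNatIso F G) {a b : K}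
    {f g : a ⟶ b} (η : f ⟶ g) : F.map₂ η ▷ t.app b ≍ t.app a ◁ G.map₂ η :=
  (comp_eqToHom_eq_iff_heq _ _).1 (t.naturality₂ η)

variable [Bicategory.Strict K']

/-- Whiskering the naturality square with `p'` on one side and `q'` on the other cancels `p` and
`q`. -/
theorem whisker_inv_heq {a b c d : K'} {f g : a ⟶ c} {f' g' : b ⟶ d} {η : f ⟶ g} {η' : f' ⟶ g'}
    {p : a ⟶ b} {q : c ⟶ d} {p' : b ⟶ a} {q' : d ⟶ c} (hp : p' ≫ p = 𝟙 b) (hq : q ≫ q' = 𝟙 c)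
    (hf : f ≫ q = p ≫ f') (hg : g ≫ q = p ≫ g') (h : η ▷ q ≍ p ◁ η') :
    η' ▷ q' ≍ p' ◁ η := by
  have e {x : a ⟶ c} {x' : b ⟶ d} (hx : x ≫ q = p ≫ x') : x' ≫ q' = p' ≫ x := by
    rw [← Bicategory.Strict.id_comp x', ← hp, Bicategory.Strict.assoc p', ← hx,
      Bicategory.Strict.assoc, Bicategory.Strict.assoc, hq, Bicategory.Strict.comp_id]
  have e' {x : a ⟶ c} : x = x ≫ q ≫ q' := by rw [hq, Bicategory.Strict.comp_id]
  have h₁ : p' ◁ η ≍ p' ◁ (η ▷ q ▷ q') := by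
    refine whiskerLeft_heq rfl (e'.trans (Bicategory.Strict.assoc _ _ _).symm)
      (e'.trans (Bicategory.Strict.assoc _ _ _).symm) ?_
    refine HEq.trans ?_ (whiskerRight_comp_heq η q q')
    exact (whiskerRight_id_heq η).symm.trans (whiskerRight_heq hq.symm rfl rfl HEq.rfl)
  have h₂ : p' ◁ (η ▷ q ▷ q') ≍ p' ◁ ((p ◁ η') ▷ q') :=
    whiskerLeft_heq rfl (congrArg (· ≫ q') hf) (congrArg (· ≫ q') hg)
      (whiskerRight_heq rfl hf hg h)
  have h₃ : p' ◁ ((p ◁ η') ▷ q') ≍ p' ◁ p ◁ (η' ▷ q') :=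
    whiskerLeft_heq rfl (Bicategory.Strict.assoc _ _ _) (Bicategory.Strict.assoc _ _ _)
      (whisker_assoc_heq _ _ _)
  refine (h₁.trans (h₂.trans (h₃.trans ((comp_whiskerLeft_heq p' p _).symm.trans ?_)))).symm
  exact (whiskerLeft_heq hp rfl rfl HEq.rfl).trans (id_whiskerLeft_heq _)

variable {F G : StrictPseudofunctor K K'} (t : TwoNatIso F G)

theorem twoNatIso_inv_naturality {a b : K} (f : a ⟶ b) :
    G.map f ≫ t.inv b = t.inv a ≫ F.map f := by
  rw [← Bicategory.Strict.id_comp (G.map f), ← t.inv_app, Bicategory.Strict.assoc (t.inv a),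
    ← t.naturality, Bicategory.Strict.assoc, Bicategory.Strict.assoc, t.app_inv,
    Bicategory.Strict.comp_id]

/-- The inverse of a 2-natural isomorphism. -/
def twoNatIsoSymm : TwoNatIso G F where
  app := t.inv
  inv := t.app
  app_inv := t.inv_app
  inv_app := t.app_inv
  naturality := twoNatIso_inv_naturality t
  naturality₂ {a b _ _} η := (comp_eqToHom_eq_iff_heq _ _).2
    (whisker_inv_heq (t.inv_app a) (t.app_inv b) (t.naturality _) (t.naturality _)
      (twoNatIso_heq t η))

/-- A 2-functor `K^co ⟶ K` with a comparison to its double is a 2-equivalence. -/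
theorem isTwoEquivalence_of_twoNatIso [Bicategory.Strict K] (F : StrictPseudofunctor (Co K) K)
    (t : TwoNatIso (StrictPseudofunctor.id (Co K)) (F.comp (coFunctor F))) :
    IsTwoEquivalence F :=
  -- The second comparison is the inverse of `t` read in $\mathbf K$: passing to the co-dual
  -- reverses 2-cells but leaves the direction of the 1-cell components alone.
  ⟨coFunctor F, ⟨t⟩, ⟨twoNatIsoSymm
    { app := fun a => Co.un (t.app (Co.of a))
      inv := fun a => Co.un (t.inv (Co.of a))
      app_inv := fun a => congrArg Co.un (t.app_inv (Co.of a))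
      inv_app := fun a => congrArg Co.un (t.inv_app (Co.of a))
      naturality := fun f => congrArg Co.un (t.naturality (Co.hom f))
      naturality₂ := fun η => (comp_eqToHom_eq_iff_heq _ _).2
        (coUn₂_heq (t.naturality _) (t.naturality _) (twoNatIso_heq t (Co.hom₂ η))) }⟩⟩

end

variable {K : Type u} [Bicategory.{w, v} K] [Bicategory.Strict K] (O : OppositeObjects K)

/-! ## The comparison with the double opposite -/

section

/-- The comparison of an object with its double opposite. -/
abbrev xi (a : K) : a ⟶ O.opp.obj (Co.of (O.opp.obj (Co.of a))) := Co.un (O.ξ.app (Co.of a))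

/-- The inverse of the comparison of an object with its double opposite. -/
abbrev xiInv (a : K) : O.opp.obj (Co.of (O.opp.obj (Co.of a))) ⟶ a := Co.un (O.ξ.inv (Co.of a))

theorem xi_xiInv (a : K) : xi O a ≫ xiInv O a = 𝟙 a := congrArg Co.un (O.ξ.app_inv (Co.of a))

theorem xiInv_xi (a : K) : xiInv O a ≫ xi O a = 𝟙 _ := congrArg Co.un (O.ξ.inv_app (Co.of a))

theorem xi_naturality {a b : K} (f : a ⟶ b) :
    f ≫ xi O b = xi O a ≫ O.opp.map (Co.hom (O.opp.map (Co.hom f))) :=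
  congrArg Co.un (O.ξ.naturality (Co.hom f))

theorem xiInv_naturality {a b : K} (f : a ⟶ b) :
    O.opp.map (Co.hom (O.opp.map (Co.hom f))) ≫ xiInv O b = xiInv O a ≫ f :=
  congrArg Co.un (twoNatIso_inv_naturality O.ξ (Co.hom f))

theorem xi_heq {a b : K} {f g : a ⟶ b} (η : f ⟶ g) :
    η ▷ xi O b ≍ xi O a ◁ doubleOpposite O η :=
  coUn₂_heq (O.ξ.naturality _) (O.ξ.naturality _) (twoNatIso_heq O.ξ (Co.hom₂ η))

theorem xiInv_heq {a b : K} {f g : a ⟶ b} (η : f ⟶ g) :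
    doubleOpposite O η ▷ xiInv O b ≍ xiInv O a ◁ η :=
  whisker_inv_heq (xiInv_xi O a) (xi_xiInv O b) (xi_naturality O f) (xi_naturality O g)
    (xi_heq O η)

end

section

variable {A B : TangentData K} (L : A.LeftAdjoints) (L' : B.LeftAdjoints)

variable (A) in
/-- The comparison of a tangentad with its double opposite. -/
def zeta : LaxData A (TangentData.doubleOpposite O L) :=
  LaxData.strict (xi O A.X) (xi_naturality O A.T)

variable (A) in
/-- The inverse of the comparison of a tangentad with its double opposite. -/
def zetaInv : LaxData (TangentData.doubleOpposite O L) A :=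
  LaxData.strict (xiInv O A.X) (xiInv_naturality O A.T)

theorem zeta_comp_zetaInv : (zeta O A L).comp (zetaInv O A L) = LaxData.id A :=
  LaxData.strict_comp_strict _ _ _ _ (xi_xiInv O A.X)

theorem zetaInv_comp_zeta : (zetaInv O A L).comp (zeta O A L) = LaxData.id _ :=
  LaxData.strict_comp_strict _ _ _ _ (xiInv_xi O A.X)

theorem xi_heq_of_heq {a b : K} {f g : a ⟶ b} {f' g' : O.opp.obj (Co.of (O.opp.obj (Co.of a))) ⟶
    O.opp.obj (Co.of (O.opp.obj (Co.of b)))} {η : f ⟶ g} {θ : f' ⟶ g'}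
    (hf : f' = O.opp.map (Co.hom (O.opp.map (Co.hom f))))
    (hg : g' = O.opp.map (Co.hom (O.opp.map (Co.hom g)))) (h : θ ≍ doubleOpposite O η) :
    η ▷ xi O b ≍ xi O a ◁ θ :=
  (xi_heq O η).trans (whiskerLeft_heq rfl hf hg h).symm

theorem xiInv_heq_of_heq {a b : K} {f g : a ⟶ b}
    {f' g' : O.opp.obj (Co.of (O.opp.obj (Co.of a))) ⟶
      O.opp.obj (Co.of (O.opp.obj (Co.of b)))} {η : f ⟶ g} {θ : f' ⟶ g'}
    (hf : f' = O.opp.map (Co.hom (O.opp.map (Co.hom f))))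
    (hg : g' = O.opp.map (Co.hom (O.opp.map (Co.hom g)))) (h : θ ≍ doubleOpposite O η) :
    θ ▷ xiInv O b ≍ xiInv O a ◁ η :=
  (whiskerRight_heq rfl hf hg h).trans (xiInv_heq O η)

theorem doubleOpposite_map_id (a : K) : 𝟙 (O.opp.obj (Co.of (O.opp.obj (Co.of a)))) =
    O.opp.map (Co.hom (O.opp.map (Co.hom (𝟙 a)))) :=
  (congrArg (fun f => O.opp.map (Co.hom f)) (O.opp.map_id (Co.of a))).trans (O.opp.map_id _)
    |>.symm

theorem doubleOpposite_map_comp {a b c : K} (f : a ⟶ b) (g : b ⟶ c) :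
    O.opp.map (Co.hom (O.opp.map (Co.hom f))) ≫ O.opp.map (Co.hom (O.opp.map (Co.hom g))) =
      O.opp.map (Co.hom (O.opp.map (Co.hom (f ≫ g)))) :=
  (congrArg (fun f => O.opp.map (Co.hom f)) (O.opp.map_comp (Co.hom f) (Co.hom g))).trans
    (O.opp.map_comp _ _) |>.symm

/-- Each structural 2-cell of the double opposite is the double opposite of the original one, so
2-naturality of $\xi$ gives every hypothesis. -/
theorem zeta_isLax : (zeta O A L).IsLax :=
  LaxData.isLax_strict _ _ (xi_naturality O _)
    (xi_heq_of_heq O rfl (doubleOpposite_map_id O _) (doubleOpposite_proj_heq O L))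
    (fun i => xi_heq_of_heq O rfl rfl (doubleOpposite_π_heq O L 2 i))
    (xi_heq_of_heq O (doubleOpposite_map_id O _) rfl (doubleOpposite_zero_heq O L))
    (xi_heq_of_heq O rfl rfl (doubleOpposite_add_heq O L))
    (xi_heq_of_heq O rfl (doubleOpposite_map_comp O _ _) (doubleOpposite_l_heq O L))
    (xi_heq_of_heq O (doubleOpposite_map_comp O _ _) (doubleOpposite_map_comp O _ _)
      (doubleOpposite_c_heq O L))

theorem zetaInv_isLax : (zetaInv O A L).IsLax :=
  LaxData.isLax_strict _ _ (xiInv_naturality O _)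
    (xiInv_heq_of_heq O rfl (doubleOpposite_map_id O _) (doubleOpposite_proj_heq O L))
    (fun i => xiInv_heq_of_heq O rfl rfl (doubleOpposite_π_heq O L 2 i))
    (xiInv_heq_of_heq O (doubleOpposite_map_id O _) rfl (doubleOpposite_zero_heq O L))
    (xiInv_heq_of_heq O rfl rfl (doubleOpposite_add_heq O L))
    (xiInv_heq_of_heq O rfl (doubleOpposite_map_comp O _ _) (doubleOpposite_l_heq O L))
    (xiInv_heq_of_heq O (doubleOpposite_map_comp O _ _) (doubleOpposite_map_comp O _ _)
      (doubleOpposite_c_heq O L))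

theorem zeta_naturality (m : LaxData A B) :
    m.comp (zeta O B L') = (zeta O A L).comp (m.doubleOpposite O L L') :=
  LaxData.ext_heq (xi_naturality O m.F) ((LaxData.comp_strict_α_heq _ _ _).trans
    ((xi_heq_of_heq O (doubleOpposite_map_comp O _ _) (doubleOpposite_map_comp O _ _)
      (doubleOpposite_α_heq O L L' m)).trans (LaxData.strict_comp_α_heq
        (B := TangentData.doubleOpposite O L) (xi O A.X) (xi_naturality O A.T)
        (m.doubleOpposite O L L')).symm))

end

end Tangentad

namespace Tangentad

open TwoCat BundleData

variable {K : Type u} [Bicategory.{w, v} K] [Bicategory.Strict K] (O : OppositeObjects K)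

/-! ## Opposite objects for adjunctable tangentads -/

namespace Tng

/-- The opposite of a tangentad with chosen left adjoints. -/
abbrev oppositeTng (A : Tng K) (L : A.LeftAdjoints) : Tng K :=
  ⟨A.toTangentData.opposite O L, A.isTangentad.opposite O L⟩

/-- The opposite of a lax tangent morphism. -/
abbrev oppositeHom {A B : Tng K} (m : A ⟶ B) (L : A.LeftAdjoints) (L' : B.LeftAdjoints) :
    oppositeTng O A L ⟶ oppositeTng O B L' :=
  ⟨m.toLaxData.opposite O L L', m.isLax.opposite O L L'⟩

theorem oppositeHom_id {A : Tng K} (L : A.LeftAdjoints) :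
    oppositeHom O (𝟙 A) L L = 𝟙 (oppositeTng O A L) :=
  Tng.Hom.ext' (LaxData.opposite_id O L)

theorem oppositeHom_comp {A B C : Tng K} (m : A ⟶ B) (n : B ⟶ C) (L : A.LeftAdjoints)
    (L' : B.LeftAdjoints) (L'' : C.LeftAdjoints) :
    oppositeHom O (m ≫ n) L L'' = oppositeHom O m L L' ≫ oppositeHom O n L' L'' :=
  Tng.Hom.ext' (LaxData.opposite_comp O L L' L'' m.toLaxData n.toLaxData)

variable {A B : Tng K} (L : A.LeftAdjoints) (L' : B.LeftAdjoints)
  (M : (oppositeTng O A L).LeftAdjoints) (M' : (oppositeTng O B L').LeftAdjoints)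

/-- The left adjoints of an opposite tangentad induced by those of the tangentad. -/
abbrev leftAdjoints : (oppositeTng O A L).LeftAdjoints := TangentData.oppositeLeftAdjoints O L

/-- The comparison of a tangentad with its double opposite, for the induced left adjoints. -/
abbrev zetaHom : A ⟶ oppositeTng O (oppositeTng O A L) (leftAdjoints O L) :=
  ⟨zeta O A.toTangentData L, zeta_isLax O L⟩

/-- The inverse of `zetaHom`. -/
abbrev zetaInvHom : oppositeTng O (oppositeTng O A L) (leftAdjoints O L) ⟶ A :=
  ⟨zetaInv O A.toTangentData L, zetaInv_isLax O L⟩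

theorem zetaHom_zetaInvHom : zetaHom O L ≫ zetaInvHom O L = 𝟙 A :=
  Tng.Hom.ext' (zeta_comp_zetaInv O L)

theorem zetaInvHom_zetaHom : zetaInvHom O L ≫ zetaHom O L = 𝟙 _ :=
  Tng.Hom.ext' (zetaInv_comp_zeta O L)

theorem zetaHom_naturality (m : A ⟶ B) : m ≫ zetaHom O L' = zetaHom O L ≫
    oppositeHom O (oppositeHom O m L L') (leftAdjoints O L) (leftAdjoints O L') :=
  Tng.Hom.ext' (zeta_naturality O L L' m.toLaxData)

/-- The comparison of a tangentad with its double opposite. -/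
def comparison : A ⟶ oppositeTng O (oppositeTng O A L) M :=
  -- The second factor is the opposite of an identity taken between the induced left adjoints and
  -- the arbitrary choice `M`.
  zetaHom O L ≫ oppositeHom O (𝟙 (oppositeTng O A L)) (leftAdjoints O L) M

/-- The inverse of the comparison of a tangentad with its double opposite. -/
def comparisonInv : oppositeTng O (oppositeTng O A L) M ⟶ A :=
  oppositeHom O (𝟙 (oppositeTng O A L)) M (leftAdjoints O L) ≫ zetaInvHom O L

theorem comparison_F : (comparison O L M).F = xi O A.X :=
  (congrArg (xi O A.X ≫ ·) (O.opp.map_id _)).trans (Bicategory.Strict.comp_id _)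

/-- By functoriality the corrections between the two choices of left adjoints compose to the
opposite of an identity and cancel; the rest is invertibility of $\xi$. -/
theorem comparison_comparisonInv : comparison O L M ≫ comparisonInv O L M = 𝟙 A := by
  have h := oppositeHom_comp O (𝟙 (oppositeTng O A L)) (𝟙 _) (leftAdjoints O L) M (leftAdjoints O L)
  rw [Bicategory.Strict.comp_id, oppositeHom_id] at h
  rw [comparison, comparisonInv, Bicategory.Strict.assoc, ← Bicategory.Strict.assoc (oppositeHom ..),
    ← h, Bicategory.Strict.id_comp, zetaHom_zetaInvHom]

theorem comparisonInv_comparison : comparisonInv O L M ≫ comparison O L M = 𝟙 _ := by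
  have h := oppositeHom_comp O (𝟙 (oppositeTng O A L)) (𝟙 _) M (leftAdjoints O L) M
  rw [Bicategory.Strict.comp_id, oppositeHom_id] at h
  rw [comparison, comparisonInv, Bicategory.Strict.assoc,
    ← Bicategory.Strict.assoc (zetaInvHom O L), zetaInvHom_zetaHom, Bicategory.Strict.id_comp, ← h]

theorem comparison_naturality (m : A ⟶ B) : m ≫ comparison O L' M' =
    comparison O L M ≫ oppositeHom O (oppositeHom O m L L') M M' := by
  rw [comparison, comparison, ← Bicategory.Strict.assoc, zetaHom_naturality,
    Bicategory.Strict.assoc, Bicategory.Strict.assoc, ← oppositeHom_comp, ← oppositeHom_comp,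
    Bicategory.Strict.comp_id, Bicategory.Strict.id_comp]

end Tng

theorem AdjTng.un₂_eqToHom_hom_φ {A B : Co (AdjTng K)} {m n : A ⟶ B} (h : m = n)
    (h' : (Co.un n).hom.F = (Co.un m).hom.F) : (Co.un₂ (eqToHom h)).hom.φ = eqToHom h' := by
  subst h; rfl

variable (L : ∀ A : AdjTng K, A.tng.LeftAdjoints)

/-- The comparison of an adjunctable tangentad with its double opposite. -/
def adjComparison : TwoNatIso (StrictPseudofunctor.id (Co (AdjTng K)))
    ((oppositeFunctor O L).comp (coFunctor (oppositeFunctor O L))) where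
  app A := Co.hom (InducedBicategory.mkHom
    (Tng.comparison O (L A.as) (L ((oppositeFunctor O L).obj A))))
  inv A := Co.hom (InducedBicategory.mkHom
    (Tng.comparisonInv O (L A.as) (L ((oppositeFunctor O L).obj A))))
  app_inv A := congrArg Co.hom (InducedBicategory.hom_ext (Tng.comparison_comparisonInv O _ _))
  inv_app A := congrArg Co.hom (InducedBicategory.hom_ext (Tng.comparisonInv_comparison O _ _))
  naturality {A B} m := congrArg Co.hom (InducedBicategory.hom_ext
    (Tng.comparison_naturality O (L A.as) (L B.as) (L ((oppositeFunctor O L).obj A))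
      (L ((oppositeFunctor O L).obj B)) (Co.un m).hom))
  naturality₂ {A B m n} η := by
    -- The 2-naturality square concerns underlying 2-cells only, where the comparison is $\xi$
    -- itself.
    have hA := Tng.comparison_F O (L A.as) (L ((oppositeFunctor O L).obj A))
    have hB := Tng.comparison_F O (L B.as) (L ((oppositeFunctor O L).obj B))
    have h : (Co.un₂ η).hom.φ ▷ (Tng.comparison O (L B.as) (L ((oppositeFunctor O L).obj B))).F ≍
        (Tng.comparison O (L A.as) (L ((oppositeFunctor O L).obj A))).F ◁
          doubleOpposite O (Co.un₂ η).hom.φ :=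
      (whiskerRight_heq hB rfl rfl HEq.rfl).trans
        ((xi_heq O _).trans (whiskerLeft_heq hA rfl rfl HEq.rfl).symm)
    have e (k : A ⟶ B) : (Co.un k).hom.F ≫
        (Tng.comparison O (L B.as) (L ((oppositeFunctor O L).obj B))).F =
          (Tng.comparison O (L A.as) (L ((oppositeFunctor O L).obj A))).F ≫
            O.opp.map (Co.hom (O.opp.map (Co.hom (Co.un k).hom.F))) := by
      rw [hA, hB]
      exact xi_naturality O _
    refine Co.un₂_injective (AdjTng.hom₂_ext' ?_)
    refine (congrArg (· ≫ _) (AdjTng.un₂_eqToHom_hom_φ _ (e n).symm)).trans (Eq.trans ?_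
      (congrArg (_ ≫ ·) (AdjTng.un₂_eqToHom_hom_φ _ (e m).symm)).symm)
    exact ((comp_eqToHom_eq_iff_heq _ _).2 h.symm).symm

/-- Opposite objects on the 2-category of adjunctable tangentads. -/
def adjOppositeObjects : OppositeObjects (AdjTng K) where
  opp := oppositeFunctor O L
  isTwoEquivalence := isTwoEquivalence_of_twoNatIso _ (adjComparison O L)
  ξ := adjComparison O L

end Tangentad

/-! ### The main theorem -/

theorem mainTheorem7 {K : Type u} [Bicategory.{w, v} K] [Bicategory.Strict K]
    (O : TwoCat.OppositeObjects K) (L : ∀ A : Tangentad.AdjTng K, A.tng.LeftAdjoints) :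
    (∀ A : Tangentad.AdjTng K, (A.tng.flat (L A)).IsTangentad) ∧
    ∃ (h₀ : ∀ A : Tangentad.AdjTng K, (A.tng.opposite O (L A)).IsTangentad ∧
        (A.tng.opposite O (L A)).IsAdjunctable)
      (h₁ : ∀ (A B : Tangentad.AdjTng K) (m : A ⟶ B), (m.hom.opposite O (L A) (L B)).IsLax)
      (h₂ : ∀ (A B : Tangentad.AdjTng K) (m n : A ⟶ B) (η : m ⟶ n),
        Tangentad.LaxData.IsCompatible (n.hom.opposite O (L A) (L B))
          (m.hom.opposite O (L A) (L B)) (O.opp.map₂ (TwoCat.Co.hom₂ η.hom.φ)))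
      (O' : TwoCat.OppositeObjects (Tangentad.AdjTng K)),
      O'.opp.toPrelaxFunctorStruct = Tangentad.oppositeAssignment O L h₀ h₁ h₂ :=
  ⟨fun A => A.tng.isTangentad.flat (L A),
    fun A => ⟨A.tng.isTangentad.opposite O (L A),
      Tangentad.TangentData.opposite_isAdjunctable O (L A)⟩,
    fun A B m => m.hom.isLax.opposite O (L A) (L B),
    fun A B _ _ η => η.hom.isCompatible.opposite O (L A) (L B),
    -- The 2-functor extends `oppositeAssignment` by proofs and coherence cells only, so the
    -- underlying data agree by definition.
    Tangentad.adjOppositeObjects O L, rfl⟩
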